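/- Let $K$ be an algebraically closed field of characteristic $0$ (for instance $K=\overline{\mathbb Q}$). Varieties are irreducible varieties over $K$, i.e. integral separated schemes of finite type over $K$, and a connected commutative algebraic group is a commutative group object in this category of varieties, with multiplication maps $[m]$. A *cover* $\pi:Y\dashrightarrow X$ is a dominant rational map over $K$, of finite degree $\deg\pi=[K(Y):K(X)]$, between varieties. If $\pi:Y\dashrightarrow X$ is a cover of a connected commutative algebraic group $X$ and $m\ge 1$, let $[m]^*Y:=X\times_{[m],\pi}Y$, where $Y$ is replaced by the domain of definition of $\pi$ (so that $\pi$ is a morphism). We say that $\pi$ satisfies (PB) if $[m]^*Y$ is irreducible for every integer $m>0$. An isogeny is a surjective homomorphism of algebraic groups with finite kernel. **Proposition 2.1.** Let $X$ be a connected commutative algebraic group over $K$, and let $\pi:Y\dashrightarrow X$ be a cover of degree $d$. Then $\pi$ satisfies (PB) if and only if $[d]^*Y$ is irreducible. Moreover, there exist a connected commutative algebraic group $Z$ over $K$, an isogeny $\lambda:Z\to X$ and a cover $\rho:Y\dashrightarrow Z$ such that $\pi=\lambda\circ\rho$ as rational maps and $\rho$ satisfies (PB). -/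

import Mathlib

open CategoryTheory Limits MonoidalCategory CartesianMonoidalCategory AlgebraicGeometry
open scoped MonObj

universe u

namespace CoverPB

variable {K : Type u} [Field K]

/-- An irreducible variety over `K` (used for `K` algebraically closed): an integral scheme,
separated and of finite type over `K`. -/
class IsVariety (X : Over (Spec (.of K))) : Prop where
  isIntegral : IsIntegral X.left
  isSeparated : IsSeparated X.hom
  locallyOfFiniteType : LocallyOfFiniteType X.hom
  quasiCompact : QuasiCompact X.hom

attribute [instance] IsVariety.isIntegral IsVariety.isSeparated
  IsVariety.locallyOfFiniteType IsVariety.quasiCompact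

instance isSeparated_left (X : Over (Spec (.of K))) [IsVariety X] : X.left.IsSeparated := by
  constructor
  rw [← terminal.comp_from X.hom]
  infer_instance

/-- The multiplication-by-`m` morphism `[m] : X ⟶ X` of a commutative group scheme, i.e. the `m`-th
power of the identity in the group `X(X)` of `X`-valued points of `X`. -/
noncomputable def mulBy (X : Over (Spec (.of K))) [GrpObj X] [IsCommMonObj X] (m : ℕ) : X ⟶ X :=
  (𝟙 X : X ⟶ X) ^ m

/-- On `T`-valued points `[m]` is `t ↦ t ^ m` (the group law is written multiplicatively here). -/
theorem comp_mulBy {T X : Over (Spec (.of K))} [GrpObj X] [IsCommMonObj X] (m : ℕ) (t : T ⟶ X) :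
    t ≫ mulBy X m = t ^ m := by
  simp [mulBy, MonObj.comp_pow]

/-- The pull-back of rational functions along a rational map `f : Y ⤏ X`. The source is the local
ring of `X` at the image of the generic point of `Y`; for `f` dominant and `X` integral, this is
the function field of `X`. -/
noncomputable def functionFieldMap {Y X : Scheme.{u}} [IsIntegral Y] (f : Y ⤏ X) :
    X.presheaf.stalk (f.fromFunctionField (IsLocalRing.closedPoint Y.functionField)) ⟶
      Y.functionField :=
  Scheme.stalkClosedPointTo f.fromFunctionField

/-- The degree `[K(Y) : K(X)]` of a dominant rational map `f : Y ⤏ X` of integral schemes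
(meaningful when this extension is finite). -/
noncomputable def degree {Y X : Scheme.{u}} [IsIntegral Y] (f : Y ⤏ X) : ℕ :=
  letI := (functionFieldMap f).hom.toAlgebra
  Module.finrank
    (X.presheaf.stalk (f.fromFunctionField (IsLocalRing.closedPoint Y.functionField)))
    Y.functionField

/-- A cover: a dominant rational map over `K`, of finite degree, between irreducible varieties. -/
structure IsCover {Y X : Over (Spec (.of K))} [IsVariety Y] [IsVariety X]
    (π : Y.left ⤏ X.left) : Prop where
  isOver : π.compHom X.hom = Y.hom.toRationalMap
  dominant : π.IsDominant
  finite : (functionFieldMap π).hom.Finite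

/-- The pull-back `[m]^*Y = X ×_{[m],π} Y`, where `Y` is replaced by the domain of definition of the
rational map `π`, the largest open subset on which `π` is a morphism. -/
noncomputable def pullbackMulBy {Y X : Over (Spec (.of K))} [IsVariety Y] [IsVariety X]
    [GrpObj X] [IsCommMonObj X] (m : ℕ) (π : Y.left ⤏ X.left) : Scheme.{u} :=
  pullback (mulBy X m).left π.toPartialMap.hom

/-- Condition (PB): `[m]^*Y` is irreducible for every integer `m > 0`. -/
def SatisfiesPB {Y X : Over (Spec (.of K))} [IsVariety Y] [IsVariety X]
    [GrpObj X] [IsCommMonObj X] (π : Y.left ⤏ X.left) : Prop :=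
  ∀ m : ℕ, 0 < m → IrreducibleSpace (pullbackMulBy m π)

/-- An isogeny: a surjective homomorphism of algebraic groups whose (scheme-theoretic) kernel,
the fibre over the neutral element, is finite over `K`. -/
structure IsIsogeny {Z X : Over (Spec (.of K))} [GrpObj Z] [GrpObj X] (f : Z ⟶ X) : Prop where
  isMonHom : IsMonHom f
  surjective : Surjective f.left
  finite_kernel : IsFinite (pullback.snd f.left (η[X] : 𝟙_ (Over (Spec (.of K))) ⟶ X).left)

end CoverPB

/-! The criterion is turned into Galois theory. In characteristic 0 the morphism `[m]` is finite,
flat and surjective, and `[m]^* : K(X) → K(X)` is a Galois extension whose automorphisms are the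
translations by the `m`-torsion points, an abelian group. By flatness, `[m]^*Y` is irreducible
exactly when its fibre over the generic point of `Y` is, that is, when the spectrum of `K(X) ⊗
K(Y)`, formed over `K(X)` along `[m]^*` and `π^*`, is irreducible. Since `[m]^*` is Galois, this
means that no subfield of `K(Y)` strictly larger than `K(X)` embeds over `K(X)` into the extension
`[m]^*` (`irreducibleSpace_pullbackMulBy_iff`).

Criterion (`NoCommonSubextension.of_finrank`). Let `S ⊆ K(Y)` embed by `σ` into the extension
`[m]^*`. Then `[d]^* ∘ σ` embeds `S` into the abelian extension `[dm]^*`. The degree of `S` over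
`K(X)` divides `d`, so `d`-th powers in the Galois group fix the image of `S`. Every `m`-torsion
point is the `d`-th power of a `dm`-torsion point, so the image is fixed by all `m`-torsion and lies
in `[m]^* K(X)`. Dividing by `[m]^*` embeds `S` into the extension `[d]^*`, and the hypothesis for
`d` gives `S = K(X)`.

Factorization (`exists_isogeny_satisfiesPB`). Choose `S ⊆ K(Y)` maximal among the subfields that
embed over `K(X)` into some extension `[m]^*`. The image of `S` is the function field of a quotient
`Z` of `X` by a group of `m`-torsion points, and `[m]` factors as `X → Z → X` with the second map an
isogeny. The inclusion `S ⊆ K(Y)` gives `ρ : Y ⤏ Z`. A subfield of `K(Y)` violating (PB) for `ρ` at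
level `n` would embed into the extension `[nm]^*` of `K(X)`, against maximality.

The geometric input is of two kinds. Dominance of `[m]` is read off the cotangent space at the
neutral element, where `[m]` acts as multiplication by `m`; finiteness and flatness then spread from
a non-empty open set by translations. The quotient `Z` is the relative spectrum over `X` of the
sections of `[m]_* 𝒪_X` lying in the given subfield. Torsion points act freely, so `X → Z` is finite
étale, and the group law descends along it (`isEtaleQuotient_toSubfieldQuotient`,
`IsEtaleQuotient.exists_grpObj`). -/

namespace CoverPB

/-! ### Common subextensions and abelian Galois theory. -/

section FieldTheory

open scoped TensorProduct

/-- Two extensions `φ : k → L` and `ψ : k → M` have no common subextension: a subfield of `M`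
containing `k` which embeds into `L` over `k` is equal to `k`. -/
def NoCommonSubextension {k L M : Type*} [Field k] [Field L] [Field M]
    (φ : k →+* L) (ψ : k →+* M) : Prop :=
  ∀ (S : Subfield M) (h : ∀ x, ψ x ∈ S), (∃ σ : S →+* L, ∀ x, σ ⟨ψ x, h x⟩ = φ x) →
    S ≤ ψ.fieldRange

/-- A finite extension in characteristic 0 is separable, hence étale; its base change to `M` is
unramified over a field, and so reduced. -/
theorem isReduced_tensorProduct {k L M : Type*} [Field k] [Field L] [Field M] [Algebra k L]
    [Algebra k M] [CharZero k] [FiniteDimensional k L] : IsReduced (L ⊗[k] M) := by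
  have : Algebra.IsSeparable k L := inferInstance
  have : Algebra.FormallyEtale k L := Algebra.FormallyEtale.of_isSeparable k L
  have h : IsReduced (M ⊗[k] L) := by
    have : Algebra.FormallyUnramified M (M ⊗[k] L) := inferInstance
    exact Algebra.FormallyUnramified.isReduced_of_field M (M ⊗[k] L)
  exact isReduced_of_injective (Algebra.TensorProduct.comm k L M).toRingHom
    (Algebra.TensorProduct.comm k L M).injective

/-- The tensor product is reduced, so irreducible means domain, and a domain here is a field. Inside
an algebraic closure of `M` this is linear disjointness of `L` and `M`, which for Galois `L` amounts
to trivial intersection. Galois is needed only for the implication from trivial intersection to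
disjointness. -/
theorem irreducibleSpace_tensorProduct_iff {k L M : Type u} [Field k] [Field L] [Field M]
    [Algebra k L] [Algebra k M] [CharZero k] [FiniteDimensional k L] [FiniteDimensional k M]
    [IsGalois k L] :
    IrreducibleSpace (PrimeSpectrum (L ⊗[k] M)) ↔
      NoCommonSubextension (algebraMap k L) (algebraMap k M) := by
  have : IsReduced (L ⊗[k] M) := isReduced_tensorProduct
  constructor
  · intro hirr S hS hσ
    obtain ⟨σ, hσ⟩ := hσ
    have hd : IsDomain (L ⊗[k] M) := by
      rw [PrimeSpectrum.irreducibleSpace_iff_isPrime_nilradical, nilradical_eq_zero] at hirr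
      have : (⊥ : Ideal (L ⊗[k] M)).IsPrime := hirr
      exact IsDomain.of_bot_isPrime _
    have hf : IsField (L ⊗[k] M) :=
      Algebra.TensorProduct.isField_of_isAlgebraic k L M (Or.inl inferInstance)
    let F : IntermediateField k M := S.toIntermediateField hS
    let σ' : F →ₐ[k] L := { σ with commutes' := hσ }
    -- Making `L` an `F`-algebra through `σ'` forces the embedding `g` to send `σ x` to `x`, so each
    -- element of `S` lies in the intersection of the two images.
    let : Algebra F L := σ'.toRingHom.toAlgebra
    have : IsScalarTower k F L := .of_algebraMap_eq fun x => (σ'.commutes x).symm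
    have : Algebra.IsAlgebraic F L := Algebra.IsAlgebraic.tower_top (K := k) F
    have : Module.IsTorsionFree F (AlgebraicClosure M) :=
      Module.isTorsionFree_iff_algebraMap_injective.mpr (RingHom.injective _)
    let g : L →ₐ[F] AlgebraicClosure M := IsAlgClosed.lift
    have hdis := IntermediateField.LinearDisjoint.of_isField' hf (g.restrictScalars k)
      (IsScalarTower.toAlgHom k M (AlgebraicClosure M))
    have hbot := hdis.inf_eq_bot
    intro x hx
    have h1 : algebraMap M (AlgebraicClosure M) x ∈ (g.restrictScalars k).fieldRange ⊓
        (IsScalarTower.toAlgHom k M (AlgebraicClosure M)).fieldRange :=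
      ⟨⟨σ ⟨x, hx⟩, g.commutes (⟨x, hx⟩ : F)⟩, ⟨x, rfl⟩⟩
    rw [hbot, IntermediateField.mem_bot] at h1
    obtain ⟨y, hy⟩ := h1
    refine ⟨y, (algebraMap M (AlgebraicClosure M)).injective ?_⟩
    rw [← hy]
    exact (IsScalarTower.algebraMap_apply k M (AlgebraicClosure M) y).symm
  · intro h
    let iM : M →ₐ[k] AlgebraicClosure M := IsScalarTower.toAlgHom k M (AlgebraicClosure M)
    let iL : L →ₐ[k] AlgebraicClosure M := IsAlgClosed.lift
    have hbot : iL.fieldRange ⊓ iM.fieldRange = ⊥ := by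
      rw [eq_bot_iff]
      rintro _ ⟨⟨a, rfl⟩, ⟨b, hb⟩⟩
      let S : Subfield M := iL.fieldRange.toSubfield.comap iM.toRingHom
      let e : L ≃+* iL.toRingHom.fieldRange := RingHom.rangeRestrictFieldEquiv iL.toRingHom
      have key := h S (fun x => ⟨algebraMap k L x, by
          exact (iL.commutes x).trans (iM.commutes x).symm⟩)
        ⟨(e.symm : _ →+* L).comp ((iM.toRingHom.comp S.subtype).codRestrict iL.toRingHom.fieldRange fun x => x.2), by
          intro x
          refine (RingEquiv.symm_apply_eq e).mpr ?_
          apply Subtype.ext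
          exact (iM.commutes x).trans (iL.commutes x).symm⟩
      obtain ⟨c, hc⟩ := key (show b ∈ S from ⟨a, hb.symm⟩)
      rw [IntermediateField.mem_bot]
      refine ⟨c, ?_⟩
      rw [← hb, ← hc]
      exact (iM.commutes c).symm
    have : IsGalois k iL.fieldRange :=
      IsGalois.of_algEquiv (AlgEquiv.ofInjectiveField iL)
    have : FiniteDimensional k iL.fieldRange :=
      (AlgEquiv.ofInjectiveField iL).toLinearEquiv.finiteDimensional
    have : FiniteDimensional k iM.fieldRange :=
      (AlgEquiv.ofInjectiveField iM).toLinearEquiv.finiteDimensional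
    have hdis := IntermediateField.LinearDisjoint.of_inf_eq_bot hbot
    have hd := hdis.isDomain'
    exact PrimeSpectrum.irreducibleSpace

/-- A ring homomorphism of fields defining a finite Galois extension. -/
def IsFiniteGalois {k L : Type*} [Field k] [Field L] (φ : k →+* L) : Prop :=
  letI := φ.toAlgebra
  FiniteDimensional k L ∧ IsGalois k L

theorem IsFiniteGalois.mem_fieldRange {k L : Type*} [Field k] [Field L] {φ : k →+* L}
    (hφ : IsFiniteGalois φ) {x : L} (hx : ∀ g : L →+* L, g.comp φ = φ → g x = x) :
    x ∈ φ.fieldRange := by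
  let := φ.toAlgebra
  obtain ⟨_, _⟩ := hφ
  have := (IsGalois.mem_bot_iff_fixed (F := k) x).mpr fun g =>
    hx (g : L →+* L) (RingHom.ext g.commutes)
  obtain ⟨y, hy⟩ := IntermediateField.mem_bot.mp this
  exact ⟨y, hy⟩

/-- The Galois group is abelian, so the subgroup fixing `σ(S)` is normal. Its index is the degree of
`S`, which divides `d`; hence it contains all `d`-th powers. -/
theorem IsFiniteGalois.iterate_eq_of_finrank_dvd {k L S : Type*} [Field k] [Field L] [Field S]
    {φ : k →+* L} (hφ : IsFiniteGalois φ)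
    (hcomm : ∀ g h : L →+* L, g.comp φ = φ → h.comp φ = φ → g.comp h = h.comp g)
    (ψ : k →+* S) (σ : S →+* L) (hσ : σ.comp ψ = φ) {d : ℕ}
    (hd : (letI := ψ.toAlgebra; Module.finrank k S) ∣ d) (g : L →+* L) (hg : g.comp φ = φ)
    (x : S) : g^[d] (σ x) = σ x := by
  let := φ.toAlgebra
  let := ψ.toAlgebra
  obtain ⟨_, _⟩ := hφ
  let σ' : S →ₐ[k] L := { σ with commutes' := fun y => congr($hσ y) }
  let g' : L ≃ₐ[k] L := AlgEquiv.ofBijective { g with commutes' := fun y => congr($hg y) }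
    (Algebra.IsAlgebraic.algHom_bijective _)
  have hmul : ∀ a b : Gal(L/k), a * b = b * a := fun a b => by
    ext y
    exact congr($(hcomm (a : L →+* L) (b : L →+* L) (RingHom.ext a.commutes)
      (RingHom.ext b.commutes)) y)
  have hnormal : σ'.fieldRange.fixingSubgroup.Normal := ⟨fun n hn a => by
    rwa [hmul a n, mul_assoc, mul_inv_cancel, mul_one]⟩
  have hidx : σ'.fieldRange.fixingSubgroup.index ∣ d := by
    rw [← IntermediateField.finrank_eq_fixingSubgroup_index]
    exact (AlgEquiv.ofInjectiveField σ').toLinearEquiv.finrank_eq ▸ hd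
  have hmem : g' ^ d ∈ σ'.fieldRange.fixingSubgroup := by
    obtain ⟨c, rfl⟩ := hidx
    rw [pow_mul]
    exact pow_mem (Subgroup.pow_index_mem _ _) c
  have h1 := (IntermediateField.mem_fixingSubgroup_iff _ _).mp hmem (σ x) ⟨x, rfl⟩
  have h2 : ∀ (n : ℕ) (y : L), (g' ^ n) y = g^[n] y := by
    intro n
    induction n with
    | zero => intro y; rfl
    | succ n ih =>
      intro y
      rw [pow_succ, Function.iterate_succ_apply]
      exact ih _
  rw [← h2]
  exact h1

/-- Let an abelian divisible group `T` act on a field `k`, and let `φ m` be endomorphisms of `k`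
such that `φ m` is Galois with group the `m`-torsion of `T`. If an extension `ψ` of degree `d`
has no common subextension with `φ d` then it has none with any `φ m`. -/
theorem NoCommonSubextension.of_finrank {k M T : Type*} [Field k] [Field M] [CommGroup T]
    (a : T → k →+* k) (φ : ℕ → k →+* k) (hφ : ∀ m n, 0 < m → 0 < n → (φ m).comp (φ n) = φ (m * n))
    (hgal : ∀ m, 0 < m → IsFiniteGalois (φ m))
    (haut : ∀ m, 0 < m → ∀ g : k →+* k, g.comp (φ m) = φ m → ∃ t, t ^ m = 1 ∧ g = a t)
    (hmul : ∀ s t, (a s).comp (a t) = a (s * t)) (hone : a 1 = RingHom.id k)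
    (hfix : ∀ m t, 0 < m → t ^ m = 1 → (a t).comp (φ m) = φ m)
    (hdiv : ∀ m, 0 < m → ∀ t : T, ∃ s, s ^ m = t)
    (ψ : k →+* M) {d : ℕ} (hd : (letI := ψ.toAlgebra; Module.finrank k M) = d) (hd0 : 0 < d)
    (h : NoCommonSubextension (φ d) ψ) {m : ℕ} (hm : 0 < m) : NoCommonSubextension (φ m) ψ := by
  intro S hS hσ
  obtain ⟨σ, hσ⟩ := hσ
  let ψS : k →+* S := ψ.codRestrict S hS
  have hdvd : (letI := ψS.toAlgebra; Module.finrank k S) ∣ d := by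
    let := ψ.toAlgebra
    let := ψS.toAlgebra
    have : IsScalarTower k S M := .of_algebraMap_eq' rfl
    rw [← hd]
    exact ⟨_, (Module.finrank_mul_finrank k S M).symm⟩
  have hcomp : ((φ d).comp σ).comp ψS = φ (d * m) := by
    rw [← hφ d m hd0 hm, RingHom.comp_assoc]
    congr 1
    ext x
    exact hσ x
  have hcomm : ∀ g h : k →+* k, g.comp (φ (d * m)) = φ (d * m) → h.comp (φ (d * m)) = φ (d * m) →
      g.comp h = h.comp g := by
    intro g h hg hh
    obtain ⟨s, -, rfl⟩ := haut _ (Nat.mul_pos hd0 hm) g hg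
    obtain ⟨t, -, rfl⟩ := haut _ (Nat.mul_pos hd0 hm) h hh
    rw [hmul, hmul, mul_comm]
  have hiter : ∀ (t : T) (n : ℕ) (y : k), (a t)^[n] y = a (t ^ n) y := by
    intro t n
    induction n with
    | zero => intro y; simp [hone]
    | succ n ih =>
      intro y
      rw [Function.iterate_succ_apply, ih, pow_succ, ← hmul]
      rfl
  -- The range of `φ m` is the fixed field of the `m`-torsion. An `m`-torsion element is `s ^ d`
  -- with `s` of order dividing `d * m`, and `d`-th powers act trivially on the image of `S`.
  have hrange : ∀ x : S, φ d (σ x) ∈ (φ m).fieldRange := by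
    intro x
    refine (hgal m hm).mem_fieldRange fun g hg => ?_
    obtain ⟨t, ht, rfl⟩ := haut m hm g hg
    obtain ⟨s, rfl⟩ := hdiv d hd0 t
    rw [← hiter]
    exact (hgal (d * m) (Nat.mul_pos hd0 hm)).iterate_eq_of_finrank_dvd hcomm ψS _ hcomp hdvd (a s)
      (hfix _ _ (Nat.mul_pos hd0 hm) (by rw [pow_mul, ht])) x
  let e : k ≃+* (φ m).fieldRange := RingHom.rangeRestrictFieldEquiv (φ m)
  -- The new embedding is `φ m` inverted on `φ d ∘ σ`. It restricts to `φ d` on `k` because `φ d`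
  -- and `φ m` commute.
  refine h S hS ⟨(e.symm : _ →+* k).comp
    (((φ d).comp σ).codRestrict (φ m).fieldRange hrange), fun x => ?_⟩
  refine (RingEquiv.symm_apply_eq e).mpr (Subtype.ext ?_)
  change φ d (σ ⟨ψ x, hS x⟩) = φ m (φ d x)
  rw [hσ, ← RingHom.comp_apply, ← RingHom.comp_apply, hφ d m hd0 hm, hφ m d hm hd0, mul_comm]

end FieldTheory

/-! ### Finite groups acting freely on a ring: the extension of the invariants is étale. -/

section FreeAction

open scoped TensorProduct

variable {B G : Type*} [CommRing B] [Group G] (a : G →* (B →+* B))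

/-- For a finite group acting on a ring without fixed maximal ideals: finite families `x`, `y` with
`∑ x i * g (y i) = δ_{g,1}`. -/
theorem exists_sum_mul_eq_ite [Finite G] [DecidableEq G]
    (hfree : ∀ g, g ≠ 1 → ∀ P : Ideal B, P.IsMaximal → ∃ b, b - a g b ∉ P) :
    ∃ s : Finset (B × B), ∀ g, ∑ i ∈ s, i.1 * a g i.2 = if g = 1 then 1 else 0 := by
  have := Fintype.ofFinite G
  let Φ : B ⊗[ℤ] B →+* (G → B) := RingHom.pi fun g =>
    (Algebra.TensorProduct.lift (RingHom.id B).toIntAlgHom (a g).toIntAlgHom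
      fun _ _ => Commute.all _ _).toRingHom
  have hΦ : ∀ b c g, Φ (b ⊗ₜ c) g = b * a g c := fun b c g => rfl
  have hu : ∀ g, g ≠ 1 → ∃ w, Φ w 1 = 1 ∧ Φ w g = 0 := by
    intro g hg
    -- `I` consists of the values at `1` of the tensors that vanish at `g`. It contains every `b - a
    -- g b`, through `1 ⊗ b - a g b ⊗ 1`, so freeness forbids it to lie in a maximal ideal.
    -- Multiplying the resulting `u g` over all `g ≠ 1` gives the indicator of `1`.
    let I : Ideal B :=
      { carrier := {c | ∃ w, Φ w 1 = c ∧ Φ w g = 0}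
        add_mem' := by
          rintro _ _ ⟨w, rfl, hw⟩ ⟨w', rfl, hw'⟩
          exact ⟨w + w', by simp, by simp [hw, hw']⟩
        zero_mem' := ⟨0, by simp, by simp⟩
        smul_mem' := by
          rintro c _ ⟨w, rfl, hw⟩
          exact ⟨c ⊗ₜ 1 * w, by simp [hΦ], by simp [hw]⟩ }
    have hI : I = ⊤ := by
      by_contra hI
      obtain ⟨P, hP, hIP⟩ := Ideal.exists_le_maximal I hI
      obtain ⟨b, hb⟩ := hfree g hg P hP
      refine hb (hIP ⟨1 ⊗ₜ b - a g b ⊗ₜ 1, ?_, ?_⟩) <;> simp [hΦ]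
    exact (I.eq_top_iff_one.mp hI)
  choose! u hu1 hu0 using hu
  let w := ∏ g ∈ Finset.univ.erase 1, u g
  have hw : ∀ g, Φ w g = if g = 1 then 1 else 0 := by
    intro g
    rw [map_prod, Finset.prod_apply]
    split_ifs with hg
    · subst hg
      exact Finset.prod_eq_one fun h hh => hu1 h (Finset.ne_of_mem_erase hh)
    · exact Finset.prod_eq_zero (Finset.mem_erase.mpr ⟨hg, Finset.mem_univ g⟩) (hu0 g hg)
  obtain ⟨s, hs⟩ := TensorProduct.exists_finset w
  refine ⟨s, fun g => ?_⟩
  rw [← hw, hs, map_sum, Finset.sum_apply]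
  rfl

/-- The trace to the ring of invariants. -/
theorem exists_trace [Fintype G]
    {B₀ : Type*} [CommRing B₀] (i : B₀ →+* B) (hi : Function.Injective i)
    (hfix : ∀ g x, a g (i x) = i x) (hinv : ∀ b, (∀ g, a g b = b) → b ∈ i.range) :
    ∃ tr : (letI := i.toAlgebra; B →ₗ[B₀] B₀),
    ∀ b, i (tr b) = ∑ g, a g b := by
  let := i.toAlgebra
  have h : ∀ b, ∑ g, a g b ∈ i.range := by
    intro b
    refine hinv _ fun h => ?_
    rw [map_sum]
    refine Fintype.sum_equiv (Equiv.mulLeft h) _ _ fun g => ?_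
    simp
  choose t ht using h
  refine ⟨{ toFun := t, map_add' := fun b c => hi ?_, map_smul' := fun r b => hi ?_ }, ht⟩
  · simp [ht, Finset.sum_add_distrib]
  · simp [ht, Finset.mul_sum, Algebra.smul_def, RingHom.algebraMap_toAlgebra, hfix]

/-- With `x`, `y` as in `exists_sum_mul_eq_ite`, one has `b = ∑ tr (y j * b) • x j`. This dual basis
exhibits `B` as a direct summand of a finite free module over the invariants. -/
theorem flat_of_free_action [Finite G]
    {B₀ : Type*} [CommRing B₀] (i : B₀ →+* B) (hi : Function.Injective i)
    (hfix : ∀ g x, a g (i x) = i x) (hinv : ∀ b, (∀ g, a g b = b) → b ∈ i.range)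
    (hfree : ∀ g, g ≠ 1 → ∀ P : Ideal B, P.IsMaximal → ∃ b, b - a g b ∉ P) : i.Flat := by
  classical
  have := Fintype.ofFinite G
  let := i.toAlgebra
  obtain ⟨s, hs⟩ := exists_sum_mul_eq_ite a hfree
  obtain ⟨tr, htr⟩ := exists_trace a i hi hfix hinv
  have hexp : ∀ b : B, ∑ j ∈ s, tr (j.2 * b) • j.1 = b := by
    intro b
    simp only [Algebra.smul_def, RingHom.algebraMap_toAlgebra, htr, map_mul, Finset.sum_mul]
    rw [Finset.sum_comm]
    have : ∀ g, ∑ j ∈ s, a g j.2 * a g b * j.1 = if g = 1 then b else 0 := by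
      intro g
      have := congr($(hs g) * a g b)
      rw [Finset.sum_mul] at this
      rw [← Finset.sum_congr rfl fun j _ => show j.1 * a g j.2 * a g b = _ by ring, this]
      split_ifs with hg
      · simp [hg]
      · simp
    simp [this]
  let f : B →ₗ[B₀] (s → B₀) := LinearMap.pi fun j => tr ∘ₗ LinearMap.mulLeft B₀ j.1.2
  let g : (s → B₀) →ₗ[B₀] B := Fintype.linearCombination B₀ fun j : s => j.1.1
  have hgf : g ∘ₗ f = LinearMap.id := by
    ext b
    simp only [LinearMap.comp_apply, LinearMap.id_apply, g, f, Fintype.linearCombination_apply]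
    conv_rhs => rw [← hexp b]
    exact Finset.sum_coe_sort s fun j => tr (j.2 * b) • j.1
  have : Module.Projective B₀ B := Module.Projective.of_split f g hgf
  exact (inferInstance : Module.Flat B₀ B)

/-- The element `∑ x j ⊗ y j` is the idempotent cutting out the diagonal of `B ⊗ B`. Its identities
are checked after applying `Ψ`, which maps into functions on `G` and is injective because `hexp`
recovers `c` from `Ψ c`. -/
theorem formallyUnramified_of_free_action [Finite G]
    {B₀ : Type*} [CommRing B₀] (i : B₀ →+* B) (hfin : i.Finite) (hi : Function.Injective i)
    (hfix : ∀ g x, a g (i x) = i x) (hinv : ∀ b, (∀ g, a g b = b) → b ∈ i.range)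
    (hfree : ∀ g, g ≠ 1 → ∀ P : Ideal B, P.IsMaximal → ∃ b, b - a g b ∉ P) :
    i.FormallyUnramified := by
  classical
  have := Fintype.ofFinite G
  let := i.toAlgebra
  have : Module.Finite B₀ B := hfin
  obtain ⟨s, hs⟩ := exists_sum_mul_eq_ite a hfree
  obtain ⟨tr, htr⟩ := exists_trace a i hi hfix hinv
  let Ψ : B ⊗[B₀] B →+* (G → B) := RingHom.pi fun g =>
    (Algebra.TensorProduct.lift (AlgHom.id B₀ B) { a g with commutes' := hfix g }
      fun _ _ => Commute.all _ _).toRingHom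
  have hΨ : ∀ b c g, Ψ (b ⊗ₜ c) g = b * a g c := fun b c g => rfl
  have hexp : ∀ c : B ⊗[B₀] B, ∑ j ∈ s, (∑ g, a g j.2 * Ψ c g) ⊗ₜ[B₀] j.1 = c := by
    intro c
    induction c with
    | zero => simp
    | add x y hx hy =>
      conv_rhs => rw [← hx, ← hy]
      simp only [map_add, Pi.add_apply, mul_add, Finset.sum_add_distrib, TensorProduct.add_tmul]
    | tmul b c =>
      have h1 : ∀ j : B × B, ∑ g, a g j.2 * Ψ (b ⊗ₜ c) g = tr (j.2 * c) • b := by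
        intro j
        rw [Algebra.smul_def, RingHom.algebraMap_toAlgebra, htr, Finset.sum_mul]
        refine Finset.sum_congr rfl fun g _ => ?_
        rw [hΨ, map_mul]
        ring
      simp only [h1, TensorProduct.smul_tmul, ← TensorProduct.tmul_sum]
      congr 1
      simp only [Algebra.smul_def, RingHom.algebraMap_toAlgebra, htr, map_mul, Finset.sum_mul]
      rw [Finset.sum_comm]
      have : ∀ g, ∑ j ∈ s, a g j.2 * a g c * j.1 = if g = 1 then c else 0 := by
        intro g
        have := congr($(hs g) * a g c)
        rw [Finset.sum_mul] at this
        rw [← Finset.sum_congr rfl fun j _ => show j.1 * a g j.2 * a g c = _ by ring, this]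
        split_ifs with hg
        · simp [hg]
        · simp
      simp [this]
  have hker : ∀ c, Ψ c = 0 → c = 0 := fun c hc => by
    rw [← hexp c, hc]
    simp
  refine Algebra.FormallyUnramified.iff_exists_tensorProduct.mpr
    ⟨∑ j ∈ s, j.1 ⊗ₜ j.2, fun c => hker _ (funext fun g => ?_), ?_⟩
  · have h1 : Ψ (∑ j ∈ s, j.1 ⊗ₜ j.2) g = if g = 1 then 1 else 0 := by
      rw [map_sum, Finset.sum_apply, ← hs g]
      exact Finset.sum_congr rfl fun j _ => hΨ _ _ _
    rw [map_mul, Pi.mul_apply, h1, map_sub, Pi.sub_apply, hΨ, hΨ]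
    split_ifs with hg
    · simp [hg]
    · simp
  · rw [map_sum]
    simpa using hs 1

end FreeAction

/-- If a finite group `G` acts on `B` without fixed maximal ideals, and two points of `B` in the
same `G`-orbit agree on the invariants of a subgroup, then they are in the same orbit of it. -/
theorem mem_of_eq_on_invariants {B G E : Type*} [CommRing B] [Group G] [Finite G] [CommRing E]
    [Nontrivial E] (a : G →* (B →+* B))
    (hfree : ∀ g, g ≠ 1 → ∀ P : Ideal B, P.IsMaximal → ∃ b, b - a g b ∉ P)
    (H : Subgroup G) (α : B →+* E) (g : G)
    (h : ∀ b, (∀ h ∈ H, a h b = b) → α b = α (a g b)) : g ∈ H := by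
  classical
  have := Fintype.ofFinite G
  obtain ⟨s, hs⟩ := exists_sum_mul_eq_ite a hfree
  -- The sums of `y j` over `H` are `H`-invariant, so `α` does not distinguish them from their
  -- translates by `g`. Evaluating the same sum both ways gives `1` on one side and the number of `h
  -- ∈ H` with `g * h = 1` on the other, which is `0` if `g ∉ H`.
  have h1 : ∑ j ∈ s, α j.1 * α (∑ h : H, a h j.2) = 1 := by
    simp only [← map_mul, ← map_sum, Finset.mul_sum]
    rw [Finset.sum_comm]
    simp [hs]
  have h2 : ∑ j ∈ s, α j.1 * α (a g (∑ h : H, a h j.2)) = ∑ h : H, if g * h = 1 then 1 else 0 := by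
    have hg : ∀ j : B × B, j.1 * a g (∑ h : H, a h j.2) = ∑ h : H, j.1 * a g (a h j.2) :=
      fun j => by rw [map_sum, Finset.mul_sum]
    simp only [← map_mul, hg]
    rw [← map_sum, Finset.sum_comm]
    have : ∀ h : H, ∑ j ∈ s, j.1 * a g (a h j.2) = if g * h = 1 then 1 else 0 := by
      intro h
      rw [← hs, map_mul]
      rfl
    simp [this]
  have h3 : ∀ j : B × B, α (∑ h : H, a h j.2) = α (a g (∑ h : H, a h j.2)) := by
    intro j
    refine h _ fun x hx => ?_
    rw [map_sum]
    refine Fintype.sum_equiv (Equiv.mulLeft (⟨x, hx⟩ : H)) _ _ fun g => ?_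
    simp
  simp only [← h3, h1] at h2
  by_contra hg
  have : ∀ h : H, g * h ≠ 1 := fun h hh => hg (by
    rw [eq_inv_of_mul_eq_one_left hh]
    exact inv_mem h.2)
  simp [this] at h2


/-! ### Generic points, function fields and generic fibres. -/

section GenericPoint

open IsLocalRing

variable {X X' : Scheme.{u}}

/-- The closed point of the spectrum of a local ring. -/
def closedPt (R : CommRingCat.{u}) [IsLocalRing R] : ↥(Spec R) := closedPoint R

theorem fromSpecStalk_closedPt (x : X) : X.fromSpecStalk x (closedPt _) = x :=
  Scheme.fromSpecStalk_closedPoint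

theorem exists_lift_fromSpecStalk {R : CommRingCat.{u}} [IsLocalRing R] (g : Spec R ⟶ X) {x : X}
    (h : g (closedPt R) = x) :
    ∃ φ : X.presheaf.stalk x ⟶ R, Spec.map φ ≫ X.fromSpecStalk x = g := by
  subst h
  exact ⟨_, Scheme.Spec_stalkClosedPointTo_fromSpecStalk g⟩

theorem map_fromSpecStalk_injective {R : CommRingCat.{u}} {x : X}
    {φ ψ : X.presheaf.stalk x ⟶ R}
    (h : Spec.map φ ≫ X.fromSpecStalk x = Spec.map ψ ≫ X.fromSpecStalk x) : φ = ψ :=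
  Spec.map_injective ((cancel_mono _).mp h)

/-- The generic point of an integral scheme. -/
noncomputable def gen (X : Scheme.{u}) [IsIntegral X] : Spec X.functionField ⟶ X :=
  X.fromSpecStalk (genericPoint X)

instance [IsIntegral X] : IsPreimmersion (gen X) :=
  inferInstanceAs (IsPreimmersion (X.fromSpecStalk _))

theorem gen_apply [IsIntegral X] (y : Spec X.functionField) : gen X y = genericPoint X := by
  have : Subsingleton ↥(Spec X.functionField) :=
    inferInstanceAs (Subsingleton (PrimeSpectrum X.functionField))
  rw [Subsingleton.elim y (closedPt X.functionField)]
  exact fromSpecStalk_closedPt _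

theorem isDominant_of_apply_eq_genericPoint [IsIntegral X'] (f : X ⟶ X') (x : X)
    (h : f x = genericPoint X') : IsDominant f := by
  refine ⟨dense_iff_closure_eq.mpr (Set.eq_univ_of_univ_subset ?_)⟩
  rw [← genericPoint_closure (α := X')]
  exact closure_mono (Set.singleton_subset_iff.mpr ⟨x, h⟩)

instance [IsIntegral X] : IsDominant (gen X) :=
  isDominant_of_apply_eq_genericPoint _ (closedPt X.functionField) (gen_apply _)

theorem apply_genericPoint [IsIntegral X] [IsIntegral X'] (f : X ⟶ X') [IsDominant f] :
    f (genericPoint X) = genericPoint X' := by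
  have h := (genericPoint_spec X).image f.continuous
  rw [Set.image_univ, f.denseRange.closure_range] at h
  exact h.eq (genericPoint_spec X')

theorem isDominant_iff_apply_genericPoint [IsIntegral X] [IsIntegral X'] (f : X ⟶ X') :
    IsDominant f ↔ f (genericPoint X) = genericPoint X' :=
  ⟨fun _ => apply_genericPoint f, isDominant_of_apply_eq_genericPoint f _⟩

/-- The map of function fields induced by a dominant morphism. -/
noncomputable def funMap [IsIntegral X] [IsIntegral X'] (f : X ⟶ X') [IsDominant f] :
    X'.functionField ⟶ X.functionField :=
  (exists_lift_fromSpecStalk (gen X ≫ f) (x := genericPoint X') (by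
    rw [Scheme.Hom.comp_apply, gen_apply, apply_genericPoint])).choose

theorem map_funMap_gen [IsIntegral X] [IsIntegral X'] (f : X ⟶ X') [IsDominant f] :
    Spec.map (funMap f) ≫ gen X' = gen X ≫ f :=
  (exists_lift_fromSpecStalk (gen X ≫ f) (x := genericPoint X') (by
    rw [Scheme.Hom.comp_apply, gen_apply, apply_genericPoint])).choose_spec

theorem map_gen_injective [IsIntegral X] {R : CommRingCat.{u}} {φ ψ : X.functionField ⟶ R}
    (h : Spec.map φ ≫ gen X = Spec.map ψ ≫ gen X) : φ = ψ :=
  map_fromSpecStalk_injective h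

theorem funMap_comp {X'' : Scheme.{u}} [IsIntegral X] [IsIntegral X'] [IsIntegral X'']
    (f : X ⟶ X') (g : X' ⟶ X'') [IsDominant f] [IsDominant g] :
    funMap (f ≫ g) = funMap g ≫ funMap f := by
  apply map_gen_injective
  rw [map_funMap_gen, Spec.map_comp, Category.assoc, map_funMap_gen,
    ← Category.assoc, ← Category.assoc, map_funMap_gen]

theorem funMap_id [IsIntegral X] : funMap (𝟙 X) = 𝟙 _ := by
  apply map_gen_injective
  rw [map_funMap_gen]
  simp

theorem funMap_congr [IsIntegral X] [IsIntegral X'] {f g : X ⟶ X'} (h : f = g) [IsDominant f]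
    [IsDominant g] : funMap f = funMap g := by
  subst h
  rfl

/-- Compatibility of `funMap` with sections over an open subset. -/
theorem germ_funMap [IsIntegral X] [IsIntegral X'] (f : X ⟶ X') [IsDominant f]
    (U : X'.Opens) (hU : genericPoint X' ∈ U) (hU' : genericPoint X ∈ f ⁻¹ᵁ U) :
    X'.presheaf.germ U _ hU ≫ funMap f = f.app U ≫ X.presheaf.germ (f ⁻¹ᵁ U) _ hU' := by
  -- The point `f (genericPoint X)` equals `genericPoint X'` only propositionally, and the stalk
  -- depends on it. The point is made a variable so that the equality can be substituted.
  have key : ∀ (x' : X') (hx : f (genericPoint X) = x') (hxU : x' ∈ U)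
      (φ : X'.presheaf.stalk x' ⟶ X.functionField)
      (_ : Spec.map φ ≫ X'.fromSpecStalk x' = gen X ≫ f),
      X'.presheaf.germ U _ hxU ≫ φ = f.app U ≫ X.presheaf.germ (f ⁻¹ᵁ U) _ hU' := by
    rintro _ rfl hxU φ h
    have : φ = f.stalkMap (genericPoint X) := by
      apply map_fromSpecStalk_injective
      rw [h, Scheme.SpecMap_stalkMap_fromSpecStalk]
      rfl
    rw [this, Scheme.Hom.germ_stalkMap]
  exact key _ (apply_genericPoint f) hU _ (map_funMap_gen f)

/-- Generalizations lift along the flat `w`, so every point of `W` is a specialization of a point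
over the generic point of `U`. Thus `W` is the closure of its generic fibre, and the two are
irreducible together. -/
theorem irreducibleSpace_iff_pullback {W U : Scheme.{u}} [IsIntegral U] (w : W ⟶ U) [Flat w]
    {P : Scheme.{u}} (κ : P ⟶ U) [IsPreimmersion κ] (hrng : Set.range κ = {genericPoint U}) :
    IrreducibleSpace W ↔ IrreducibleSpace ↥(pullback w κ) := by
  have hemb : Topology.IsEmbedding (pullback.fst w κ) := (pullback.fst w κ).isEmbedding
  have hrange : Set.range (pullback.fst w κ) = w ⁻¹' {genericPoint U} := by
    rw [Scheme.Pullback.range_fst, hrng]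
  have h1 : IrreducibleSpace ↥(pullback w κ) ↔ IsIrreducible (w ⁻¹' {genericPoint U}) := by
    rw [← hrange, ← Set.image_univ]
    constructor
    · intro h
      exact (IrreducibleSpace.isIrreducible_univ _).image _ hemb.continuous.continuousOn
    · intro h
      rw [Set.image_univ] at h
      have := Subtype.irreducibleSpace h
      exact hemb.toHomeomorph.symm.surjective.irreducibleSpace hemb.toHomeomorph.symm.continuous
  have hgen : ∀ y : W, ∃ z : W, z ⤳ y ∧ w z = genericPoint U := fun y =>
    (Flat.generalizingMap w) (genericPoint_specializes (w y))
  rw [h1]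
  constructor
  · intro h
    obtain ⟨z, hz, hz'⟩ := hgen (genericPoint W)
    rw [isIrreducible_iff_closure.symm]
    convert! IrreducibleSpace.isIrreducible_univ W
    refine Set.eq_univ_of_univ_subset ?_
    rw [← genericPoint_closure (α := W)]
    refine (closure_minimal (Set.singleton_subset_iff.mpr ?_) isClosed_closure)
    exact hz.mem_closed isClosed_closure (subset_closure hz')
  · intro h
    rw [irreducibleSpace_def]
    convert! h.closure
    refine (Set.eq_univ_of_univ_subset fun y _ => ?_).symm
    obtain ⟨z, hz, hz'⟩ := hgen y
    exact hz.mem_closed isClosed_closure (subset_closure hz')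

/-- Every non-zero element of `B` divides a non-zero element of `A`, so inverting the latter already
produces the fraction field of `B`. -/
theorem isLocalization_of_isIntegral {A B L : Type*} [CommRing A] [IsDomain A] [CommRing B]
    [IsDomain B] [Field L] [Algebra A B] [Algebra B L] [IsFractionRing B L] [Algebra.IsIntegral A B]
    (hinj : Function.Injective (algebraMap A B)) :
    IsLocalization (Algebra.algebraMapSubmonoid B (nonZeroDivisors A)) L := by
  have hle : Algebra.algebraMapSubmonoid B (nonZeroDivisors A) ≤ nonZeroDivisors B := by
    rintro _ ⟨x, hx, rfl⟩
    rw [mem_nonZeroDivisors_iff_ne_zero]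
    have hx := nonZeroDivisors.ne_zero hx
    exact fun h => hx (hinj (by simpa using h))
  have := (faithfulSMul_iff_algebraMap_injective A B).mpr hinj
  refine ⟨⟨fun y => ?_, fun z => ?_, fun {x y} h => ?_⟩⟩
  · exact IsLocalization.map_units L (⟨y.1, hle y.2⟩ : nonZeroDivisors B)
  · obtain ⟨⟨b, s⟩, hb⟩ := IsLocalization.surj (nonZeroDivisors B) z
    obtain ⟨r, hr, c, hc⟩ := (Algebra.IsAlgebraic.isAlgebraic (R := A) s.1).exists_nonzero_dvd s.2
    refine ⟨⟨b * c, ⟨algebraMap A B r, r, mem_nonZeroDivisors_of_ne_zero hr, rfl⟩⟩, ?_⟩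
    simp only [hc, map_mul] at hb ⊢
    rw [← hb]
    ring
  · exact ⟨1, by simpa using IsFractionRing.injective B L h⟩

theorem genericPoint_mem [IsIntegral X] (U : X.Opens) [h : Nonempty U] : genericPoint X ∈ U :=
  ((genericPoint_spec X).mem_open_set_iff U.isOpen).mpr (by simpa using h)

/-- The generic fibre of an integral dominant morphism of integral schemes. -/
theorem isPullback_gen [IsIntegral X] [IsIntegral X'] (f : X ⟶ X') [IsDominant f]
    [IsIntegralHom f] : IsPullback (gen X) (Spec.map (funMap f)) f (gen X') := by
  obtain ⟨_, ⟨V, hV, rfl⟩, hVx, -⟩ := X'.isBasis_affineOpens.exists_subset_of_mem_open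
    (Set.mem_univ (genericPoint X')) isOpen_univ
  have hVx : genericPoint X' ∈ V := hVx
  have hV : IsAffineOpen V := hV
  have hf := hV.preimage f
  have hfx : genericPoint X ∈ f ⁻¹ᵁ V := by
    change f (genericPoint X) ∈ V
    rwa [apply_genericPoint f]
  have : Nonempty V := ⟨⟨_, hVx⟩⟩
  have : Nonempty (f ⁻¹ᵁ V) := ⟨⟨_, hfx⟩⟩
  have h1 : IsPullback hf.fromSpec (Spec.map (f.app V)) f hV.fromSpec := by
    refine (IsOpenImmersion.isPullback _ _ _ _ ?_ ?_).flip
    · rw [← IsAffineOpen.SpecMap_appLE_fromSpec f hV hf le_rfl, Scheme.Hom.app_eq_appLE]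
    · simp
  let := (f.app V).hom.toAlgebra
  let := (X'.presheaf.germ V _ hVx).hom.toAlgebra
  let := (X.presheaf.germ (f ⁻¹ᵁ V) _ hfx).hom.toAlgebra
  let := (funMap f).hom.toAlgebra
  let := (f.app V ≫ X.presheaf.germ (f ⁻¹ᵁ V) _ hfx).hom.toAlgebra
  have : IsScalarTower Γ(X', V) Γ(X, f ⁻¹ᵁ V) X.functionField := .of_algebraMap_eq' rfl
  have : IsScalarTower Γ(X', V) X'.functionField X.functionField :=
    .of_algebraMap_eq' congr(($(germ_funMap f V hVx hfx)).hom).symm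
  have : IsFractionRing Γ(X', V) X'.functionField :=
    functionField_isFractionRing_of_isAffineOpen X' V hV
  have : IsFractionRing Γ(X, f ⁻¹ᵁ V) X.functionField :=
    functionField_isFractionRing_of_isAffineOpen X _ hf
  have : Algebra.IsIntegral Γ(X', V) Γ(X, f ⁻¹ᵁ V) :=
    ⟨f.isIntegral_app V hV⟩
  have hinj : Function.Injective (algebraMap Γ(X', V) Γ(X, f ⁻¹ᵁ V)) := by
    refine Function.Injective.of_comp (f := algebraMap Γ(X, f ⁻¹ᵁ V) X.functionField) ?_
    rw [← RingHom.coe_comp, ← IsScalarTower.algebraMap_eq,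
      IsScalarTower.algebraMap_eq Γ(X', V) X'.functionField]
    exact (algebraMap X'.functionField X.functionField).injective.comp
      (IsFractionRing.injective Γ(X', V) X'.functionField)
  -- By integrality, inverting the non-zero functions of the base already gives `K(X)`. Read as a
  -- pushout of rings, this localization is the required cartesian square.
  have hloc : IsLocalization (Algebra.algebraMapSubmonoid Γ(X, f ⁻¹ᵁ V)
      (nonZeroDivisors Γ(X', V))) X.functionField := isLocalization_of_isIntegral hinj
  have hpush : Algebra.IsPushout Γ(X', V) X'.functionField Γ(X, f ⁻¹ᵁ V) X.functionField :=
    ((Algebra.isLocalization_iff_isPushout (nonZeroDivisors Γ(X', V)) X'.functionField).mp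
      hloc).symm
  have h2 : IsPullback (Spec.map (X.presheaf.germ (f ⁻¹ᵁ V) _ hfx)) (Spec.map (funMap f))
      (Spec.map (f.app V)) (Spec.map (X'.presheaf.germ V _ hVx)) := by
    refine isPullback_SpecMap_of_isPushout _ _ _ _ ?_
    exact (CommRingCat.isPushout_iff_isPushout ..).mpr hpush.symm
  have h3 := h2.paste_horiz h1
  convert! h3 using 1
  · exact (hf.fromSpecStalk_eq_fromSpecStalk hfx).symm
  · exact (hV.fromSpecStalk_eq_fromSpecStalk hVx).symm

/-- By flatness only the fibre over the generic point of `U` matters. That point maps to the generic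
point of `X'`, so the fibre is a base change of the generic fibre of `f`, described by
`isPullback_gen`. -/
theorem irreducibleSpace_pullback_iff [IsIntegral X] [IsIntegral X'] (f : X ⟶ X') [IsDominant f]
    [IsIntegralHom f] [Flat f] {U : Scheme.{u}} [IsIntegral U] (g : U ⟶ X')
    {M : Type u} [Field M] (κ : Spec (.of M) ⟶ U) [IsPreimmersion κ]
    (hrng : Set.range κ = {genericPoint U}) (ψ : X'.functionField ⟶ .of M)
    (hψ : Spec.map ψ ≫ gen X' = κ ≫ g) :
    IrreducibleSpace ↥(pullback f g) ↔
      IrreducibleSpace ↥(pullback (Spec.map (funMap f)) (Spec.map ψ)) := by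
  rw [irreducibleSpace_iff_pullback (pullback.snd f g) κ hrng]
  have h1 : IsPullback (pullback.fst (pullback.snd f g) κ ≫ pullback.fst f g)
      (pullback.snd (pullback.snd f g) κ) f (κ ≫ g) :=
    (IsPullback.of_hasPullback (pullback.snd f g) κ).paste_horiz (IsPullback.of_hasPullback f g)
  have h2 : IsPullback (pullback.fst (Spec.map (funMap f)) (Spec.map ψ) ≫ gen X)
      (pullback.snd (Spec.map (funMap f)) (Spec.map ψ)) f (κ ≫ g) := by
    rw [← hψ]
    exact (IsPullback.of_hasPullback (Spec.map (funMap f)) (Spec.map ψ)).paste_horiz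
      (isPullback_gen f)
  let e := (h1.isoIsPullback _ _ h2).schemeIsoToHomeo
  constructor
  · intro h
    exact e.surjective.irreducibleSpace e.continuous
  · intro h
    exact e.symm.surjective.irreducibleSpace e.symm.continuous

end GenericPoint

/-! ### Function fields of rational maps, and irreducibility of pull-backs along Galois morphisms.
-/

section RationalMaps

variable {X X' Y : Scheme.{u}}

open scoped TensorProduct in
theorem irreducibleSpace_pullback_spec_iff {k L M : Type u} [Field k] [Field L] [Field M]
    [CharZero k] (φ : k →+* L) (ψ : k →+* M) (hφ : IsFiniteGalois φ) (hψ : ψ.Finite) :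
    IrreducibleSpace ↥(pullback (Spec.map (CommRingCat.ofHom φ)) (Spec.map (CommRingCat.ofHom ψ)))
      ↔ NoCommonSubextension φ ψ := by
  algebraize [φ, ψ]
  obtain ⟨h1, h2⟩ := hφ
  have : FiniteDimensional k M := hψ
  refine Iff.trans ?_ (irreducibleSpace_tensorProduct_iff (k := k) (L := L) (M := M))
  let e := (pullbackSpecIso k L M).schemeIsoToHomeo
  constructor
  · intro h
    exact e.surjective.irreducibleSpace e.continuous
  · intro h
    have h' : IrreducibleSpace ↥(Spec (.of (L ⊗[k] M))) := h
    exact e.symm.surjective.irreducibleSpace e.symm.continuous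

theorem isDominant_iff_fromFunctionField [IsIntegral X] [IsIntegral Y] (π : Y ⤏ X) :
    π.IsDominant ↔ π.fromFunctionField (closedPt Y.functionField) = genericPoint X := by
  obtain ⟨f, rfl⟩ := π.exists_rep
  have hη : genericPoint Y ∈ f.domain :=
    (genericPoint_specializes _).mem_open f.domain.2 f.dense_domain.nonempty.choose_spec
  have : Nonempty f.domain := ⟨⟨_, hη⟩⟩
  have h1 : genericPoint f.domain = ⟨genericPoint Y, hη⟩ :=
    Subtype.ext (genericPoint_eq_of_isOpenImmersion f.domain.ι)
  rw [Scheme.RationalMap.fromFunctionField_toRationalMap,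
    Scheme.PartialMap.isDominant_toRationalMap_iff, isDominant_iff_apply_genericPoint]
  have h2 : f.domain.fromSpecStalkOfMem _ hη (closedPt Y.functionField) = ⟨genericPoint Y, hη⟩ := by
    apply f.domain.ι.isOpenEmbedding.injective
    rw [← Scheme.Hom.comp_apply, Scheme.Opens.fromSpecStalkOfMem_ι]
    exact fromSpecStalk_closedPt _
  rw [Scheme.PartialMap.fromFunctionField, Scheme.PartialMap.fromSpecStalkOfMem,
    Scheme.Hom.comp_apply, h2, h1]

/-- The map of function fields induced by a dominant rational map. -/
noncomputable def ratMap [IsIntegral X] [IsIntegral Y] (π : Y ⤏ X) [π.IsDominant] :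
    X.functionField ⟶ Y.functionField :=
  (exists_lift_fromSpecStalk π.fromFunctionField ((isDominant_iff_fromFunctionField π).mp
    inferInstance)).choose

theorem map_ratMap_gen [IsIntegral X] [IsIntegral Y] (π : Y ⤏ X) [π.IsDominant] :
    Spec.map (ratMap π) ≫ gen X = π.fromFunctionField :=
  (exists_lift_fromSpecStalk π.fromFunctionField ((isDominant_iff_fromFunctionField π).mp
    inferInstance)).choose_spec

theorem fromFunctionField_compHom [IsIntegral Y] (π : Y ⤏ X) (f : X ⟶ X') :
    (π.compHom f).fromFunctionField = π.fromFunctionField ≫ f := by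
  obtain ⟨g, rfl⟩ := π.exists_rep
  rw [← Scheme.RationalMap.compHom_toRationalMap,
    Scheme.RationalMap.fromFunctionField_toRationalMap,
    Scheme.RationalMap.fromFunctionField_toRationalMap]
  exact Scheme.PartialMap.fromSpecStalkOfMem_compHom _ _ _ _

theorem fromFunctionField_toRationalMap' [IsIntegral Y] (f : Y ⟶ X) :
    f.toRationalMap.fromFunctionField = gen Y ≫ f :=
  Scheme.PartialMap.fromSpecStalkOfMem_toPartialMap f _

theorem functionFieldMap_finite_iff [IsIntegral X] [IsIntegral Y] (π : Y ⤏ X) [π.IsDominant] :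
    (functionFieldMap π).hom.Finite ↔ (ratMap π).hom.Finite := by
  have key : ∀ (x : X) (hx : π.fromFunctionField (closedPt Y.functionField) = x)
      (φ : X.presheaf.stalk x ⟶ Y.functionField)
      (_ : Spec.map φ ≫ X.fromSpecStalk x = π.fromFunctionField),
      ((functionFieldMap π).hom.Finite ↔ φ.hom.Finite) := by
    rintro _ rfl φ h
    have : functionFieldMap π = φ := by
      apply map_fromSpecStalk_injective
      exact (Scheme.Spec_stalkClosedPointTo_fromSpecStalk _).trans h.symm
    rw [← this]
    rfl
  exact key _ ((isDominant_iff_fromFunctionField π).mp inferInstance) _ (map_ratMap_gen π)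

theorem degree_eq [IsIntegral X] [IsIntegral Y] (π : Y ⤏ X) [π.IsDominant] :
    degree π = letI := (ratMap π).hom.toAlgebra
      Module.finrank X.functionField Y.functionField := by
  have key : ∀ (x : X) (hx : π.fromFunctionField (closedPt Y.functionField) = x)
      (φ : X.presheaf.stalk x ⟶ Y.functionField)
      (_ : Spec.map φ ≫ X.fromSpecStalk x = π.fromFunctionField),
      (degree π = letI := φ.hom.toAlgebra
        Module.finrank (X.presheaf.stalk x) Y.functionField) := by
    rintro _ rfl φ h
    have : functionFieldMap π = φ := by
      apply map_fromSpecStalk_injective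
      exact (Scheme.Spec_stalkClosedPointTo_fromSpecStalk _).trans h.symm
    rw [← this]
    rfl
  exact key _ ((isDominant_iff_fromFunctionField π).mp inferInstance) _ (map_ratMap_gen π)

/-- Irreducibility of a pull-back along a finite flat morphism which is generically Galois. -/
theorem irreducibleSpace_pullback_rationalMap_iff [IsIntegral X] [IsIntegral X'] [IsIntegral Y]
    [X'.IsSeparated] [CharZero X'.functionField] (f : X ⟶ X') [IsDominant f]
    [IsIntegralHom f] [Flat f] (hf : IsFiniteGalois (funMap f).hom) (π : Y ⤏ X') [π.IsDominant]
    (hπ : (ratMap π).hom.Finite) :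
    IrreducibleSpace ↥(pullback f π.toPartialMap.hom) ↔
      NoCommonSubextension (funMap f).hom (ratMap π).hom := by
  let p := π.toPartialMap
  have hη : genericPoint Y ∈ p.domain :=
    (genericPoint_specializes _).mem_open p.domain.2 p.dense_domain.nonempty.choose_spec
  have : Nonempty p.domain := ⟨⟨_, hη⟩⟩
  -- The generic point of the domain of definition is presented by the function field of `Y` itself,
  -- which avoids comparing it with the function field of the open subscheme.
  let κ := p.domain.fromSpecStalkOfMem _ hη
  have hκ : κ ≫ p.domain.ι = gen Y := Scheme.Opens.fromSpecStalkOfMem_ι ..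
  have h1 : genericPoint p.domain = ⟨genericPoint Y, hη⟩ :=
    Subtype.ext (genericPoint_eq_of_isOpenImmersion p.domain.ι)
  have hκ' : IsPreimmersion (κ ≫ p.domain.ι) := by rw [hκ]; infer_instance
  have : IsPreimmersion κ := IsPreimmersion.of_comp κ p.domain.ι
  have hrng : Set.range κ = {genericPoint p.domain} := by
    have hk (y) : κ y = genericPoint p.domain := by
      apply p.domain.ι.isOpenEmbedding.injective
      rw [← Scheme.Hom.comp_apply, hκ, gen_apply, h1]
      rfl
    ext z
    simp only [Set.mem_range, Set.mem_singleton_iff, hk]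
    exact ⟨fun ⟨_, h⟩ => h.symm, fun h => ⟨closedPt Y.functionField, h.symm⟩⟩
  have hψ : Spec.map (ratMap π) ≫ gen X' = κ ≫ p.hom := by
    rw [map_ratMap_gen]
    conv_lhs => rw [← π.toRationalMap_toPartialMap]
    rfl
  refine (irreducibleSpace_pullback_iff f p.hom (M := Y.functionField) κ hrng
    (ratMap π) hψ).trans ?_
  exact irreducibleSpace_pullback_spec_iff (funMap f).hom (ratMap π).hom hf hπ

end RationalMaps

/-! ### Tangent vectors at the neutral element, and dominance of `[n]`. -/

section TangentSpace

open IsLocalRing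

/-- On the quotient of consecutive powers `𝔪^i / 𝔪^(i+1)` the map acts as the unit `n^i`. An element
of the kernel therefore lies in every power of `𝔪`, and Krull's intersection theorem makes it zero.
-/
theorem injective_of_sub_mem_sq {O : Type*} [CommRing O] [IsLocalRing O] [IsNoetherianRing O]
    (φ : O →+* O) (n : ℕ) (hn : IsUnit (n : O))
    (h : ∀ x ∈ maximalIdeal O, φ x - n * x ∈ maximalIdeal O ^ 2) : Function.Injective φ := by
  have hpow : ∀ i : ℕ, ∀ x ∈ maximalIdeal O ^ (i + 1),
      φ x - (n : O) ^ (i + 1) * x ∈ maximalIdeal O ^ (i + 2) := by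
    intro i
    induction i with
    | zero => intro x hx; simpa using h x (by simpa using hx)
    | succ i ih =>
      intro x hx
      rw [pow_succ] at hx
      refine Submodule.mul_induction_on hx (fun a ha b hb => ?_) (fun a b ha hb => ?_)
      · have h1 := ih a ha
        have h2 := h b hb
        have hφb : φ b ∈ maximalIdeal O := by
          have : φ b = (φ b - n * b) + n * b := by ring
          rw [this]
          exact Ideal.add_mem _ (Ideal.pow_le_self two_ne_zero h2) (Ideal.mul_mem_left _ _ hb)
        have : φ (a * b) - (n : O) ^ (i + 1 + 1) * (a * b) =
            (φ a - (n : O) ^ (i + 1) * a) * φ b +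
              ((n : O) ^ (i + 1) * a) * (φ b - n * b) := by
          rw [map_mul]; ring
        rw [this]
        refine Ideal.add_mem _ ?_ ?_
        · rw [show i + 1 + 2 = (i + 2) + 1 by ring, pow_succ]
          exact Ideal.mul_mem_mul h1 hφb
        · rw [show i + 1 + 2 = (i + 1) + 2 by ring, pow_add]
          exact Ideal.mul_mem_mul (Ideal.mul_mem_left _ _ ha) h2
      · have : φ (a + b) - (n : O) ^ (i + 1 + 1) * (a + b) =
            (φ a - (n : O) ^ (i + 1 + 1) * a) + (φ b - (n : O) ^ (i + 1 + 1) * b) := by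
          rw [map_add]; ring
        rw [this]
        exact Ideal.add_mem _ ha hb
  rw [injective_iff_map_eq_zero]
  intro x hx
  have hall : ∀ i : ℕ, x ∈ maximalIdeal O ^ (i + 1) := by
    intro i
    induction i with
    | zero =>
      rw [zero_add, pow_one, mem_maximalIdeal, mem_nonunits_iff]
      intro hu
      exact (hu.map φ).ne_zero hx
    | succ i ih =>
      have h1 := hpow i x ih
      rw [hx, zero_sub, neg_mem_iff] at h1
      obtain ⟨u, hu⟩ := hn.pow (i + 1)
      have h2 := Ideal.mul_mem_left _ (↑u⁻¹ : O) h1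
      rwa [← hu, Units.inv_mul_cancel_left] at h2
  have h0 : x ∈ ⨅ i, maximalIdeal O ^ i := by
    rw [Ideal.mem_iInf]
    intro i
    exact Ideal.pow_le_pow_right (Nat.le_succ i) (hall i)
  rwa [Ideal.iInf_pow_eq_bot_of_isLocalRing _ (maximalIdeal.isMaximal O).ne_top] at h0

instance {K V : Type*} [Field K] [AddCommGroup V] [Module K V] [Module Kᵐᵒᵖ V]
    [IsCentralScalar K V] : IsLocalRing (TrivSqZeroExt K V) := by
  have : Nontrivial (TrivSqZeroExt K V) := TrivSqZeroExt.fst_surjective.nontrivial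
  refine IsLocalRing.of_nonunits_add fun a b ha hb => ?_
  simp only [mem_nonunits_iff, TrivSqZeroExt.isUnit_iff_isUnit_fst, isUnit_iff_ne_zero, not_not,
    TrivSqZeroExt.fst_add] at *
  simp [ha, hb]

variable {K : Type u} [Field K]

/-- The spectrum of a `K`-algebra as a scheme over `K`. -/
noncomputable def specOver (A : Type u) [CommRing A] [Algebra K A] : Over (Spec (.of K)) :=
  Over.mk (Spec.map (CommRingCat.ofHom (algebraMap K A)))

/-- The morphism of `K`-schemes induced by a morphism of `K`-algebras. -/
noncomputable def specOverMap {A B : Type u} [CommRing A] [CommRing B] [Algebra K A] [Algebra K B]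
    (f : A →ₐ[K] B) : specOver (K := K) B ⟶ specOver A :=
  Over.homMk (Spec.map (CommRingCat.ofHom f.toRingHom)) (by
    simp only [specOver, Over.mk_hom]
    rw [← Spec.map_comp, ← CommRingCat.ofHom_comp]
    congr 2
    exact f.comp_algebraMap)

theorem specOverMap_comp {A B C : Type u} [CommRing A] [CommRing B] [CommRing C] [Algebra K A]
    [Algebra K B] [Algebra K C] (f : A →ₐ[K] B) (g : B →ₐ[K] C) :
    specOverMap (g.comp f) = specOverMap g ≫ specOverMap f := by
  ext1
  exact Spec.map_comp (CommRingCat.ofHom f.toRingHom) (CommRingCat.ofHom g.toRingHom)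

/-- The closed point of the spectrum of a local `K`-algebra. -/
noncomputable def specPt (A : Type u) [CommRing A] [Algebra K A] [IsLocalRing A] :
    ↥(specOver (K := K) A).left := closedPt (.of A)

theorem specOverMap_specPt {A B : Type u} [CommRing A] [CommRing B] [Algebra K A]
    [Algebra K B] [IsLocalRing A] [IsLocalRing B] (f : A →ₐ[K] B) :
    (specOverMap f).left (specPt B) = specPt A ↔ IsLocalHom f.toRingHom :=
  (IsLocalRing.isLocalHom_iff_comap_closedPoint f.toRingHom).symm

variable (X : Over (Spec (.of K))) [GrpObj X]

/-- The image of the neutral element of a group scheme over `K`. -/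
noncomputable def onePt : X.left :=
  (η[X] : 𝟙_ (Over (Spec (.of K))) ⟶ X).left (closedPt (.of K))

/-- The local ring of a group scheme at the neutral element. -/
noncomputable abbrev oneStalk : CommRingCat.{u} := X.left.presheaf.stalk (onePt X)

noncomputable instance : Algebra K (oneStalk X) :=
  (Spec.preimage (X.left.fromSpecStalk (onePt X) ≫ X.hom)).hom.toAlgebra

theorem map_algebraMap_oneStalk :
    Spec.map (CommRingCat.ofHom (algebraMap K (oneStalk X))) =
      X.left.fromSpecStalk (onePt X) ≫ X.hom :=
  Spec.map_preimage _

/-- The inclusion of the local scheme at the neutral element. -/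
noncomputable def oneLocal : specOver (K := K) (oneStalk X) ⟶ X :=
  Over.homMk (X.left.fromSpecStalk (onePt X)) (map_algebraMap_oneStalk X).symm

instance : Mono (oneLocal X) :=
  have : Mono (oneLocal X).left := inferInstanceAs (Mono (X.left.fromSpecStalk (onePt X)))
  Over.mono_of_mono_left _

theorem exists_algHom {A : Type u} [CommRing A] [Algebra K A] [IsLocalRing A]
    (t : specOver (K := K) A ⟶ X) (ht : t.left (specPt A) = onePt X) :
    ∃ φ : oneStalk X →ₐ[K] A, specOverMap φ ≫ oneLocal X = t := by
  obtain ⟨φ, hφ⟩ := exists_lift_fromSpecStalk (R := .of A) t.left ht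
  have h : (CommRingCat.ofHom (algebraMap K (oneStalk X))) ≫ φ =
      CommRingCat.ofHom (algebraMap K A) := by
    apply Spec.map_injective
    rw [Spec.map_comp, map_algebraMap_oneStalk, ← Category.assoc, hφ]
    exact Over.w t
  refine ⟨{ φ.hom with commutes' := fun r => congr($h r) }, ?_⟩
  ext1
  exact hφ

theorem specOverMap_oneLocal_injective {A : Type u} [CommRing A] [Algebra K A]
    {φ ψ : oneStalk X →ₐ[K] A} (h : specOverMap φ ≫ oneLocal X = specOverMap ψ ≫ oneLocal X) :
    φ = ψ := by
  have h1 : (specOverMap φ).left = (specOverMap ψ).left := by rw [(cancel_mono _).mp h]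
  have h2 := Spec.map_injective h1
  ext x
  exact congr($h2 x)

/-- The spectrum of `K` is the unit object. -/
noncomputable def specOverUnit : specOver (K := K) K ⟶ 𝟙_ (Over (Spec (.of K))) :=
  Over.homMk (𝟙 _) ((Category.id_comp (𝟙 (Spec (.of K)))).trans (Spec.map_id (.of K)).symm)

theorem one_left_specPt : (1 : specOver (K := K) K ⟶ X).left (specPt K) = onePt X := by
  have : (1 : specOver (K := K) K ⟶ X) = specOverUnit ≫ η[X] := by
    rw [Hom.one_def]
    congr 1
    exact toUnit_unique _ _
  rw [this]
  rfl

theorem exists_augmentation :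
    ∃ ev : oneStalk X →ₐ[K] K, specOverMap ev ≫ oneLocal X = (1 : specOver (K := K) K ⟶ X) :=
  exists_algHom X _ (one_left_specPt X)

/-- The evaluation at the neutral element. -/
noncomputable def augmentation : oneStalk X →ₐ[K] K := (exists_augmentation X).choose

theorem specOverMap_augmentation :
    specOverMap (augmentation X) ≫ oneLocal X = (1 : specOver (K := K) K ⟶ X) :=
  (exists_augmentation X).choose_spec

theorem one_eq_specOverMap {A : Type u} [CommRing A] [Algebra K A] :
    (1 : specOver (K := K) A ⟶ X) =
      specOverMap ((Algebra.ofId K A).comp (augmentation X)) ≫ oneLocal X := by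
  rw [specOverMap_comp, Category.assoc, specOverMap_augmentation, MonObj.comp_one]

/-- Point derivations at the neutral element with values in `V`. -/
def IsPointDerivation {V : Type u} [AddCommGroup V] [Module K V]
    (D : oneStalk X →ₗ[K] V) : Prop :=
  ∀ a b, D (a * b) = augmentation X a • D b + augmentation X b • D a

variable {X} in
/-- The morphism to the ring of dual numbers defined by a point derivation. -/
noncomputable def IsPointDerivation.algHom {V : Type u} [AddCommGroup V] [Module K V] [Module Kᵐᵒᵖ V]
    [IsCentralScalar K V] {D : oneStalk X →ₗ[K] V} (hD : IsPointDerivation X D) :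
    oneStalk X →ₐ[K] TrivSqZeroExt K V :=
  AlgHom.ofLinearMap
    ((TrivSqZeroExt.inlAlgHom K K V).toLinearMap ∘ₗ (augmentation X).toLinearMap +
      TrivSqZeroExt.inrHom K V ∘ₗ D)
    (by
      have h1 : D 1 = 0 := by
        have h := hD 1 1
        simp only [mul_one, map_one, one_smul, left_eq_add] at h
        exact h
      simp [h1])
    (fun a b => by
      ext
      · simp
      · simp [hD a b])

section

variable {V W : Type u} [AddCommGroup V] [Module K V] [Module Kᵐᵒᵖ V] [IsCentralScalar K V]
  [AddCommGroup W] [Module K W] [Module Kᵐᵒᵖ W] [IsCentralScalar K W]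

variable {X}

theorem IsPointDerivation.fst_algHom {D : oneStalk X →ₗ[K] V} (hD : IsPointDerivation X D) (x) :
    (hD.algHom x).fst = augmentation X x := by
  simp [algHom]

theorem IsPointDerivation.snd_algHom {D : oneStalk X →ₗ[K] V} (hD : IsPointDerivation X D) (x) :
    (hD.algHom x).snd = D x := by
  simp [algHom]

omit [Module Kᵐᵒᵖ V] [IsCentralScalar K V] [Module Kᵐᵒᵖ W] [IsCentralScalar K W] in
theorem IsPointDerivation.comp {D : oneStalk X →ₗ[K] V} (hD : IsPointDerivation X D)
    (f : V →ₗ[K] W) : IsPointDerivation X (f ∘ₗ D) := fun a b => by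
  simp [hD a b]

theorem IsPointDerivation.map_comp_algHom {D : oneStalk X →ₗ[K] V} (hD : IsPointDerivation X D)
    (f : V →ₗ[K] W) : (TrivSqZeroExt.map f).comp hD.algHom = (hD.comp f).algHom := by
  ext x
  · simp [fst_algHom]
  · simp [snd_algHom]

/-- The morphism from the spectrum of the dual numbers defined by a point derivation. -/
noncomputable def IsPointDerivation.hom {D : oneStalk X →ₗ[K] V} (hD : IsPointDerivation X D) :
    specOver (K := K) (TrivSqZeroExt K V) ⟶ X :=
  specOverMap hD.algHom ≫ oneLocal X

theorem IsPointDerivation.map_hom {D : oneStalk X →ₗ[K] V} (hD : IsPointDerivation X D)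
    (f : V →ₗ[K] W) : specOverMap (TrivSqZeroExt.map f) ≫ hD.hom = (hD.comp f).hom := by
  rw [hom, hom, ← map_comp_algHom, specOverMap_comp, Category.assoc]

omit [Module Kᵐᵒᵖ V] [IsCentralScalar K V] in
theorem isPointDerivation_zero : IsPointDerivation X (0 : oneStalk X →ₗ[K] V) := fun a b => by simp

theorem IsPointDerivation.hom_zero : (isPointDerivation_zero (X := X) (V := V)).hom = 1 := by
  rw [one_eq_specOverMap, hom]
  congr 2
  ext x
  · simp [fst_algHom, Algebra.ofId_apply, TrivSqZeroExt.algebraMap_eq_inl]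
  · simp [snd_algHom, Algebra.ofId_apply, TrivSqZeroExt.algebraMap_eq_inl]

theorem IsPointDerivation.hom_congr {D D' : oneStalk X →ₗ[K] V} (hD : IsPointDerivation X D)
    (hD' : IsPointDerivation X D') (h : D = D') : hD.hom = hD'.hom := by
  subst h
  rfl

omit [Module Kᵐᵒᵖ V] [IsCentralScalar K V] in
theorem IsPointDerivation.add {D D' : oneStalk X →ₗ[K] V} (hD : IsPointDerivation X D)
    (hD' : IsPointDerivation X D') : IsPointDerivation X (D + D') := fun a b => by
  simp only [LinearMap.add_apply, hD a b, hD' a b, smul_add]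
  abel

omit [Module Kᵐᵒᵖ V] [IsCentralScalar K V] in
theorem IsPointDerivation.prod {D D' : oneStalk X →ₗ[K] V} (hD : IsPointDerivation X D)
    (hD' : IsPointDerivation X D') : IsPointDerivation X (D.prod D') := fun a b => by
  simp [hD a b, hD' a b]

theorem oneLocal_specPt : (oneLocal X).left (specPt (oneStalk X)) = onePt X :=
  fromSpecStalk_closedPt _

instance : IsLocalHom (augmentation X).toRingHom := by
  rw [← specOverMap_specPt]
  have : Function.Injective (oneLocal X).left :=
    (X.left.fromSpecStalk (onePt X)).isEmbedding.injective
  apply this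
  rw [oneLocal_specPt, ← one_left_specPt X, ← specOverMap_augmentation, Over.comp_left,
    Scheme.Hom.comp_apply]

theorem IsPointDerivation.hom_left_specPt {D : oneStalk X →ₗ[K] V} (hD : IsPointDerivation X D) :
    hD.hom.left (specPt (TrivSqZeroExt K V)) = onePt X := by
  have hloc : IsLocalHom hD.algHom.toRingHom := ⟨fun a h => by
    rw [TrivSqZeroExt.isUnit_iff_isUnit_fst] at h
    exact isUnit_of_map_unit (augmentation X).toRingHom a (by simpa [fst_algHom] using h)⟩
  rw [hom, Over.comp_left, Scheme.Hom.comp_apply, (specOverMap_specPt _).mpr hloc, oneLocal_specPt]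

theorem specOverMap_trivSqZeroExt_map (f : V →ₗ[K] W) :
    (specOverMap (TrivSqZeroExt.map f)).left (specPt (TrivSqZeroExt K W)) =
      specPt (TrivSqZeroExt K V) := by
  rw [specOverMap_specPt]
  exact ⟨fun a h => by
    rw [TrivSqZeroExt.isUnit_iff_isUnit_fst] at h ⊢
    simpa using h⟩

/-- The group law on tangent vectors is the addition. -/
theorem IsPointDerivation.hom_mul_hom {D D' : oneStalk X →ₗ[K] V} (hD : IsPointDerivation X D)
    (hD' : IsPointDerivation X D') : hD.hom * hD'.hom = (hD.add hD').hom := by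
  -- The universal case has values in `V × V`: the tangent vectors `(D, 0)` and `(0, D')`. Their
  -- product restricts to `D` and `D'` along the two projections, which determine it, so it is `(D,
  -- D')`. Pushing forward by the sum `V × V → V` gives `D + D'`.
  let s₁ := (hD.comp (LinearMap.inl K V V)).hom
  let s₂ := (hD'.comp (LinearMap.inr K V V)).hom
  have hs₁ := hD.comp (LinearMap.inl K V V)
  have hs₂ := hD'.comp (LinearMap.inr K V V)
  have h1 : specOverMap (TrivSqZeroExt.map (LinearMap.fst K V V)) ≫ (s₁ * s₂) = hD.hom := by
    rw [MonObj.comp_mul, map_hom, map_hom, hom_congr (hs₁.comp _) hD (by ext; simp),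
      hom_congr (hs₂.comp _) isPointDerivation_zero (by ext; simp), hom_zero, mul_one]
  have h2 : specOverMap (TrivSqZeroExt.map (LinearMap.snd K V V)) ≫ (s₁ * s₂) = hD'.hom := by
    rw [MonObj.comp_mul, map_hom, map_hom, hom_congr (hs₁.comp _) isPointDerivation_zero
      (by ext; simp), hom_congr (hs₂.comp _) hD' (by ext; simp), hom_zero, one_mul]
  have h3 : specOverMap (TrivSqZeroExt.map (LinearMap.fst K V V + LinearMap.snd K V V)) ≫
      (s₁ * s₂) = hD.hom * hD'.hom := by
    rw [MonObj.comp_mul, map_hom, map_hom, hom_congr (hs₁.comp _) hD (by ext; simp),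
      hom_congr (hs₂.comp _) hD' (by ext; simp)]
  obtain ⟨φ, hφ⟩ := exists_algHom X (s₁ * s₂) (by
    rw [← specOverMap_trivSqZeroExt_map (LinearMap.fst K V V),
      ← Scheme.Hom.comp_apply, ← Over.comp_left, h1, hom_left_specPt])
  have h4 : φ = (hD.prod hD').algHom := by
    have h5 : (TrivSqZeroExt.map (LinearMap.fst K V V)).comp φ = hD.algHom := by
      apply specOverMap_oneLocal_injective
      rw [specOverMap_comp, Category.assoc, hφ, h1, hom]
    have h6 : (TrivSqZeroExt.map (LinearMap.snd K V V)).comp φ = hD'.algHom := by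
      apply specOverMap_oneLocal_injective
      rw [specOverMap_comp, Category.assoc, hφ, h2, hom]
    ext x
    · simpa [fst_algHom] using congr(($h5 x).fst)
    · simpa [snd_algHom] using congr(($h5 x).snd)
    · simpa [snd_algHom] using congr(($h6 x).snd)
  rw [← h3, ← hφ, h4]
  change _ ≫ (hD.prod hD').hom = _
  rw [map_hom]
  exact hom_congr _ _ (by ext; simp)

omit [Module Kᵐᵒᵖ V] [IsCentralScalar K V] in
theorem IsPointDerivation.nsmul {D : oneStalk X →ₗ[K] V} (hD : IsPointDerivation X D) (n : ℕ) :
    IsPointDerivation X (n • D) := fun a b => by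
  simp only [LinearMap.smul_apply, hD a b, smul_add]
  rw [smul_comm n, smul_comm n]

theorem IsPointDerivation.hom_pow {D : oneStalk X →ₗ[K] V} (hD : IsPointDerivation X D) (n : ℕ) :
    hD.hom ^ n = (hD.nsmul n).hom := by
  induction n with
  | zero => rw [pow_zero, hom_congr _ isPointDerivation_zero (D' := 0) (by simp), hom_zero]
  | succ n ih =>
    rw [pow_succ, ih, hom_mul_hom]
    exact hom_congr _ _ (by rw [succ_nsmul])

end

variable {X}

theorem augmentation_eq_zero_iff (x : oneStalk X) :
    augmentation X x = 0 ↔ x ∈ maximalIdeal (oneStalk X) := by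
  rw [mem_maximalIdeal, mem_nonunits_iff, ← not_iff_not, not_not, ← ne_eq, ← isUnit_iff_ne_zero]
  exact isUnit_map_iff (augmentation X).toRingHom x

/-- The product of `a` and `b`, each diminished by its value at the neutral element, lies in `𝔪 ^ 2`
and is killed by `ℓ`; expanding it is the Leibniz rule. The subtracted term makes the derivation
vanish on constants. -/
theorem isPointDerivation_of_linear (ℓ : oneStalk X →ₗ[K] K)
    (hℓ : ∀ x ∈ maximalIdeal (oneStalk X) ^ 2, ℓ x = 0) :
    IsPointDerivation X (ℓ - ℓ ∘ₗ Algebra.linearMap K _ ∘ₗ (augmentation X).toLinearMap) := by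
  intro a b
  let κ : K →+* oneStalk X := algebraMap K _
  have hm (a : oneStalk X) : a - κ (augmentation X a) ∈ maximalIdeal (oneStalk X) := by
    rw [← augmentation_eq_zero_iff]
    simp [κ]
  have h := hℓ _ (by rw [pow_two]; exact Ideal.mul_mem_mul (hm a) (hm b))
  have h1 : (a - κ (augmentation X a)) * (b - κ (augmentation X b)) = (a * b -
      κ (augmentation X (a * b))) - augmentation X a • (b - κ (augmentation X b)) -
      augmentation X b • (a - κ (augmentation X a)) := by
    simp only [Algebra.smul_def, map_mul, κ]
    ring
  rw [h1, map_sub, map_sub, map_smul, map_smul, sub_sub, sub_eq_zero] at h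
  simpa [κ] using h

theorem mulBy_left_onePt [IsCommMonObj X] (n : ℕ) : (mulBy X n).left (onePt X) = onePt X := by
  rw [← one_left_specPt, ← Scheme.Hom.comp_apply, ← Over.comp_left, comp_mulBy, one_pow]

theorem exists_stalk_mulBy [IsCommMonObj X] (n : ℕ) :
    ∃ φ : oneStalk X →ₐ[K] oneStalk X, specOverMap φ ≫ oneLocal X = oneLocal X ≫ mulBy X n := by
  apply exists_algHom
  rw [Over.comp_left, Scheme.Hom.comp_apply, oneLocal_specPt, mulBy_left_onePt]

/-- On the cotangent space `[n]` induces the multiplication by `n`. -/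
theorem stalk_mulBy_sub_mem [IsCommMonObj X] (n : ℕ) (φ : oneStalk X →ₐ[K] oneStalk X)
    (hφ : specOverMap φ ≫ oneLocal X = oneLocal X ≫ mulBy X n) (x : oneStalk X)
    (hx : x ∈ maximalIdeal (oneStalk X)) :
    φ x - n * x ∈ maximalIdeal (oneStalk X) ^ 2 := by
  have haug : (augmentation X).comp φ = augmentation X := by
    apply specOverMap_oneLocal_injective
    rw [specOverMap_comp, Category.assoc, hφ, ← Category.assoc, specOverMap_augmentation,
      comp_mulBy, one_pow]
  by_contra hy
  -- A linear form killing `𝔪 ^ 2` but not `φ x - n * x` defines a tangent vector. Along `[n]` that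
  -- vector becomes its `n`-th power, which is `n` times the derivation, so `ℓ (φ x) = n ℓ x`: a
  -- contradiction.
  obtain ⟨ℓ, hℓ, hker⟩ := Submodule.exists_le_ker_of_notMem
    (p := (maximalIdeal (oneStalk X) ^ 2).restrictScalars K) hy
  have hD := isPointDerivation_of_linear ℓ (fun x hx => hker hx)
  set D := ℓ - ℓ ∘ₗ Algebra.linearMap K _ ∘ₗ (augmentation X).toLinearMap with hDdef
  have h1 : hD.algHom.comp φ = (hD.nsmul n).algHom := by
    apply specOverMap_oneLocal_injective
    change _ = IsPointDerivation.hom _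
    rw [specOverMap_comp, Category.assoc, hφ, ← Category.assoc, comp_mulBy,
      ← IsPointDerivation.hom_pow]
    rfl
  have h2 : D (φ x) = n • D x := by
    simpa [IsPointDerivation.snd_algHom] using congr(($h1 x).snd)
  apply hℓ
  have h3 : augmentation X x = 0 := (augmentation_eq_zero_iff x).mpr hx
  have h4 : augmentation X (φ x) = 0 := congr($haug x).trans h3
  have h5 : D x = ℓ x := by simp [hDdef, h3]
  have h6 : D (φ x) = ℓ (φ x) := by simp [hDdef, h4]
  rw [h5, h6] at h2
  rw [map_sub, h2, ← nsmul_eq_mul, map_nsmul, sub_self]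

/-- The integer `n` is invertible in characteristic 0, so `[n]` is injective on the local ring at
the neutral element and dominant on its spectrum. That spectrum contains the generic point of `X`.
-/
theorem isDominant_mulBy [CharZero K] [IsVariety X] [IsCommMonObj X] (n : ℕ) (hn : 0 < n) :
    IsDominant (mulBy X n).left := by
  have : IsLocallyNoetherian X.left := LocallyOfFiniteType.isLocallyNoetherian X.hom
  have : IsNoetherianRing (oneStalk X) := inferInstance
  obtain ⟨φ, hφ⟩ := exists_stalk_mulBy (X := X) n
  have hinj : Function.Injective φ := injective_of_sub_mem_sq φ.toRingHom n
    (by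
      have : IsUnit (n : K) := isUnit_iff_ne_zero.mpr (by exact_mod_cast hn.ne')
      simpa using this.map (algebraMap K (oneStalk X)))
    (stalk_mulBy_sub_mem n φ hφ)
  have h1 : IsDominant (specOverMap φ).left :=
    ⟨(PrimeSpectrum.denseRange_comap_iff_ker_le_nilRadical φ.toRingHom).mpr (by
      rw [(RingHom.injective_iff_ker_eq_bot φ.toRingHom).mp hinj]
      exact bot_le)⟩
  have h2 : IsDominant (oneLocal X).left := by
    obtain ⟨y, hy⟩ : genericPoint X.left ∈ Set.range (X.left.fromSpecStalk (onePt X)) := by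
      rw [Scheme.range_fromSpecStalk]
      exact genericPoint_specializes _
    exact isDominant_of_apply_eq_genericPoint _ y hy
  have h3 : IsDominant ((oneLocal X).left ≫ (mulBy X n).left) := by
    rw [← Over.comp_left, ← hφ, Over.comp_left]
    infer_instance
  exact IsDominant.of_comp (oneLocal X).left _

end TangentSpace

/-! ### Points over `K`, finiteness over opens, and translations. -/

section Points

variable {K : Type u} [Field K] {X Z : Over (Spec (.of K))}

/-- The image of a `K`-point. -/
noncomputable def pt (t : 𝟙_ (Over (Spec (.of K))) ⟶ X) : X.left := t.left (closedPt (.of K))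

theorem pt_comp (t : 𝟙_ (Over (Spec (.of K))) ⟶ X) (f : X ⟶ Z) : pt (t ≫ f) = f.left (pt t) := by
  rw [pt, Over.comp_left, Scheme.Hom.comp_apply, pt]

variable [IsAlgClosed K]

theorem exists_pt_eq [LocallyOfFiniteType X.hom] (x : X.left) (hx : IsClosed {x}) :
    ∃ t : 𝟙_ (Over (Spec (.of K))) ⟶ X, pt t = x :=
  ⟨Over.homMk (pointOfClosedPoint X.hom x hx) (pointOfClosedPoint_comp X.hom x hx),
    pointOfClosedPoint_apply X.hom x hx _⟩

theorem pt_injective [LocallyOfFiniteType X.hom] :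
    Function.Injective (pt : (𝟙_ (Over (Spec (.of K))) ⟶ X) → X.left) := fun s t h => by
  ext1
  exact ext_of_apply_closedPoint_eq X.hom (Over.w s) (Over.w t) h

theorem isClosed_pt [LocallyOfFiniteType X.hom] (t : 𝟙_ (Over (Spec (.of K))) ⟶ X) :
    IsClosed {pt t} :=
  (pointEquivClosedPoint X.hom ⟨t.left, Over.w t⟩).2

theorem exists_pt_mem [LocallyOfFiniteType X.hom] {S : Set X.left} (hS : IsLocallyClosed S)
    (hne : S.Nonempty) : ∃ t : 𝟙_ (Over (Spec (.of K))) ⟶ X, pt t ∈ S := by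
  have := LocallyOfFiniteType.jacobsonSpace X.hom
  obtain ⟨x, hx, hxc⟩ := nonempty_inter_closedPoints hne hS
  obtain ⟨t, rfl⟩ := exists_pt_eq x hxc
  exact ⟨t, hx⟩

theorem opens_eq_top_of_pt_mem [LocallyOfFiniteType X.hom] (U : X.left.Opens)
    (h : ∀ t : 𝟙_ (Over (Spec (.of K))) ⟶ X, pt t ∈ U) : U = ⊤ := by
  by_contra hU
  rw [← TopologicalSpace.Opens.coe_eq_univ, ← ne_eq, ← Set.nonempty_compl] at hU
  obtain ⟨t, ht⟩ := exists_pt_mem U.isOpen.isClosed_compl.isLocallyClosed hU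
  exact ht (h t)

end Points

section Locality

instance : IsZariskiLocalAtTarget @IsFinite.{u} :=
  @HasAffineProperty.instIsZariskiLocalAtTarget _ _
    IsFinite.instHasAffinePropertyAndIsAffineFiniteCarrierObjOppositeOpensCarrierCarrierCommRingCatPresheafOpOpensTopHomAppTop

instance : MorphismProperty.RespectsIso @IsFinite.{u} :=
  (inferInstance : MorphismProperty.IsStableUnderBaseChange @IsFinite.{u}).respectsIso

/-- This moves finiteness over `V` to finiteness over a translate of `V`, with `σ` and `τ`
compatible translations of source and target. -/
theorem isFinite_morphismRestrict_of_comm {X Y : Scheme.{u}} (f : X ⟶ Y) (σ : X ⟶ X) (τ : Y ⟶ Y)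
    [IsIso σ] [IsIso τ] (h : σ ≫ f = f ≫ τ) (V : Y.Opens) (hV : IsFinite (f ∣_ V)) :
    IsFinite (f ∣_ (τ ⁻¹ᵁ V)) := by
  have h2 : IsFinite ((σ ≫ f) ∣_ V) := by
    rw [morphismRestrict_comp]
    exact (MorphismProperty.cancel_left_of_respectsIso @IsFinite (σ ∣_ (f ⁻¹ᵁ V)) (f ∣_ V)).mpr hV
  rw [h, morphismRestrict_comp] at h2
  exact (MorphismProperty.cancel_right_of_respectsIso @IsFinite (f ∣_ (τ ⁻¹ᵁ V))
    (τ ∣_ V)).mp h2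

end Locality

section Translations

variable {K : Type u} [Field K] {X : Over (Spec (.of K))} [GrpObj X] [IsCommMonObj X]

/-- The translation by a `K`-point. -/
noncomputable def translation (t : 𝟙_ (Over (Spec (.of K))) ⟶ X) : X ⟶ X := (toUnit X ≫ t) * 𝟙 X

omit [IsCommMonObj X] in
theorem comp_translation {T : Over (Spec (.of K))} (x : T ⟶ X)
    (t : 𝟙_ (Over (Spec (.of K))) ⟶ X) : x ≫ translation t = (toUnit T ≫ t) * x := by
  rw [translation, MonObj.comp_mul, ← Category.assoc, comp_toUnit, Category.comp_id]

omit [IsCommMonObj X] in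
theorem point_comp_translation (s t : 𝟙_ (Over (Spec (.of K))) ⟶ X) :
    s ≫ translation t = t * s := by
  rw [comp_translation, toUnit_unit, Category.id_comp]

omit [IsCommMonObj X] in
theorem translation_comp (s t : 𝟙_ (Over (Spec (.of K))) ⟶ X) :
    translation s ≫ translation t = translation (t * s) := by
  rw [comp_translation, translation, translation, MonObj.comp_mul, mul_assoc]

theorem translation_one : translation (1 : 𝟙_ (Over (Spec (.of K))) ⟶ X) = 𝟙 X := by
  rw [translation, MonObj.comp_one, one_mul]

instance (t : 𝟙_ (Over (Spec (.of K))) ⟶ X) : IsIso (translation t) :=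
  ⟨translation t⁻¹, by rw [translation_comp, inv_mul_cancel, translation_one],
    by rw [translation_comp, mul_inv_cancel, translation_one]⟩

instance (t : 𝟙_ (Over (Spec (.of K))) ⟶ X) : IsIso (translation t).left :=
  inferInstanceAs (IsIso ((Over.forget _).map (translation t)))

omit [IsCommMonObj X] in
theorem pt_translation (s t : 𝟙_ (Over (Spec (.of K))) ⟶ X) :
    (translation t).left (pt s) = pt (t * s) := by
  rw [← pt_comp, point_comp_translation]

theorem translation_comp_mulBy (t : 𝟙_ (Over (Spec (.of K))) ⟶ X) (m : ℕ) :
    translation t ≫ mulBy X m = mulBy X m ≫ translation (t ^ m) := by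
  rw [comp_mulBy, comp_translation, translation, mul_pow, mulBy, MonObj.comp_pow]

theorem mulBy_comp_mulBy (m n : ℕ) : mulBy X m ≫ mulBy X n = mulBy X (m * n) := by
  rw [comp_mulBy, mulBy, mulBy, pow_mul]

theorem mulBy_one : mulBy X 1 = 𝟙 X := pow_one _

end Translations

/-! ### Generically finite morphisms are finite over a non-empty open subset. -/

section FunctionFieldFinite

/-- The isomorphism `e` need not be `k`-linear: it only shows that `k` and `L` have the same finite
transcendence degree over `K`. Hence `L` is algebraic over `k`, and it is finitely generated. -/
theorem finite_of_algEquiv {K k L : Type u} [Field K] [Field k] [Field L] [Algebra K k]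
    [Algebra k L] [Algebra K L] [IsScalarTower K k L] [Algebra.EssFiniteType K L]
    (e : k ≃ₐ[K] L) : FiniteDimensional k L := by
  have h1 : Algebra.trdeg K k = Algebra.trdeg K L := e.trdeg_eq
  have h2 := trdeg_add_eq K k (A := L)
  have h3 : Algebra.trdeg K L < Cardinal.aleph0 := trdeg_lt_aleph0 K L
  have h4 : Algebra.trdeg k L = 0 := by
    rw [h1] at h2
    exact Cardinal.eq_of_add_eq_add_left (by rw [h2, add_zero]) h3
  have : Algebra.IsAlgebraic k L := trdeg_eq_zero_iff.mp h4
  have : Algebra.EssFiniteType k L := .of_comp K k L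
  obtain ⟨s, hs⟩ := IntermediateField.fg_top k L
  have := IntermediateField.finiteDimensional_adjoin (K := k) (L := L) (S := (s : Set L))
    fun x _ => Algebra.IsIntegral.isIntegral x
  rw [hs] at this
  exact IntermediateField.topEquiv.toLinearEquiv.finiteDimensional

theorem exists_iso_comp_stalkMap {X X' : Scheme.{u}} [IsIntegral X] [IsIntegral X'] (f : X ⟶ X')
    [IsDominant f] : ∃ e : X'.functionField ≅ X'.presheaf.stalk (f (genericPoint X)),
      e.hom ≫ f.stalkMap (genericPoint X) = funMap f := by
  have key : ∀ (x' : X') (hx : f (genericPoint X) = x')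
      (φ : X'.presheaf.stalk x' ⟶ X.functionField)
      (_ : Spec.map φ ≫ X'.fromSpecStalk x' = gen X ≫ f),
      ∃ e : X'.presheaf.stalk x' ≅ X'.presheaf.stalk (f (genericPoint X)),
        e.hom ≫ f.stalkMap (genericPoint X) = φ := by
    rintro _ rfl φ h
    refine ⟨Iso.refl _, ?_⟩
    apply map_fromSpecStalk_injective
    rw [h, Iso.refl_hom, Category.id_comp, Scheme.SpecMap_stalkMap_fromSpecStalk]
    rfl
  exact key _ (apply_genericPoint f) _ (map_funMap_gen f)

theorem essFiniteType_funMap {X X' : Scheme.{u}} [IsIntegral X] [IsIntegral X'] (f : X ⟶ X')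
    [IsDominant f] [LocallyOfFiniteType f] : (funMap f).hom.EssFiniteType := by
  obtain ⟨e, he⟩ := exists_iso_comp_stalkMap f
  rw [← he]
  rw [CommRingCat.hom_comp, RingHom.EssFiniteType.respectsIso.cancel_left_isIso]
  exact LocallyOfFiniteType.stalkMap f (genericPoint X)

/-- A dominant endomorphism of a variety is generically finite. -/
theorem finite_funMap_of_endomorphism {K : Type u} [Field K] {X : Over (Spec (.of K))} [IsVariety X]
    (f : X ⟶ X) [IsDominant f.left] : (funMap f.left).hom.Finite := by
  have : IsDominant X.hom := by
    obtain ⟨x⟩ : Nonempty X.left := inferInstance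
    have : Subsingleton ↥(Spec (.of K)) := inferInstanceAs (Subsingleton (PrimeSpectrum K))
    exact isDominant_of_apply_eq_genericPoint _ x (Subsingleton.elim _ _)
  have h1 : funMap X.hom ≫ funMap f.left = funMap X.hom := by
    rw [← funMap_comp]
    exact funMap_congr (Over.w f)
  have h2 := essFiniteType_funMap X.hom
  have key : ∀ {K k L : Type u} [Field K] [Field k] [Field L] (e : k ≃+* L) (a : K →+* k)
      (b : K →+* L) (φ : k →+* L), φ.comp a = b → e.toRingHom.comp a = b → b.EssFiniteType →
      φ.Finite := by
    intro K k L _ _ _ e a b φ h h' hb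
    algebraize [a, b, φ]
    have : IsScalarTower K k L := .of_algebraMap_eq' h.symm
    exact finite_of_algEquiv (K := K) { e with commutes' := fun r => congr($h' r) }
  exact key (RingEquiv.refl _) (funMap X.hom).hom (funMap X.hom).hom (funMap f.left).hom
    congr(($h1).hom) rfl h2

/-- The element `g` is a common multiplier making finitely many generators of `B` integral over `A`.
Once `g` is inverted the generators themselves are integral. -/
theorem exists_isIntegral_away {A B : Type*} [CommRing A] [IsDomain A] [CommRing B]
    [Algebra A B] [Algebra.FiniteType A B] [Algebra.IsAlgebraic A B] :
    ∃ g : A, g ≠ 0 ∧ ∀ (A' B' : Type u) [CommRing A'] [CommRing B'] [Algebra A A'] [Algebra B B']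
      [IsLocalization.Away g A'] [IsLocalization.Away (algebraMap A B g) B'],
      (IsLocalization.Away.map A' B' (algebraMap A B) g).IsIntegral := by
  obtain ⟨s, hs⟩ := ‹Algebra.FiniteType A B›
  obtain ⟨g, hg, hinteg⟩ := Algebra.IsAlgebraic.exists_integral_multiples A s
  refine ⟨g, hg, fun A' B' _ _ _ _ _ _ => ?_⟩
  let φ := IsLocalization.Away.map A' B' (algebraMap A B) g
  let := φ.toAlgebra
  let := ((algebraMap B B').comp (algebraMap A B)).toAlgebra
  have hφ (a : A) : φ (algebraMap A A' a) = algebraMap B B' (algebraMap A B a) :=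
    IsLocalization.map_eq _ a
  have : IsScalarTower A A' B' := .of_algebraMap_eq fun a => (hφ a).symm
  have : IsScalarTower A B B' := .of_algebraMap_eq' rfl
  have hinv : IsIntegral A' (IsLocalization.Away.invSelf (S := B') (algebraMap A B g)) := by
    have : φ (IsLocalization.Away.invSelf g) =
        IsLocalization.Away.invSelf (S := B') (algebraMap A B g) := by
      have h1 := congrArg φ (IsLocalization.Away.mul_invSelf (S := A') g)
      rw [map_mul, map_one, hφ] at h1
      have h2 := IsLocalization.Away.mul_invSelf (S := B') (algebraMap A B g)
      exact (IsLocalization.Away.algebraMap_isUnit (S := B') (algebraMap A B g)).mul_left_cancel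
        (h1.trans h2.symm)
    rw [← this]
    exact isIntegral_algebraMap (R := A') (A := B')
  have hB (b : B) : IsIntegral A' (algebraMap B B' b) := by
    have hb : b ∈ Algebra.adjoin A (s : Set B) := by rw [hs]; trivial
    induction hb using Algebra.adjoin_induction with
    | mem z hz =>
      have h1 : IsIntegral A' (algebraMap B B' (g • z)) :=
        ((hinteg z hz).map (IsScalarTower.toAlgHom A B B')).tower_top
      have h2 : algebraMap B B' z = IsLocalization.Away.invSelf (S := B') (algebraMap A B g) *
          algebraMap B B' (g • z) := by
        rw [Algebra.smul_def, map_mul, ← mul_assoc, mul_comm (IsLocalization.Away.invSelf _),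
          IsLocalization.Away.mul_invSelf, one_mul]
      rw [h2]
      exact hinv.mul h1
    | algebraMap a =>
      rw [← hφ]
      exact isIntegral_algebraMap (R := A') (A := B')
    | add x y _ _ hx hy => rw [map_add]; exact hx.add hy
    | mul x y _ _ hx hy => rw [map_mul]; exact hx.mul hy
  intro x
  obtain ⟨n, b, hb⟩ := IsLocalization.Away.surj (algebraMap A B g) x
  have : x = (IsLocalization.Away.invSelf (S := B') (algebraMap A B g)) ^ n *
      algebraMap B B' b := by
    rw [← hb, mul_left_comm, ← mul_pow, mul_comm (IsLocalization.Away.invSelf _),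
      IsLocalization.Away.mul_invSelf, one_pow, mul_one]
  rw [this]
  exact (hinv.pow n).mul (hB b)

/-- A generically finite morphism is finite over a non-empty open subset. -/
theorem exists_isFinite_morphismRestrict {X Y : Scheme.{u}} [IsIntegral X] [IsIntegral Y]
    (f : X ⟶ Y) [IsDominant f] [LocallyOfFiniteType f] [IsSeparated f]
    (hf : (funMap f).hom.Finite) : ∃ V : Y.Opens, Nonempty V ∧ IsFinite (f ∣_ V) := by
  obtain ⟨_, ⟨U, hU, rfl⟩, hUx, -⟩ := Y.isBasis_affineOpens.exists_subset_of_mem_open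
    (Set.mem_univ (genericPoint Y)) isOpen_univ
  have hUx : genericPoint Y ∈ U := hUx
  have hU : IsAffineOpen U := hU
  have hUx' : genericPoint X ∈ f ⁻¹ᵁ U := by
    change f (genericPoint X) ∈ U
    rwa [apply_genericPoint f]
  obtain ⟨_, ⟨V, hV, rfl⟩, hVx, hVU⟩ := X.isBasis_affineOpens.exists_subset_of_mem_open
    hUx' (f ⁻¹ᵁ U).isOpen
  have hVx : genericPoint X ∈ V := hVx
  have hV : IsAffineOpen V := hV
  have hVU : V ≤ f ⁻¹ᵁ U := hVU
  have : Nonempty U := ⟨⟨_, hUx⟩⟩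
  have : Nonempty V := ⟨⟨_, hVx⟩⟩
  have hft := f.finiteType_appLE hU hV hVU
  have hcomm : Y.presheaf.germ U _ hUx ≫ funMap f =
      f.appLE U V hVU ≫ X.presheaf.germ V _ hVx := by
    rw [germ_funMap f U hUx hUx', Scheme.Hom.appLE, Category.assoc, X.presheaf.germ_res]
  let := (f.appLE U V hVU).hom.toAlgebra
  let := (Y.presheaf.germ U _ hUx).hom.toAlgebra
  let := (X.presheaf.germ V _ hVx).hom.toAlgebra
  let := (funMap f).hom.toAlgebra
  let := (f.appLE U V hVU ≫ X.presheaf.germ V _ hVx).hom.toAlgebra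
  have : IsScalarTower Γ(Y, U) Γ(X, V) X.functionField := .of_algebraMap_eq' rfl
  have : IsScalarTower Γ(Y, U) Y.functionField X.functionField :=
    .of_algebraMap_eq' congr(($hcomm).hom).symm
  have : IsFractionRing Γ(Y, U) Y.functionField :=
    functionField_isFractionRing_of_isAffineOpen Y U hU
  have : IsFractionRing Γ(X, V) X.functionField :=
    functionField_isFractionRing_of_isAffineOpen X V hV
  have : FiniteDimensional Y.functionField X.functionField := hf
  have : Algebra.FiniteType Γ(Y, U) Γ(X, V) := hft
  have : Algebra.IsAlgebraic Γ(Y, U) X.functionField :=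
    (IsFractionRing.comap_isAlgebraic_iff (K := Y.functionField)).mpr inferInstance
  have : Algebra.IsAlgebraic Γ(Y, U) Γ(X, V) := ⟨fun b =>
    (isAlgebraic_algebraMap_iff (IsFractionRing.injective Γ(X, V) X.functionField)).mp
      (Algebra.IsAlgebraic.isAlgebraic (R := Γ(Y, U)) _)⟩
  obtain ⟨g, hg, hinteg⟩ := exists_isIntegral_away.{u} (A := Γ(Y, U)) (B := Γ(X, V))
  let U' := Y.basicOpen g
  let V' := X.basicOpen (f.appLE U V hVU g)
  have hVU' : V' ≤ f ⁻¹ᵁ U' := by simp [U', V', Scheme.Hom.appLE]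
  have hU'aff : IsAffineOpen U' := hU.basicOpen g
  have hV'aff : IsAffineOpen V' := hV.basicOpen _
  have h1 : (f.appLE U' V' hVU').hom.IsIntegral := by
    let := hU.isLocalization_basicOpen g
    let := hV.isLocalization_basicOpen (f.appLE U V hVU g)
    have h2 := hU.appLE_eq_away_map f hV hVU g
    rw [h2]
    exact hinteg _ _
  have h2 : IsIntegralHom (f.resLE U' V' hVU') := by
    have : IsAffine U' := hU'aff
    have : IsAffine V' := hV'aff
    refine (IsIntegralHom.hasAffineProperty.iff_of_isAffine).mpr ⟨inferInstance, ?_⟩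
    exact (RingHom.isIntegral_respectsIso.arrow_mk_iso_iff (arrowResLEAppIso f U' V' hVU')).mpr h1
  have hne : genericPoint Y ∈ U' := by
    rw [Scheme.mem_basicOpen _ _ _ hUx, isUnit_iff_ne_zero]
    exact fun h => hg (IsFractionRing.injective Γ(Y, U) Y.functionField
      (h.trans (map_zero (algebraMap Γ(Y, U) Y.functionField)).symm))
  have hne' : genericPoint X ∈ V' := by
    rw [Scheme.mem_basicOpen _ _ _ hVx, isUnit_iff_ne_zero]
    intro h
    have h3 : algebraMap Γ(Y, U) X.functionField g = 0 := h
    rw [IsScalarTower.algebraMap_apply Γ(Y, U) Y.functionField, map_eq_zero] at h3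
    exact hg (IsFractionRing.injective Γ(Y, U) Y.functionField (h3.trans (map_zero _).symm))
  -- The inclusion of `V'` in `f ⁻¹ᵁ U'` is open, and it is integral because `f` is separated. Its
  -- image is clopen and non-empty in an irreducible space, so it is everything.
  have heq : V' = f ⁻¹ᵁ U' := by
    have h3 : IsIntegralHom (X.homOfLE hVU' ≫ f ∣_ U') := h2
    have h4 : IsIntegralHom (X.homOfLE hVU') := .of_comp _ (f ∣_ U')
    have h5 : IsClopen (Set.range (X.homOfLE hVU')) :=
      ⟨(X.homOfLE hVU').isClosedMap.isClosed_range, (X.homOfLE hVU').isOpenEmbedding.isOpen_range⟩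
    have : Nonempty (f ⁻¹ᵁ U') := ⟨⟨_, hVU' hne'⟩⟩
    have h6 : Set.range (X.homOfLE hVU') = Set.univ :=
      h5.eq_univ ⟨X.homOfLE hVU' ⟨_, hne'⟩, Set.mem_range_self _⟩
    refine le_antisymm hVU' fun x hx => ?_
    obtain ⟨y, hy⟩ : (⟨x, hx⟩ : (f ⁻¹ᵁ U' :)) ∈ Set.range (X.homOfLE hVU') := by
      rw [h6]; trivial
    have h7 : (f ⁻¹ᵁ U').ι (X.homOfLE hVU' y) = V'.ι y := by
      rw [← Scheme.Hom.comp_apply, X.homOfLE_ι]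
    have h8 : x = y.1 := by rw [hy] at h7; exact h7
    rw [h8]
    exact y.2
  refine ⟨U', ⟨⟨_, hne⟩⟩, ?_⟩
  rw [IsFinite.iff_isIntegralHom_and_locallyOfFiniteType]
  refine ⟨?_, inferInstance⟩
  rw [← Scheme.Hom.resLE_eq_morphismRestrict]
  exact (f.resLE_congr hVU' rfl heq @IsIntegralHom).mp h2

end FunctionFieldFinite

/-! ### The morphism `[m]` is finite, flat and surjective. -/

section MulBy

variable {K : Type u} [Field K] {X : Over (Spec (.of K))}

theorem formallySmooth_of_essFiniteType {k L : Type*} [Field k] [CharZero k] [Field L]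
    (φ : k →+* L) (hφ : φ.EssFiniteType) : φ.FormallySmooth := by
  algebraize [φ]
  exact Algebra.FormallySmooth.of_perfectField

theorem charZero_functionField [CharZero K] (X : Over (Spec (.of K))) [IsIntegral X.left] :
    CharZero X.left.functionField :=
  charZero_of_injective_ringHom (Spec.preimage (gen X.left ≫ X.hom)).hom.injective

theorem locallyOfFiniteType_left [LocallyOfFiniteType X.hom] {Y : Over (Spec (.of K))}
    (f : X ⟶ Y) : LocallyOfFiniteType f.left := by
  have : LocallyOfFiniteType (f.left ≫ Y.hom) := by rw [Over.w]; infer_instance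
  exact locallyOfFiniteType_of_comp f.left Y.hom

theorem isSeparated_hom_left [IsSeparated X.hom] {Y : Over (Spec (.of K))}
    (f : X ⟶ Y) : IsSeparated f.left := by
  have : IsSeparated (f.left ≫ Y.hom) := by rw [Over.w]; infer_instance
  exact IsSeparated.of_comp f.left Y.hom

variable [IsAlgClosed K] [CharZero K] [IsVariety X] [GrpObj X] [IsCommMonObj X]

/-- Since `[m]` is generically finite, it is finite over some non-empty open `V`, and by
equivariance over every translate of `V` by an `m`-th power. These translates cover `X`: for a
`K`-point `y`, dominance of `[m]` gives `t` with `y * t ^ m` in `V`. -/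
theorem isFinite_mulBy (m : ℕ) (hm : 0 < m) : IsFinite (mulBy X m).left := by
  have := isDominant_mulBy (X := X) m hm
  have := locallyOfFiniteType_left (mulBy X m)
  have := isSeparated_hom_left (mulBy X m)
  obtain ⟨V, ⟨v⟩, hfin⟩ := exists_isFinite_morphismRestrict (mulBy X m).left
    (finite_funMap_of_endomorphism (mulBy X m))
  have key (t : 𝟙_ (Over (Spec (.of K))) ⟶ X) :
      IsFinite ((mulBy X m).left ∣_ ((translation (t ^ m)).left ⁻¹ᵁ V)) := by
    have h1 : ((translation t).left ≫ (mulBy X m).left) =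
        ((mulBy X m).left ≫ (translation (t ^ m)).left) := by
      rw [← Over.comp_left, translation_comp_mulBy, Over.comp_left]
    exact isFinite_morphismRestrict_of_comm _ _ _ h1 V hfin
  let W : X.left.Opens := ⨆ t : 𝟙_ (Over (Spec (.of K))) ⟶ X, (translation (t ^ m)).left ⁻¹ᵁ V
  have hW : W = ⊤ := by
    refine opens_eq_top_of_pt_mem W fun y => ?_
    obtain ⟨t, ht⟩ := exists_pt_mem (X := X)
      (((mulBy X m).left ≫ (translation y).left) ⁻¹ᵁ V).isOpen.isLocallyClosed
      (((mulBy X m).left ≫ (translation y).left).denseRange.inter_open_nonempty _ V.isOpen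
        ⟨v.1, v.2⟩ |>.elim fun x hx => hx.2.elim fun z hz => ⟨z, by
          change _ ∈ V; rw [hz]; exact hx.1⟩)
    refine TopologicalSpace.Opens.mem_iSup.mpr ⟨t, ?_⟩
    change (translation (t ^ m)).left (pt y) ∈ V
    change ((mulBy X m).left ≫ (translation y).left) (pt t) ∈ V at ht
    rw [← Over.comp_left, ← pt_comp, ← Category.assoc, comp_mulBy, point_comp_translation] at ht
    rwa [pt_translation, mul_comm]
  refine IsZariskiLocalAtTarget.of_forall_exists_morphismRestrict fun x => ?_
  have hx : x ∈ W := by rw [hW]; trivial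
  obtain ⟨t, ht⟩ := TopologicalSpace.Opens.mem_iSup.mp hx
  exact ⟨_, ht, key t⟩

/-- The smooth locus of `[m]` contains the generic point, by characteristic 0, and is stable under
translations. These act transitively on `K`-points, so it contains them all and is everything;
smooth morphisms are flat. -/
theorem flat_mulBy (m : ℕ) (hm : 0 < m) : Flat (mulBy X m).left := by
  have := isDominant_mulBy (X := X) m hm
  have := locallyOfFiniteType_left (mulBy X m)
  have : IsLocallyNoetherian X.left := LocallyOfFiniteType.isLocallyNoetherian X.hom
  have : LocallyOfFinitePresentation (mulBy X m).left :=
    LocallyOfFinitePresentation.iff_locallyOfFiniteType.mpr inferInstance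
  have hgen : genericPoint X.left ∈ (mulBy X m).left.smoothLocus := by
    rw [Scheme.Hom.mem_smoothLocus]
    obtain ⟨e, he⟩ := exists_iso_comp_stalkMap (mulBy X m).left
    rw [← RingHom.FormallySmooth.respectsIso.cancel_left_isIso e.hom, ← CommRingCat.hom_comp, he]
    have h1 := essFiniteType_funMap (mulBy X m).left
    have := charZero_functionField X
    exact formallySmooth_of_essFiniteType _ h1
  have hinv (t : 𝟙_ (Over (Spec (.of K))) ⟶ X) :
      (translation t).left ⁻¹ᵁ (mulBy X m).left.smoothLocus = (mulBy X m).left.smoothLocus := by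
    have h1 : ((translation t).left ≫ (mulBy X m).left) =
        ((mulBy X m).left ≫ (translation (t ^ m)).left) := by
      rw [← Over.comp_left, translation_comp_mulBy, Over.comp_left]
    ext x
    rw [Scheme.Hom.preimage_smoothLocus_eq]
    rw! [h1]
    refine Iff.symm ((RingHom.FormallySmooth.respectsIso.cancel_left_isIso
      ((translation (t ^ m)).left.stalkMap ((mulBy X m).left x))
      ((mulBy X m).left.stalkMap x)).symm.trans ?_)
    rw [← CommRingCat.hom_comp, ← Scheme.Hom.stalkMap_comp]
    rfl
  have htop : (mulBy X m).left.smoothLocus = ⊤ := by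
    obtain ⟨s, hs⟩ := exists_pt_mem (X := X)
      (mulBy X m).left.smoothLocus.isOpen.isLocallyClosed ⟨_, hgen⟩
    refine opens_eq_top_of_pt_mem _ fun t => ?_
    rw [← hinv (s * t⁻¹)]
    change (translation (s * t⁻¹)).left (pt t) ∈ (mulBy X m).left.smoothLocus
    rwa [pt_translation, inv_mul_cancel_right]
  have := Scheme.Hom.smoothLocus_eq_top_iff.mp htop
  infer_instance

theorem surjective_mulBy (m : ℕ) (hm : 0 < m) : Surjective (mulBy X m).left := by
  have := isDominant_mulBy (X := X) m hm
  have := isFinite_mulBy (X := X) m hm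
  constructor
  have := (mulBy X m).left.isClosedMap.isClosed_range
  exact Set.range_eq_univ.mp (by rw [← (mulBy X m).left.denseRange.closure_range, this.closure_eq])

end MulBy

/-! ### The extension `[m]^*` is Galois with the `m`-torsion as group; the degree criterion. -/

section Galois

/-- Separability is automatic in characteristic 0, and normality says that all embeddings into an
algebraic closure have the same image. -/
theorem IsFiniteGalois.of_forall_embedding {k L : Type*} [Field k] [Field L] [CharZero k]
    (φ : k →+* L) (hfin : φ.Finite)
    (h : ∀ σ : L →+* AlgebraicClosure L, σ.comp φ = (algebraMap L _).comp φ →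
      ∀ x, σ x ∈ (algebraMap L (AlgebraicClosure L)).fieldRange) : IsFiniteGalois φ := by
  let := φ.toAlgebra
  have : FiniteDimensional k L := hfin
  refine ⟨this, ?_⟩
  have hn : Normal k L := by
    let F : IntermediateField k (AlgebraicClosure L) :=
      (IsScalarTower.toAlgHom k L (AlgebraicClosure L)).fieldRange
    let e : L ≃ₐ[k] F := AlgEquiv.ofInjectiveField _
    have : Normal k F := by
      rw [IntermediateField.normal_iff_forall_fieldRange_le]
      rintro σ _ ⟨x, rfl⟩
      obtain ⟨y, rfl⟩ := e.surjective x
      obtain ⟨z, hz⟩ := h ((σ : F →+* AlgebraicClosure L).comp (e : L →+* F)) (by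
        ext c
        exact (congrArg σ (e.commutes c)).trans (σ.commutes c)) y
      exact ⟨z, hz⟩
    exact Normal.of_algEquiv e.symm
  exact ⟨⟩

variable {K : Type u} [Field K] [IsAlgClosed K] {X : Over (Spec (.of K))}

theorem exists_map_comp_fromSpecResidueField {E : Type u} [Field E] {X : Scheme.{u}}
    (z : Spec (.of E) ⟶ X) (x : X) (h : z (closedPt (.of E)) = x) :
    ∃ φ : X.residueField x ⟶ .of E, Spec.map φ ≫ X.fromSpecResidueField x = z := by
  subst h
  exact ⟨_, Scheme.descResidueField_stalkClosedPointTo_fromSpecResidueField E X z⟩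

/-- A field-valued point with closed image is constant. -/
theorem eq_toUnit_comp_of_apply_eq [LocallyOfFiniteType X.hom] {E : Type u} [Field E]
    (s : Spec (.of E) ⟶ Spec (.of K)) (z : Over.mk s ⟶ X)
    (t : 𝟙_ (Over (Spec (.of K))) ⟶ X) (h : z.left (closedPt (.of E)) = pt t) :
    z = toUnit _ ≫ t := by
  ext1
  obtain ⟨φ, hφ⟩ := exists_map_comp_fromSpecResidueField z.left (pt t) h
  have ht : t.left = pointOfClosedPoint X.hom (pt t) (isClosed_pt t) :=
    ext_of_apply_closedPoint_eq X.hom (Over.w t) (pointOfClosedPoint_comp X.hom _ _)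
      (pointOfClosedPoint_apply X.hom _ (isClosed_pt t) _).symm
  have hs : s = Spec.map ((residueFieldIsoBase X.hom (pt t) (isClosed_pt t)).inv ≫ φ) := by
    rw [Spec.map_comp, SpecMap_residueFieldIsoBase_inv, ← Category.assoc, hφ]
    exact (Over.w z).symm
  have hu : (toUnit (Over.mk s)).left = s := by
    have := Over.w (toUnit (Over.mk s))
    exact (Category.comp_id _).symm.trans this
  rw [Over.comp_left, hu, ht, ← hφ, hs, pointOfClosedPoint, ← Category.assoc, ← Spec.map_comp,
    Iso.hom_inv_id_assoc]

/-- The fibre over a closed point is closed, and by quasi-finiteness it is discrete. -/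
theorem isClosed_singleton_of_apply_eq {X Y : Scheme.{u}} (f : X ⟶ Y) [LocallyQuasiFinite f]
    {x : X} (h : IsClosed {f x}) : IsClosed {x} := by
  have hd : DiscreteTopology ↥(f ⁻¹' {f x}) :=
    isDiscrete_iff_discreteTopology.mp (f.isDiscrete_preimage_singleton (f x))
  have hc := (h.preimage f.continuous).isClosedEmbedding_subtypeVal
  have := hc.isClosedMap _ (isClosed_discrete {(⟨x, rfl⟩ : ↥(f ⁻¹' {f x}))})
  rwa [Set.image_singleton] at this

variable [CharZero K] [IsVariety X] [GrpObj X] [IsCommMonObj X]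

/-- Two field-valued points with the same `m`-th power differ by an `m`-torsion point. -/
theorem exists_eq_comp_translation {m : ℕ} (hm : 0 < m) {E : Type u} [Field E]
    (s : Spec (.of E) ⟶ Spec (.of K)) (x y : Over.mk s ⟶ X)
    (h : x ≫ mulBy X m = y ≫ mulBy X m) :
    ∃ t : 𝟙_ (Over (Spec (.of K))) ⟶ X, t ^ m = 1 ∧ y = x ≫ translation t := by
  have := isFinite_mulBy (X := X) m hm
  -- The quotient `y * x⁻¹` is killed by `m`, so its image point lies in the fibre of the finite
  -- morphism `[m]` over a closed point. It is therefore closed, and over an algebraically closed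
  -- field the quotient is a constant `K`-point.
  have hz : (y * x⁻¹) ^ m = 1 := by
    rw [comp_mulBy, comp_mulBy] at h
    rw [mul_pow, inv_pow, h, mul_inv_cancel]
  have hp : (mulBy X m).left ((y * x⁻¹).left (closedPt (.of E))) =
      pt (1 : 𝟙_ (Over (Spec (.of K))) ⟶ X) := by
    rw [← Scheme.Hom.comp_apply, ← Over.comp_left, comp_mulBy, hz,
      ← MonObj.comp_one (toUnit (Over.mk s)), Over.comp_left, Scheme.Hom.comp_apply]
    have : Subsingleton ↥(𝟙_ (Over (Spec (.of K)))).left :=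
      inferInstanceAs (Subsingleton (PrimeSpectrum K))
    exact congrArg _ (Subsingleton.elim _ _)
  obtain ⟨t, ht⟩ := exists_pt_eq ((y * x⁻¹).left (closedPt (.of E)))
    (isClosed_singleton_of_apply_eq (mulBy X m).left (by rw [hp]; exact isClosed_pt _))
  refine ⟨t, pt_injective ?_, ?_⟩
  · rw [← comp_mulBy, pt_comp, ht, hp]
  · rw [comp_translation, ← eq_toUnit_comp_of_apply_eq s (y * x⁻¹) t ht.symm,
      inv_mul_cancel_right]

theorem exists_pow_eq {m : ℕ} (hm : 0 < m) (t : 𝟙_ (Over (Spec (.of K))) ⟶ X) :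
    ∃ s : 𝟙_ (Over (Spec (.of K))) ⟶ X, s ^ m = t := by
  have := surjective_mulBy (X := X) m hm
  obtain ⟨s, hs⟩ := exists_pt_mem (X := X)
    ((isClosed_pt t).preimage (mulBy X m).left.continuous).isLocallyClosed
    ((mulBy X m).left.surjective (pt t))
  exact ⟨s, pt_injective (by rw [← comp_mulBy, pt_comp]; exact hs)⟩

/-- Embeddings of `K(X)` agreeing on the image of `[m]^*` differ by an `m`-torsion translation. -/
theorem exists_funMap_translation_comp {m : ℕ} (hm : 0 < m) [IsDominant (mulBy X m).left]
    {E : Type u} [Field E] (α β : X.left.functionField ⟶ .of E)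
    (h : funMap (mulBy X m).left ≫ α = funMap (mulBy X m).left ≫ β) :
    ∃ t : 𝟙_ (Over (Spec (.of K))) ⟶ X, t ^ m = 1 ∧ β = funMap (translation t).left ≫ α := by
  -- The embeddings `α` and `β` are read as two `E`-valued points of `X`; the hypothesis says that
  -- they have the same `m`-th power.
  have key : (Spec.map α ≫ gen X.left) ≫ (mulBy X m).left =
      (Spec.map β ≫ gen X.left) ≫ (mulBy X m).left := by
    rw [Category.assoc, Category.assoc, ← map_funMap_gen, ← Spec.map_comp_assoc, h,
      Spec.map_comp_assoc]
  have hw : (Spec.map β ≫ gen X.left) ≫ X.hom = (Spec.map α ≫ gen X.left) ≫ X.hom := by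
    rw [← Over.w (mulBy X m), ← Category.assoc, ← key, Category.assoc]
  obtain ⟨t, ht, h⟩ := exists_eq_comp_translation hm ((Spec.map α ≫ gen X.left) ≫ X.hom)
    (Over.homMk (Spec.map α ≫ gen X.left)) (Over.homMk (Spec.map β ≫ gen X.left) hw)
    (by ext1; exact key)
  refine ⟨t, ht, map_gen_injective ?_⟩
  rw [Spec.map_comp, Category.assoc, map_funMap_gen, ← Category.assoc]
  exact congrArg CommaMorphism.left h

omit [IsAlgClosed K] [CharZero K] in
theorem funMap_translation_comp {m : ℕ} [IsDominant (mulBy X m).left]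
    (t : 𝟙_ (Over (Spec (.of K))) ⟶ X) (ht : t ^ m = 1) :
    funMap (mulBy X m).left ≫ funMap (translation t).left = funMap (mulBy X m).left := by
  rw [← funMap_comp]
  exact funMap_congr (by rw [← Over.comp_left, translation_comp_mulBy, ht, translation_one,
    Category.comp_id])

/-- An embedding of `K(X)` into its algebraic closure that agrees with the inclusion on `[m]^* K(X)`
is the inclusion preceded by a translation, and translations preserve `K(X)`. -/
theorem isFiniteGalois_funMap_mulBy {m : ℕ} (hm : 0 < m) [IsDominant (mulBy X m).left] :
    IsFiniteGalois (funMap (mulBy X m).left).hom := by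
  have := charZero_functionField X
  refine .of_forall_embedding _ (finite_funMap_of_endomorphism _) fun σ hσ x => ?_
  obtain ⟨t, -, h⟩ := exists_funMap_translation_comp hm
    (CommRingCat.ofHom (algebraMap X.left.functionField (AlgebraicClosure X.left.functionField)))
    (CommRingCat.ofHom σ) (by ext x; exact (congr($hσ x)).symm)
  exact ⟨(funMap (translation t).left).hom x, congr($(congrArg CommRingCat.Hom.hom h) x).symm⟩

theorem noCommonSubextension_mulBy {Mf : Type*} [Field Mf] (ψ : X.left.functionField →+* Mf)
    {d : ℕ} (hd : (letI := ψ.toAlgebra; Module.finrank X.left.functionField Mf) = d)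
    (hd0 : 0 < d) [IsDominant (mulBy X d).left]
    (h : NoCommonSubextension (funMap (mulBy X d).left).hom ψ) {m : ℕ} (hm : 0 < m)
    [IsDominant (mulBy X m).left] :
    NoCommonSubextension (funMap (mulBy X m).left).hom ψ := by
  classical
  -- The identity at `m = 0` is a filler that makes `φ` total; only positive indices are ever used.
  let φ : ℕ → X.left.functionField →+* X.left.functionField := fun m =>
    if hm : 0 < m then
      have := isDominant_mulBy (X := X) m hm
      (funMap (mulBy X m).left).hom
    else RingHom.id _
  have hφ : ∀ m (hm : 0 < m) (_ : IsDominant (mulBy X m).left),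
      φ m = (funMap (mulBy X m).left).hom := fun m hm _ => dif_pos hm
  have hφ' : ∀ m (hm : 0 < m), ∃ (_ : IsDominant (mulBy X m).left),
      φ m = (funMap (mulBy X m).left).hom := fun m hm =>
    ⟨isDominant_mulBy (X := X) m hm, hφ m hm _⟩
  rw [← hφ _ hm]
  rw [← hφ _ hd0] at h
  refine NoCommonSubextension.of_finrank
    (fun t : 𝟙_ (Over (Spec (.of K))) ⟶ X => (funMap (translation t).left).hom) φ ?_ ?_ ?_ ?_ ?_
    ?_ ?_ ψ hd hd0 h hm
  · intro m n hm hn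
    obtain ⟨_, h₁⟩ := hφ' m hm
    obtain ⟨_, h₂⟩ := hφ' n hn
    obtain ⟨_, h₃⟩ := hφ' _ (Nat.mul_pos hm hn)
    rw [h₁, h₂, h₃, ← CommRingCat.hom_comp, ← funMap_comp]
    exact congrArg _ (funMap_congr (by rw [← Over.comp_left, mulBy_comp_mulBy]))
  · intro m hm
    obtain ⟨_, h₁⟩ := hφ' m hm
    rw [h₁]
    exact isFiniteGalois_funMap_mulBy hm
  · intro m hm g hg
    obtain ⟨_, h₁⟩ := hφ' m hm
    rw [h₁] at hg
    obtain ⟨t, ht, h⟩ := exists_funMap_translation_comp hm (𝟙 _) (CommRingCat.ofHom g)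
      (by ext x; exact congr($hg x).symm)
    exact ⟨t, ht, congrArg CommRingCat.Hom.hom (h.trans (Category.comp_id _))⟩
  · intro s t
    rw [← CommRingCat.hom_comp, ← funMap_comp]
    exact congrArg _ (funMap_congr (by rw [← Over.comp_left, translation_comp, mul_comm]))
  · exact congrArg CommRingCat.Hom.hom
      ((funMap_congr (by rw [translation_one, Over.id_left])).trans funMap_id)
  · intro m t hm ht
    obtain ⟨_, h₁⟩ := hφ' m hm
    rw [h₁, ← CommRingCat.hom_comp, funMap_translation_comp t ht]
  · exact fun m hm t => exists_pow_eq hm t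

theorem irreducibleSpace_pullbackMulBy_iff {Y : Over (Spec (.of K))} [IsVariety Y]
    (π : Y.left ⤏ X.left) [π.IsDominant] (hπ : (ratMap π).hom.Finite) {m : ℕ} (hm : 0 < m)
    [IsDominant (mulBy X m).left] :
    IrreducibleSpace ↥(pullbackMulBy m π) ↔
      NoCommonSubextension (funMap (mulBy X m).left).hom (ratMap π).hom := by
  have := charZero_functionField X
  have := isFinite_mulBy (X := X) m hm
  have := flat_mulBy (X := X) m hm
  exact irreducibleSpace_pullback_rationalMap_iff _ (isFiniteGalois_funMap_mulBy hm) π hπ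

theorem satisfiesPB_iff {Y : Over (Spec (.of K))} [IsVariety Y] (π : Y.left ⤏ X.left)
    (hπ : IsCover π) {d : ℕ} (hd : degree π = d) :
    SatisfiesPB π ↔ IrreducibleSpace ↥(pullbackMulBy d π) := by
  have := hπ.dominant
  have hfin := (functionFieldMap_finite_iff π).mp hπ.finite
  rw [degree_eq] at hd
  have hd0 : 0 < d := by
    let := (ratMap π).hom.toAlgebra
    have : Module.Finite X.left.functionField Y.left.functionField := hfin
    rw [← hd]
    exact Module.finrank_pos
  refine ⟨fun h => h d hd0, fun h m hm => ?_⟩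
  have := isDominant_mulBy (X := X) m hm
  have := isDominant_mulBy (X := X) d hd0
  rw [irreducibleSpace_pullbackMulBy_iff π hfin hm]
  rw [irreducibleSpace_pullbackMulBy_iff π hfin hd0] at h
  exact noCommonSubextension_mulBy _ hd hd0 h hm

end Galois

/-- The hypothesis `h` lets powers of `a` clear denominators within `S`. This is the algebra behind
the gluing of a sheaf of subrings. -/
theorem isLocalization_away_subring {B B' : Type*} [CommRing B] [CommRing B'] [Algebra B B']
    (S : Subring B) (S' : Subring B') (j : S →+* S') (hj : ∀ b, (j b : B') = algebraMap B B' b)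
    (a : S) [IsLocalization.Away (a : B) B'] (hu : IsUnit (j a))
    (h : ∀ b : B, algebraMap B B' b ∈ S' → ∃ n : ℕ, (a : B) ^ n * b ∈ S) :
    letI := j.toAlgebra; IsLocalization.Away a S' := by
  let := j.toAlgebra
  refine IsLocalization.Away.mk a hu (fun z => ?_) (fun b c hbc => ?_)
  · obtain ⟨n, b, hb⟩ := IsLocalization.Away.surj (a : B) (z : B')
    obtain ⟨m, hm⟩ := h b (by
      rw [← hb, ← hj, ← SubmonoidClass.coe_pow]
      exact S'.mul_mem z.2 (SetLike.coe_mem _))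
    refine ⟨m + n, ⟨_, hm⟩, Subtype.ext ?_⟩
    change (z : B') * ((j a ^ (m + n) : S') : B') = (j ⟨_, hm⟩ : B')
    rw [hj, SubmonoidClass.coe_pow, hj, map_mul, ← hb, map_pow]
    ring
  · have : algebraMap B B' b = algebraMap B B' c := by
      rw [← hj, ← hj]
      exact congrArg Subtype.val hbc
    obtain ⟨n, hn⟩ := IsLocalization.Away.exists_of_eq (a : B) this
    exact ⟨n, Subtype.ext hn⟩

/-! ### Relative spectrum of a quasi-coherent sheaf of subrings. -/

section SubringGluing

open Scheme.AffineZariskiSite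

variable {X Y : Scheme.{u}} (f : X ⟶ Y)

/-- A quasi-coherent sheaf of subrings of `f_* 𝒪_X` containing the image of `𝒪_Y`. -/
structure SubringSheaf where
  obj (U : Y.Opens) : Subring Γ(X, f ⁻¹ᵁ U)
  app_mem (U : Y.Opens) (r : Γ(Y, U)) : f.app U r ∈ obj U
  map_mem {U V : Y.Opens} (h : U ≤ V) {b : Γ(X, f ⁻¹ᵁ V)} (hb : b ∈ obj V) :
    X.presheaf.map (homOfLE (f.preimage_mono h)).op b ∈ obj U
  mem_of_map_mem {U : Y.Opens} (hU : IsAffineOpen U) (r : Γ(Y, U)) {b : Γ(X, f ⁻¹ᵁ U)}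
    (hb : X.presheaf.map (homOfLE (f.preimage_mono (Y.basicOpen_le r))).op b ∈
      obj (Y.basicOpen r)) : ∃ n : ℕ, f.app U r ^ n * b ∈ obj U

namespace SubringSheaf

variable {f} (S : SubringSheaf f)

/-- The associated functor on affine opens. -/
abbrev functor : Y.AffineZariskiSiteᵒᵖ ⥤ CommRingCat where
  obj U := .of (S.obj U.unop.1)
  map i := CommRingCat.ofHom ((X.presheaf.map
    (homOfLE (f.preimage_mono (toOpens_mono i.unop.le))).op).hom.restrict _ _
      fun _ hx => S.map_mem (toOpens_mono i.unop.le) hx)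
  map_id U := by
    ext x
    exact congr($(X.presheaf.map_id _) x.1)
  map_comp i j := by
    ext x
    exact congr($(X.presheaf.map_comp (homOfLE (f.preimage_mono (toOpens_mono i.unop.le))).op
      (homOfLE (f.preimage_mono (toOpens_mono j.unop.le))).op) x.1)

/-- The structure map. -/
def structureMap : (toOpensFunctor Y).op ⋙ Y.presheaf ⟶ S.functor where
  app U := CommRingCat.ofHom ((f.app U.unop.1).hom.codRestrict _ (S.app_mem _))
  naturality {U V} i := by
    ext x
    have h := f.naturality ((toOpensFunctor Y).map i.unop).op
    exact congr($h x)

/-- This is quasi-coherence: restriction to a basic open is localization, which is the condition for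
the affine spectra to glue over `Y`. -/
theorem coequifibered [IsAffineHom f] : S.structureMap.Coequifibered := by
  refine coequifibered_iff_forall_isLocalizationAway.mpr fun U r => ?_
  have hloc : letI := (X.presheaf.map (homOfLE (f.preimage_mono (Y.basicOpen_le r))).op).hom.toAlgebra
      IsLocalization.Away (f.app U.1 r) Γ(X, f ⁻¹ᵁ (Y.basicOpen r)) := by
    -- The preimage of a basic open is a basic open only up to a propositional equality, so the open
    -- set is made a variable.
    have key : ∀ (V : X.Opens) (hV : V = X.basicOpen (f.app U.1 r)) (i : V ≤ f ⁻¹ᵁ U.1),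
        letI := (X.presheaf.map (homOfLE i).op).hom.toAlgebra
        IsLocalization.Away (f.app U.1 r) Γ(X, V) := by
      rintro _ rfl i
      exact (U.2.preimage f).isLocalization_basicOpen _
    exact key _ (f.preimage_basicOpen r) _
  let := (X.presheaf.map (homOfLE (f.preimage_mono (Y.basicOpen_le r))).op).hom.toAlgebra
  let j : S.obj U.1 →+* S.obj (Y.basicOpen r) :=
    (S.functor.map (homOfLE (U.basicOpen_le r)).op).hom
  refine isLocalization_away_subring (S.obj U.1) (S.obj (Y.basicOpen r)) j (fun _ => rfl)
    ⟨f.app U.1 r, S.app_mem _ _⟩ ?_ fun b hb => S.mem_of_map_mem U.2 r hb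
  have h1 : IsUnit (Y.presheaf.map (homOfLE (Y.basicOpen_le r)).op r) :=
    RingedSpace.isUnit_res_basicOpen _ r
  have h2 := h1.map ((f.app (Y.basicOpen r)).hom.codRestrict (S.obj (Y.basicOpen r)) (S.app_mem _))
  convert h2 using 1
  exact Subtype.ext congr($(f.naturality (homOfLE (Y.basicOpen_le r)).op) r).symm

variable [IsAffineHom f]

/-- The gluing datum. -/
noncomputable def glueData : (directedCover Y).RelativeGluingData :=
  relativeGluingData S.coequifibered

instance : (S.glueData.functor ⋙ Scheme.forget).IsLocallyDirected :=
  Scheme.Cover.RelativeGluingData.instIsLocallyDirectedI₀CompFunctorForgetOfIsThin ..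

/-- The relative spectrum. -/
noncomputable def spec : Scheme.{u} := S.glueData.glued

/-- The inclusion of the part over an affine open. -/
noncomputable def specMap (U : Y.AffineZariskiSite) :
    Spec (CommRingCat.of (S.obj U.1)) ⟶ S.spec :=
  S.glueData.cover.f U

instance (U : Y.AffineZariskiSite) : IsOpenImmersion (S.specMap U) :=
  S.glueData.cover.map_prop U

/-- The structure morphism. -/
noncomputable def fromSpec : S.spec ⟶ Y := S.glueData.toBase

/-- The structure map on an affine open. -/
def incl (U : Y.Opens) : Γ(Y, U) ⟶ CommRingCat.of (S.obj U) :=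
  CommRingCat.ofHom ((f.app U).hom.codRestrict _ (S.app_mem _))

theorem specMap_fromSpec {U : Y.AffineZariskiSite} (hU : IsAffineOpen U.1) :
    S.specMap U ≫ S.fromSpec = Spec.map (S.incl U.1) ≫ hU.fromSpec :=
  colimit.ι_desc _ _

theorem map_specMap {U V : Y.AffineZariskiSite} (i : U ⟶ V) :
    Spec.map (S.functor.map i.op) ≫ S.specMap V = S.specMap U :=
  colimit.w S.glueData.functor i

theorem preimage_fromSpec (U : Y.AffineZariskiSite) :
    S.fromSpec ⁻¹ᵁ U.1 = (S.specMap U).opensRange := by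
  have := S.glueData.toBase_preimage_eq_opensRange_ι U
  have hr : ((directedCover Y).f U).opensRange = U.1 := U.1.opensRange_ι
  rw [hr] at this
  exact this

/-- The morphism from the source, on the preimage of an affine open. -/
noncomputable def toSpecOn (U : Y.AffineZariskiSite) : (f ⁻¹ᵁ U.1).toScheme ⟶ S.spec :=
  (f ⁻¹ᵁ U.1).toSpecΓ ≫ Spec.map (CommRingCat.ofHom (S.obj U.1).subtype) ≫ S.specMap U

theorem homOfLE_toSpecOn {U V : Y.AffineZariskiSite} (i : U ⟶ V) :
    X.homOfLE (f.preimage_mono (toOpens_mono i.le)) ≫ S.toSpecOn V = S.toSpecOn U := by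
  have h : CommRingCat.ofHom (S.obj V.1).subtype ≫
      X.presheaf.map (homOfLE (f.preimage_mono (toOpens_mono i.le))).op =
      S.functor.map i.op ≫ CommRingCat.ofHom (S.obj U.1).subtype := rfl
  rw [toSpecOn, toSpecOn, ← S.map_specMap i, ← Spec.map_comp_assoc,
    ← Scheme.Opens.toSpecΓ_SpecMap_presheaf_map_assoc, ← Spec.map_comp_assoc]
  exact congrArg (fun x => (f ⁻¹ᵁ U.1).toSpecΓ ≫ Spec.map x ≫ S.specMap V) h

omit [IsAffineHom f] in
theorem trans_comp_pullbackRestrictIsoRestrict {U V : Y.AffineZariskiSite} (i : U ⟶ V) :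
    Scheme.Cover.trans ((directedCover Y).pullback₁ f) i ≫
      (pullbackRestrictIsoRestrict f V.1).hom = (pullbackRestrictIsoRestrict f U.1).hom ≫
        X.homOfLE (f.preimage_mono (toOpens_mono i.le)) := by
  refine (cancel_mono (f ⁻¹ᵁ V.1).ι).mp ?_
  refine (Category.assoc _ _ _).trans
    ((congrArg _ (pullbackRestrictIsoRestrict_hom_ι f V.1)).trans (.trans ?_
      (Category.assoc _ _ _).symm))
  rw [Scheme.homOfLE_ι]
  exact ((pullback.lift_fst _ _ _).trans (Category.comp_id _)).trans
    (pullbackRestrictIsoRestrict_hom_ι f U.1).symm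

/-- The canonical morphism to the relative spectrum. -/
noncomputable def toSpec : X ⟶ S.spec :=
  Scheme.OpenCover.glueMorphismsOfLocallyDirected ((directedCover Y).pullback₁ f)
    (fun U => (pullbackRestrictIsoRestrict f _).hom ≫ S.toSpecOn U) fun i =>
    (Category.assoc _ _ _).symm.trans
      ((congrArg (· ≫ S.toSpecOn _) (trans_comp_pullbackRestrictIsoRestrict i)).trans
        ((Category.assoc _ _ _).trans (congrArg _ (S.homOfLE_toSpecOn i))))

theorem ι_toSpec (U : Y.AffineZariskiSite) :
    (f ⁻¹ᵁ U.1).ι ≫ S.toSpec = S.toSpecOn U := by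
  rw [← cancel_epi (pullbackRestrictIsoRestrict f U.1).hom, ← Category.assoc]
  trans ((directedCover Y).pullback₁ f).f U ≫ S.toSpec
  · congr 1
    exact pullbackRestrictIsoRestrict_hom_ι f U.1
  delta toSpec
  generalize_proofs _ _ _ _ H
  exact Scheme.OpenCover.map_glueMorphismsOfLocallyDirected _ _ H _

theorem toSpecOn_fromSpec (U : Y.AffineZariskiSite) :
    S.toSpecOn U ≫ S.fromSpec = (f ⁻¹ᵁ U.1).ι ≫ f := by
  have hU : IsAffineOpen U.1 := U.2
  rw [toSpecOn, Category.assoc, Category.assoc, S.specMap_fromSpec hU, ← Spec.map_comp_assoc]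
  have : S.incl U.1 ≫ CommRingCat.ofHom (S.obj U.1).subtype = f.app U.1 := rfl
  rw [this]
  simp

theorem toSpec_fromSpec : S.toSpec ≫ S.fromSpec = f :=
  Scheme.Cover.hom_ext (X.openCoverOfIsOpenCover _
    (.comap (iSup_affineOpens_eq_top Y) f.base.1)) _ _ fun U =>
    (Category.assoc _ _ _).symm.trans
      ((congrArg (· ≫ S.fromSpec) (S.ι_toSpec U)).trans (S.toSpecOn_fromSpec U))

theorem isAffineOpen_preimage_fromSpec (U : Y.AffineZariskiSite) :
    IsAffineOpen (S.fromSpec ⁻¹ᵁ U.1) := by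
  rw [S.preimage_fromSpec]
  exact isAffineOpen_opensRange _

instance : IsAffineHom S.fromSpec :=
  ⟨fun U hU => S.isAffineOpen_preimage_fromSpec ⟨U, hU⟩⟩

/-- The sections of the relative spectrum over an affine open. -/
theorem appLE_toSpec (U : Y.AffineZariskiSite) (h : f ⁻¹ᵁ U.1 ≤ S.toSpec ⁻¹ᵁ S.fromSpec ⁻¹ᵁ U.1) :
    ∃ e : Γ(S.spec, S.fromSpec ⁻¹ᵁ U.1) ≅ CommRingCat.of (S.obj U.1),
      e.hom ≫ CommRingCat.ofHom (S.obj U.1).subtype =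
        S.toSpec.appLE (S.fromSpec ⁻¹ᵁ U.1) (f ⁻¹ᵁ U.1) h := by
  have hV : S.specMap U ⁻¹ᵁ S.fromSpec ⁻¹ᵁ U.1 = ⊤ := by
    rw [S.preimage_fromSpec, Scheme.Hom.preimage_opensRange]
  have : IsIso ((S.specMap U).app (S.fromSpec ⁻¹ᵁ U.1)) :=
    Scheme.Hom.isIso_app _ _ (S.preimage_fromSpec U).le
  have : IsIso ((S.specMap U).appLE (S.fromSpec ⁻¹ᵁ U.1) ⊤ hV.ge) := by
    rw [Scheme.Hom.appLE]
    have := (Spec (CommRingCat.of (S.obj U.1))).presheaf.map_isIso (eqToHom hV.symm).op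
    exact IsIso.comp_isIso' inferInstance this
  refine ⟨asIso ((S.specMap U).appLE (S.fromSpec ⁻¹ᵁ U.1) ⊤ hV.ge) ≪≫ Scheme.ΓSpecIso _, ?_⟩
  have h0 : ⊤ ≤ ((f ⁻¹ᵁ U.1).ι ≫ S.toSpec) ⁻¹ᵁ S.fromSpec ⁻¹ᵁ U.1 := by
    rw [← Scheme.Hom.comp_preimage, Category.assoc, S.toSpec_fromSpec, Scheme.Hom.comp_preimage,
      Scheme.Opens.ι_preimage_self]
  have h1 : S.toSpec.appLE (S.fromSpec ⁻¹ᵁ U.1) (f ⁻¹ᵁ U.1) h ≫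
      (f ⁻¹ᵁ U.1).ι.appLE (f ⁻¹ᵁ U.1) ⊤ (Scheme.Opens.ι_preimage_self _).ge =
      ((f ⁻¹ᵁ U.1).ι ≫ S.toSpec).appLE (S.fromSpec ⁻¹ᵁ U.1) ⊤ h0 :=
    Scheme.Hom.appLE_comp_appLE ..
  have h2 : (f ⁻¹ᵁ U.1).ι.appLE (f ⁻¹ᵁ U.1) ⊤ (Scheme.Opens.ι_preimage_self _).ge =
      (f ⁻¹ᵁ U.1).topIso.inv := by
    rw [Scheme.Opens.ι_appLE]
    rfl
  have h3 : (f ⁻¹ᵁ U.1).ι ≫ S.toSpec = ((f ⁻¹ᵁ U.1).toSpecΓ ≫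
    Spec.map (CommRingCat.ofHom (S.obj U.1).subtype)) ≫ S.specMap U :=
    (S.ι_toSpec U).trans (Category.assoc _ _ _).symm
  have h4 : ((f ⁻¹ᵁ U.1).ι ≫ S.toSpec).appLE (S.fromSpec ⁻¹ᵁ U.1) ⊤ h0 =
      (S.specMap U).appLE (S.fromSpec ⁻¹ᵁ U.1) ⊤ hV.ge ≫ ((f ⁻¹ᵁ U.1).toSpecΓ ≫
        Spec.map (CommRingCat.ofHom (S.obj U.1).subtype)).appTop := by
    have h5 : ((f ⁻¹ᵁ U.1).toSpecΓ ≫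
        Spec.map (CommRingCat.ofHom (S.obj U.1).subtype)).appTop = Scheme.Hom.appLE _ ⊤ ⊤ le_rfl :=
      (Scheme.Hom.appLE_eq_app _).symm
    rw [h5]
    refine .trans ?_ (Scheme.Hom.appLE_comp_appLE _ (S.specMap U) (S.fromSpec ⁻¹ᵁ U.1) ⊤ ⊤
      hV.ge le_rfl).symm
    simp only [h3]
  rw [← cancel_mono (f ⁻¹ᵁ U.1).topIso.inv, ← h2, h1, h4, h2, Scheme.Hom.comp_appTop,
    Scheme.Opens.toSpecΓ_appTop, Iso.trans_hom, asIso_hom]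
  simp only [Category.assoc]
  rw [← Scheme.ΓSpecIso_naturality_assoc]

end SubringSheaf

end SubringGluing

/-! ### Integrality and finiteness of the relative spectrum; sheaves cut out by a subfield. -/

namespace SubringSheaf

section Spec

variable {X Y : Scheme.{u}} {f : X ⟶ Y} [IsAffineHom f] (S : SubringSheaf f)

theorem preimage_toSpec (V : Y.Opens) : S.toSpec ⁻¹ᵁ S.fromSpec ⁻¹ᵁ V = f ⁻¹ᵁ V := by
  rw [← Scheme.Hom.comp_preimage, S.toSpec_fromSpec]

theorem appLE_toSpec_injective {U : Y.Opens} (hU : IsAffineOpen U) :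
    Function.Injective
      (S.toSpec.appLE (S.fromSpec ⁻¹ᵁ U) (f ⁻¹ᵁ U) (S.preimage_toSpec U).ge).hom := by
  obtain ⟨e, he⟩ := S.appLE_toSpec ⟨U, hU⟩ (S.preimage_toSpec U).ge
  rw [← he]
  exact Subtype.val_injective.comp e.commRingCatIsoToRingEquiv.injective

theorem range_appLE_toSpec {U : Y.Opens} (hU : IsAffineOpen U) :
    (S.toSpec.appLE (S.fromSpec ⁻¹ᵁ U) (f ⁻¹ᵁ U) (S.preimage_toSpec U).ge).hom.range =
      S.obj U := by
  obtain ⟨e, he⟩ := S.appLE_toSpec ⟨U, hU⟩ (S.preimage_toSpec U).ge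
  rw [← he]
  ext b
  constructor
  · rintro ⟨x, rfl⟩
    exact (e.hom x).2
  · intro hb
    obtain ⟨x, hx⟩ := e.commRingCatIsoToRingEquiv.surjective ⟨b, hb⟩
    exact ⟨x, congrArg Subtype.val hx⟩

/-- A basic open missed by the image comes from a section `s` whose pull-back has empty basic open.
The pull-back is zero because `X` is reduced, and `s` is zero because sections inject. -/
theorem isDominant_toSpec [IsReduced X] : IsDominant S.toSpec := by
  refine ⟨dense_iff_inter_open.mpr fun V hV hne => ?_⟩
  obtain ⟨z, hz⟩ := hne
  obtain ⟨_, ⟨U, hU, rfl⟩, hzU, -⟩ := Y.isBasis_affineOpens.exists_subset_of_mem_open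
    (Set.mem_univ (S.fromSpec z)) isOpen_univ
  have hU : IsAffineOpen U := hU
  have hUZ : IsAffineOpen (S.fromSpec ⁻¹ᵁ U) := hU.preimage S.fromSpec
  obtain ⟨s, hs, hzs⟩ := hUZ.exists_basicOpen_le (V := ⟨V, hV⟩) ⟨z, hz⟩ hzU
  by_contra hcon
  have h1 : X.basicOpen (S.toSpec.appLE (S.fromSpec ⁻¹ᵁ U) (f ⁻¹ᵁ U)
      (S.preimage_toSpec U).ge s) = ⊥ := by
    rw [Scheme.basicOpen_appLE]
    refine le_bot_iff.mp fun x hx => hcon ⟨S.toSpec x, hs hx.2, x, rfl⟩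
  rw [basicOpen_eq_bot_iff, map_eq_zero_iff _ (S.appLE_toSpec_injective hU)] at h1
  subst h1
  rw [Scheme.basicOpen_zero] at hzs
  exact hzs

instance [IsIntegral X] : IsIntegral S.spec := by
  have := S.isDominant_toSpec
  have : IrreducibleSpace S.spec := by
    have h := ((IrreducibleSpace.isIrreducible_univ X).image S.toSpec
      S.toSpec.continuous.continuousOn).closure
    rw [Set.image_univ, S.toSpec.denseRange.closure_range] at h
    exact (irreducibleSpace_def _).mpr h
  have : IsReduced S.spec := by
    have h (U : Y.AffineZariskiSite) : AlgebraicGeometry.IsReduced (S.glueData.cover.X U) :=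
      have : _root_.IsReduced (S.obj U.1) :=
        isReduced_of_injective (S.obj U.1).subtype Subtype.val_injective
      inferInstanceAs (AlgebraicGeometry.IsReduced (Spec (CommRingCat.of (S.obj U.1))))
    exact @IsReduced.of_openCover _ S.glueData.cover h
  exact isIntegral_of_irreducibleSpace_of_isReduced _

/-- Over an affine open the sections form a submodule of a finite module over a noetherian ring. -/
theorem isFinite_fromSpec (hf : IsFinite f) [IsLocallyNoetherian Y] : IsFinite S.fromSpec := by
  refine ⟨fun U hU => ?_⟩
  have h1 : S.fromSpec.app U ≫
      S.toSpec.appLE (S.fromSpec ⁻¹ᵁ U) (f ⁻¹ᵁ U) (S.preimage_toSpec U).ge = f.app U := by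
    rw [Scheme.Hom.app_eq_appLE, Scheme.Hom.appLE_comp_appLE, Scheme.Hom.app_eq_appLE]
    simp only [S.toSpec_fromSpec]
  have h2 : (f.app U).hom.Finite := IsFinite.finite_app (f := f) U hU
  have h3 := S.appLE_toSpec_injective hU
  have : IsNoetherianRing Γ(Y, U) := IsLocallyNoetherian.component_noetherian ⟨U, hU⟩
  rw [← h1] at h2
  revert h2 h3
  generalize S.fromSpec.app U = g
  generalize S.toSpec.appLE _ _ _ = h
  intro h2 h3
  algebraize [g.hom, h.hom, (g ≫ h).hom]
  have : IsScalarTower Γ(Y, U) Γ(S.spec, S.fromSpec ⁻¹ᵁ U) Γ(X, f ⁻¹ᵁ U) := .of_algebraMap_eq' rfl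
  exact Module.Finite.of_injective (IsScalarTower.toAlgHom Γ(Y, U) _ Γ(X, f ⁻¹ᵁ U)).toLinearMap h3

end Spec

section OfSubfield

variable {X Y : Scheme.{u}} [IsIntegral X] [IsIntegral Y] (f : X ⟶ Y) [IsDominant f]

/-- The sheaf of sections which lie in a given subfield of the function field. -/
noncomputable def ofSubfield (F : Subfield X.functionField) (hF : ∀ x, funMap f x ∈ F) : SubringSheaf f where
  -- The infimum over a proposition imposes no condition when the generic point is absent, so the
  -- definition makes sense for every `U`.
  obj U := ⨅ h : genericPoint X ∈ f ⁻¹ᵁ U,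
    F.toSubring.comap (X.presheaf.germ (f ⁻¹ᵁ U) _ h).hom
  app_mem U r := by
    refine Subring.mem_iInf.mpr fun h => ?_
    have hU : genericPoint Y ∈ U := by rw [← apply_genericPoint f]; exact h
    have := congr($(germ_funMap f U hU h) r)
    change X.presheaf.germ (f ⁻¹ᵁ U) _ h (f.app U r) ∈ F
    rw [← CommRingCat.comp_apply, ← this]
    exact hF _
  map_mem {U V} h b hb := by
    refine Subring.mem_iInf.mpr fun hU => ?_
    have := Subring.mem_iInf.mp hb (f.preimage_mono h hU)
    change X.presheaf.germ (f ⁻¹ᵁ U) _ hU (X.presheaf.map _ b) ∈ F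
    rw [X.presheaf.germ_res_apply]
    exact this
  mem_of_map_mem {U} hU r b hb := by
    -- Restriction does not change the germ at the generic point, so `n = 0` suffices if that point
    -- is present. Otherwise the preimage of the basic open is empty, `f.app U r` vanishes, and `n =
    -- 1` works.
    by_cases hr : genericPoint X ∈ f ⁻¹ᵁ Y.basicOpen r
    · refine ⟨0, Subring.mem_iInf.mpr fun h => ?_⟩
      have := Subring.mem_iInf.mp hb hr
      change X.presheaf.germ _ _ hr (X.presheaf.map _ b) ∈ F at this
      rw [X.presheaf.germ_res_apply] at this
      rw [pow_zero, one_mul]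
      exact this
    · refine ⟨1, ?_⟩
      have h0 : f.app U r = 0 := by
        rw [← basicOpen_eq_bot_iff, ← Scheme.preimage_basicOpen]
        by_contra hne
        have hne : Nonempty ↥(f ⁻¹ᵁ Y.basicOpen r) := by
          rw [← ne_eq, ← TopologicalSpace.Opens.coe_eq_empty.ne, ← Set.nonempty_iff_ne_empty] at hne
          exact ⟨⟨_, hne.choose_spec⟩⟩
        exact hr (genericPoint_mem (f ⁻¹ᵁ Y.basicOpen r) (h := hne))
      rw [h0, pow_one, zero_mul]
      exact Subring.zero_mem _

theorem mem_ofSubfield {F : Subfield X.functionField} {hF : ∀ x, funMap f x ∈ F} {U : Y.Opens}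
    (h : genericPoint X ∈ f ⁻¹ᵁ U) (b : Γ(X, f ⁻¹ᵁ U)) :
    b ∈ (ofSubfield f F hF).obj U ↔ X.presheaf.germ (f ⁻¹ᵁ U) _ h b ∈ F :=
  Subring.mem_iInf.trans ⟨fun H => H h, fun H _ => H⟩

theorem funMap_germ {Z : Scheme.{u}} [IsIntegral Z] (q : X ⟶ Z) [IsDominant q] {W : Z.Opens}
    {V : X.Opens} (e : V ≤ q ⁻¹ᵁ W) (hV : genericPoint X ∈ V) (hW : genericPoint Z ∈ W)
    (c : Γ(Z, W)) :
    funMap q (Z.presheaf.germ W _ hW c) = X.presheaf.germ V _ hV (q.appLE W V e c) := by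
  have := congr($(germ_funMap q W hW (e hV)) c)
  rw [CommRingCat.comp_apply] at this
  rw [this, Scheme.Hom.appLE, CommRingCat.comp_apply, CommRingCat.comp_apply,
    X.presheaf.germ_res_apply]

/-- The function field of the relative spectrum is the given subfield. -/
theorem fieldRange_funMap_toSpec [IsIntegralHom f] {F : Subfield X.functionField}
    {hF : ∀ x, funMap f x ∈ F} [IsDominant (ofSubfield f F hF).toSpec] :
    (funMap (ofSubfield f F hF).toSpec).hom.fieldRange = F := by
  set S := ofSubfield f F hF with hS
  obtain ⟨_, ⟨V, hV, rfl⟩, hVx, -⟩ := Y.isBasis_affineOpens.exists_subset_of_mem_open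
    (Set.mem_univ (genericPoint Y)) isOpen_univ
  have hVx : genericPoint Y ∈ V := hVx
  have hV : IsAffineOpen V := hV
  have hf := hV.preimage f
  have hW := hV.preimage S.fromSpec
  have hfx : genericPoint X ∈ f ⁻¹ᵁ V := by
    change f (genericPoint X) ∈ V
    rwa [apply_genericPoint f]
  have hWx : genericPoint S.spec ∈ S.fromSpec ⁻¹ᵁ V := by
    rw [← S.preimage_toSpec] at hfx
    have : S.toSpec (genericPoint X) ∈ S.fromSpec ⁻¹ᵁ V := hfx
    rwa [apply_genericPoint S.toSpec] at this
  have key (c : Γ(S.spec, S.fromSpec ⁻¹ᵁ V)) := funMap_germ S.toSpec (S.preimage_toSpec V).ge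
    hfx hWx c
  have hrange := S.range_appLE_toSpec hV
  have : Nonempty V := ⟨⟨_, hVx⟩⟩
  have : Nonempty (f ⁻¹ᵁ V) := ⟨⟨_, hfx⟩⟩
  have : Nonempty (S.fromSpec ⁻¹ᵁ V) := ⟨⟨_, hWx⟩⟩
  have hmem (c : Γ(S.spec, S.fromSpec ⁻¹ᵁ V)) :
      funMap S.toSpec (S.spec.presheaf.germ _ _ hWx c) ∈ F := by
    rw [key, ← mem_ofSubfield f (F := F) (hF := hF) hfx]
    exact hrange.le ⟨c, rfl⟩
  have hmem' (b : Γ(X, f ⁻¹ᵁ V)) (hb : X.presheaf.germ _ _ hfx b ∈ F) :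
      X.presheaf.germ _ _ hfx b ∈ (funMap S.toSpec).hom.fieldRange := by
    rw [← mem_ofSubfield f (F := F) (hF := hF) hfx] at hb
    obtain ⟨c, rfl⟩ := hrange.ge hb
    exact ⟨_, key c⟩
  refine le_antisymm ?_ fun x hx => ?_
  · rintro _ ⟨z, rfl⟩
    let := (S.spec.presheaf.germ (S.fromSpec ⁻¹ᵁ V) _ hWx).hom.toAlgebra
    have : IsFractionRing Γ(S.spec, S.fromSpec ⁻¹ᵁ V) S.spec.functionField :=
      functionField_isFractionRing_of_isAffineOpen S.spec _ hW
    obtain ⟨c, d, hd, rfl⟩ := IsFractionRing.div_surjective (A := Γ(S.spec, S.fromSpec ⁻¹ᵁ V)) z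
    rw [map_div₀]
    exact F.div_mem (hmem c) (hmem d)
  · let := (f.app V).hom.toAlgebra
    let := (X.presheaf.germ (f ⁻¹ᵁ V) _ hfx).hom.toAlgebra
    have : IsFractionRing Γ(X, f ⁻¹ᵁ V) X.functionField :=
      functionField_isFractionRing_of_isAffineOpen X _ hf
    have : Algebra.IsIntegral Γ(Y, V) Γ(X, f ⁻¹ᵁ V) := ⟨f.isIntegral_app V hV⟩
    have hgerm (a : Γ(Y, V)) : funMap f (Y.presheaf.germ V _ hVx a) =
        X.presheaf.germ _ _ hfx (f.app V a) := by
      have := funMap_germ f le_rfl hfx hVx a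
      rwa [Scheme.Hom.appLE_eq_app] at this
    have hinj : Function.Injective (algebraMap Γ(Y, V) Γ(X, f ⁻¹ᵁ V)) := by
      have : IsFractionRing Γ(Y, V) Y.functionField :=
        functionField_isFractionRing_of_isAffineOpen Y V hV
      intro a b hab
      refine IsFractionRing.injective Γ(Y, V) Y.functionField ((funMap f).hom.injective ?_)
      exact (hgerm a).trans ((congrArg _ hab).trans (hgerm b).symm)
    have hloc : IsLocalization (Algebra.algebraMapSubmonoid Γ(X, f ⁻¹ᵁ V)
      (nonZeroDivisors Γ(Y, V))) X.functionField := isLocalization_of_isIntegral hinj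
    -- An element of `F` is written with a denominator from the base. That denominator lies in `F`,
    -- hence so does the numerator, and both are sections of the subring sheaf.
    obtain ⟨⟨b, ⟨_, a, ha, rfl⟩⟩, hb⟩ := IsLocalization.surj
      (Algebra.algebraMapSubmonoid Γ(X, f ⁻¹ᵁ V) (nonZeroDivisors Γ(Y, V))) x
    have hb : x * X.presheaf.germ _ _ hfx (f.app V a) = X.presheaf.germ _ _ hfx b := hb
    have ha1 : X.presheaf.germ _ _ hfx (f.app V a) ∈ F := by
      rw [← hgerm]
      exact hF _
    have ha0 : X.presheaf.germ _ _ hfx (f.app V a) ≠ 0 := by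
      have h := IsLocalization.map_units X.functionField
        (⟨_, a, ha, rfl⟩ : Algebra.algebraMapSubmonoid Γ(X, f ⁻¹ᵁ V) (nonZeroDivisors Γ(Y, V)))
      exact h.ne_zero
    rw [eq_div_of_mul_eq ha0 hb]
    exact div_mem (hmem' _ (by rw [← hb]; exact F.mul_mem hx ha1)) (hmem' _ ha1)

end OfSubfield

end SubringSheaf

/-! ### Étale quotients by endomorphisms and descent of invariant morphisms. -/

section Quotient

theorem isPullback_whiskerRight {C : Type*} [Category* C] [CartesianMonoidalCategory C] {X Z : C}
    (q : X ⟶ Z) (W : C) : IsPullback (fst X W) (q ▷ W) q (fst Z W) := by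
  refine ⟨⟨by simp⟩, ⟨PullbackCone.IsLimit.mk _ (fun s => lift s.fst (s.snd ≫ snd _ _)) ?_ ?_ ?_⟩⟩
  · intro s
    simp
  · intro s
    ext
    · simp [s.condition]
    · simp
  · intro s m h1 h2
    ext
    · simp [h1]
    · simp [← h2]

theorem isPullback_whiskerLeft {C : Type*} [Category* C] [CartesianMonoidalCategory C] {X Z : C}
    (q : X ⟶ Z) (W : C) : IsPullback (snd W X) (W ◁ q) q (snd W Z) := by
  refine ⟨⟨by simp⟩, ⟨PullbackCone.IsLimit.mk _ (fun s => lift (s.snd ≫ fst _ _) s.fst) ?_ ?_ ?_⟩⟩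
  · intro s
    simp
  · intro s
    ext
    · simp
    · simp [s.condition]
  · intro s m h1 h2
    ext
    · simp [← h2]
    · simp [h1]

variable {K : Type u} [Field K]

theorem whiskerRight_left_of {X Z : Over (Spec (.of K))} (P : MorphismProperty Scheme.{u})
    [P.IsStableUnderBaseChange] (q : X ⟶ Z) (W : Over (Spec (.of K))) (h : P q.left) :
    P (q ▷ W).left :=
  P.of_isPullback ((isPullback_whiskerRight q W).map (Over.forget _)) h

theorem whiskerLeft_left_of {X Z : Over (Spec (.of K))} (P : MorphismProperty Scheme.{u})
    [P.IsStableUnderBaseChange] (q : X ⟶ Z) (W : Over (Spec (.of K))) (h : P q.left) :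
    P (W ◁ q).left :=
  P.of_isPullback ((isPullback_whiskerLeft q W).map (Over.forget _)) h

/-- `q : X ⟶ Z` is an étale quotient of a `K`-variety by a family of endomorphisms: it is invariant,
and its fibres on `K`-points are orbits. -/
structure IsEtaleQuotient {X Z : Over (Spec (.of K))} (q : X ⟶ Z) {I : Type*} (τ : I → (X ⟶ X)) :
    Prop where
  flat : Flat q.left
  surjective : Surjective q.left
  quasiCompact : QuasiCompact q.left
  formallyUnramified : FormallyUnramified q.left
  locallyOfFiniteType : LocallyOfFiniteType q.left
  comp_eq (i : I) : τ i ≫ q = q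
  exists_eq (x y : 𝟙_ (Over (Spec (.of K))) ⟶ X) : x ≫ q = y ≫ q → ∃ i, y = x ≫ τ i

namespace IsEtaleQuotient

variable {X Z : Over (Spec (.of K))} {q : X ⟶ Z} {I : Type*} {τ : I → (X ⟶ X)}

theorem epi_left (hq : IsEtaleQuotient q τ) : Epi q.left := by
  have := hq.flat
  have := hq.surjective
  have := hq.quasiCompact
  infer_instance

theorem epi (hq : IsEtaleQuotient q τ) : Epi q := by
  have := hq.epi_left
  exact Over.epi_of_epi_left q

/-- Products of quotient maps are needed to descend the multiplication to `Z ⊗ Z`, and triple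
products to verify associativity. -/
theorem tensor {X' Z' : Over (Spec (.of K))} {q' : X' ⟶ Z'} {I' : Type*} {τ' : I' → (X' ⟶ X')}
    (hq : IsEtaleQuotient q τ) (hq' : IsEtaleQuotient q' τ') :
    IsEtaleQuotient (q ⊗ₘ q') fun i : I × I' => τ i.1 ⊗ₘ τ' i.2 := by
  have key (P : MorphismProperty Scheme.{u}) [P.IsStableUnderBaseChange]
      (hP : ∀ {A B C : Scheme.{u}} (f : A ⟶ B) (g : B ⟶ C), P f → P g → P (f ≫ g))
      (h : P q.left) (h' : P q'.left) : P (q ⊗ₘ q').left := by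
    rw [MonoidalCategory.tensorHom_def, Over.comp_left]
    exact hP _ _ (whiskerRight_left_of P q X' h) (whiskerLeft_left_of P q' Z h')
  refine ⟨key _ (fun _ _ _ _ => inferInstance) hq.flat hq'.flat,
    key _ (fun _ _ _ _ => inferInstance) hq.surjective hq'.surjective,
    key _ (fun _ _ _ _ => inferInstance) hq.quasiCompact hq'.quasiCompact,
    key _ (MorphismProperty.comp_mem _) hq.formallyUnramified hq'.formallyUnramified,
    key _ (fun _ _ _ _ => inferInstance) hq.locallyOfFiniteType hq'.locallyOfFiniteType,
    fun i => ?_, fun x y h => ?_⟩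
  · rw [tensorHom_comp_tensorHom, hq.comp_eq, hq'.comp_eq]
  · obtain ⟨i, hi⟩ := hq.exists_eq (x ≫ fst _ _) (y ≫ fst _ _)
      (by simpa using congrArg (· ≫ fst _ _) h)
    obtain ⟨j, hj⟩ := hq'.exists_eq (x ≫ snd _ _) (y ≫ snd _ _)
      (by simpa using congrArg (· ≫ snd _ _) h)
    refine ⟨(i, j), ?_⟩
    ext1
    · simp [hi]
    · simp [hj]

variable [IsAlgClosed K]

/-- Invariant morphisms descend to the quotient. -/
theorem exists_desc (hq : IsEtaleQuotient q τ) (hX : LocallyOfFiniteType X.hom)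
    {V : Over (Spec (.of K))} (h : X ⟶ V) (hh : ∀ i, τ i ≫ h = h) : ∃ g : Z ⟶ V, q ≫ g = h := by
  have := hq.flat
  have := hq.surjective
  have := hq.quasiCompact
  have := hq.formallyUnramified
  have := hq.locallyOfFiniteType
  have := hq.epi_left
  let T : Over (Spec (.of K)) := Over.mk (pullback.fst q.left q.left ≫ X.hom)
  have : LocallyOfFiniteType T.hom :=
    inferInstanceAs (LocallyOfFiniteType (pullback.fst q.left q.left ≫ X.hom))
  let p₁ : T ⟶ X := Over.homMk (pullback.fst q.left q.left)
  let p₂ : T ⟶ X := Over.homMk (pullback.snd q.left q.left) (by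
    change _ = pullback.fst q.left q.left ≫ X.hom
    rw [← Over.w q, ← Category.assoc, ← pullback.condition, Category.assoc])
  have hp : p₁ ≫ q = p₂ ≫ q := by
    ext1
    exact pullback.condition
  -- On the fibre product of `X` with itself over `Z`, `c i` sends `(x, y)` to `(τ i x, y)`. The
  -- diagonal is open because `q` is unramified, so `U i`, where `τ i x = y`, is open. The `U i`
  -- contain all `K`-points, hence they cover, and on each one invariance of `h` identifies its two
  -- pull-backs.
  let c (i : I) : T.left ⟶ pullback q.left q.left :=
    pullback.lift (p₁ ≫ τ i).left p₂.left (by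
      rw [← Over.comp_left, ← Over.comp_left, Category.assoc, hq.comp_eq, hp])
  let U (i : I) : T.left.Opens := c i ⁻¹ᵁ (pullback.diagonal q.left).opensRange
  have hU : ⨆ i, U i = ⊤ := by
    refine opens_eq_top_of_pt_mem _ fun w => ?_
    obtain ⟨i, hi⟩ := hq.exists_eq (w ≫ p₁) (w ≫ p₂) (by
      rw [Category.assoc, Category.assoc, hp])
    refine TopologicalSpace.Opens.mem_iSup.mpr ⟨i, ?_⟩
    have h1 : w.left ≫ c i = (w ≫ p₂).left ≫ pullback.diagonal q.left := by
      ext1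
      · rw [Category.assoc, Category.assoc, pullback.lift_fst, pullback.diagonal_fst,
          Category.comp_id, hi, ← Over.comp_left, Category.assoc]
      · rw [Category.assoc, Category.assoc, pullback.lift_snd, pullback.diagonal_snd,
          Category.comp_id, ← Over.comp_left]
    refine ⟨(w ≫ p₂).left (closedPt (.of K)), ?_⟩
    rw [← Scheme.Hom.comp_apply, ← h1, Scheme.Hom.comp_apply]
    rfl
  have key (i : I) : (U i).ι ≫ (p₁ ≫ τ i).left = (U i).ι ≫ p₂.left := by
    have hr : Set.range ((U i).ι ≫ c i) ⊆ Set.range (pullback.diagonal q.left) := by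
      rintro _ ⟨x, rfl⟩
      rw [Scheme.Hom.comp_apply]
      exact x.2
    have h1 := IsOpenImmersion.lift_fac (pullback.diagonal q.left) ((U i).ι ≫ c i) hr
    have h2 := congrArg (· ≫ pullback.fst q.left q.left) h1
    have h3 := congrArg (· ≫ pullback.snd q.left q.left) h1
    simp only [Category.assoc, pullback.diagonal_fst, pullback.diagonal_snd, Category.comp_id,
      c, pullback.lift_fst, pullback.lift_snd] at h2 h3
    rw [← h2, h3]
  have key' (i : I) : (U i).ι ≫ p₁.left ≫ h.left = (U i).ι ≫ p₂.left ≫ h.left := by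
    rw [← Category.assoc (U i).ι p₂.left, ← key, Category.assoc, ← Over.comp_left, ← Over.comp_left,
      Category.assoc, hh]
  have hpair : p₁.left ≫ h.left = p₂.left ≫ h.left := by
    exact Scheme.Cover.hom_ext (T.left.openCoverOfIsOpenCover U hU) _ _ key'
  -- A flat, surjective, quasi-compact morphism is an effective epimorphism of schemes, so equality
  -- on the fibre product is all that descent requires.
  let g : Z.left ⟶ V.left := EffectiveEpi.desc q.left h.left fun {W} a b hab => by
    rw [← pullback.lift_fst a b hab, Category.assoc]
    refine (congrArg _ hpair).trans ?_
    rw [← Category.assoc]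
    exact congrArg (· ≫ h.left) (pullback.lift_snd a b hab)
  have hg : q.left ≫ g = h.left := EffectiveEpi.fac ..
  refine ⟨Over.homMk g ?_, ?_⟩
  · rw [← cancel_epi q.left, ← Category.assoc, hg, Over.w, Over.w]
  · ext1
    exact hg

end IsEtaleQuotient

end Quotient


/-! ### Descent of a commutative group structure to a quotient. -/

section DescendGroup

variable {C : Type*} [Category* C] [CartesianMonoidalCategory C] [BraidedCategory C]

/-- A commutative group structure descends along an epimorphism which is compatible with the
operations. -/
theorem exists_grpObj_of_epi {X Z : C} [GrpObj X] [IsCommMonObj X] (q : X ⟶ Z) [Epi q]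
    [Epi (q ⊗ₘ q)] [Epi ((q ⊗ₘ q) ⊗ₘ q)] (mul : Z ⊗ Z ⟶ Z) (hmul : (q ⊗ₘ q) ≫ mul = μ[X] ≫ q)
    (inv : Z ⟶ Z) (hinv : q ≫ inv = ι[X] ≫ q) :
    ∃ (_ : GrpObj Z) (_ : IsCommMonObj Z), IsMonHom q := by
  have hx (T : C) (a b : T ⟶ X) : lift (a ≫ q) (b ≫ q) ≫ mul = (a * b) ≫ q := by
    rw [← lift_map, Category.assoc, hmul, ← Category.assoc]
    rfl
  let i1 : MonObj Z :=
    { one := η[X] ≫ q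
      mul := mul
      one_mul := by
        have h1 : Epi (𝟙_ C ◁ q) := by
          have : 𝟙_ C ◁ q = (λ_ X).hom ≫ q ≫ (λ_ Z).inv := by simp
          rw [this]
          infer_instance
        rw [← cancel_epi (𝟙_ C ◁ q), whisker_exchange_assoc, comp_whiskerRight, Category.assoc,
          ← MonoidalCategory.tensorHom_def_assoc, hmul, leftUnitor_naturality,
          MonObj.one_mul_assoc]
      mul_one := by
        have h1 : Epi (q ▷ 𝟙_ C) := by
          have : q ▷ 𝟙_ C = (ρ_ X).hom ≫ q ≫ (ρ_ Z).inv := by simp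
          rw [this]
          infer_instance
        rw [← cancel_epi (q ▷ 𝟙_ C), ← whisker_exchange_assoc, whiskerLeft_comp, Category.assoc,
          ← MonoidalCategory.tensorHom_def'_assoc, hmul, rightUnitor_naturality,
          MonObj.mul_one_assoc]
      mul_assoc := by
        have h : (q ⊗ₘ q) ⊗ₘ q = lift (lift ((fst _ X ≫ fst X X) ≫ q) ((fst _ X ≫ snd X X) ≫ q))
            (snd (X ⊗ X) X ≫ q) := by
          ext <;> simp
        rw [← cancel_epi ((q ⊗ₘ q) ⊗ₘ q), h, lift_lift_associator_hom_assoc, lift_whiskerRight_assoc,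
          lift_whiskerLeft_assoc, hx, hx, hx, hx, mul_assoc] }
  have i2 : IsMonHom q := ⟨rfl, hmul.symm⟩
  let i3 : GrpObj Z :=
    { i1 with
      inv := inv
      left_inv := by
        rw [← cancel_epi q, comp_lift_assoc, hinv, Category.comp_id]
        have h := hx X ι[X] (𝟙 X)
        rw [Category.id_comp] at h
        refine h.trans ?_
        have h1 : ι[X] * 𝟙 X = 1 := by
          rw [← Category.id_comp ι[X], ← Hom.inv_def, inv_mul_cancel]
        rw [h1, Hom.one_def, Category.assoc, ← Category.assoc q, comp_toUnit]
        rfl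
      right_inv := by
        rw [← cancel_epi q, comp_lift_assoc, hinv, Category.comp_id]
        have h := hx X (𝟙 X) ι[X]
        rw [Category.id_comp] at h
        refine h.trans ?_
        have h1 : 𝟙 X * ι[X] = 1 := by
          rw [← Category.id_comp ι[X], ← Hom.inv_def, mul_inv_cancel]
        rw [h1, Hom.one_def, Category.assoc, ← Category.assoc q, comp_toUnit]
        rfl }
  refine ⟨i3, ⟨?_⟩, i2⟩
  rw [← cancel_epi (q ⊗ₘ q), BraidedCategory.braiding_naturality_assoc]
  change _ ≫ (q ⊗ₘ q) ≫ mul = (q ⊗ₘ q) ≫ mul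
  rw [hmul, IsCommMonObj.mul_comm_assoc]

end DescendGroup

section QuotientGroup

variable {K : Type u} [Field K]

theorem tensor_translation_comp_mul {X : Over (Spec (.of K))} [GrpObj X] [IsCommMonObj X]
    (s t : 𝟙_ (Over (Spec (.of K))) ⟶ X) :
    (translation s ⊗ₘ translation t) ≫ μ[X] = μ[X] ≫ translation (s * t) := by
  have h1 : μ[X] = fst X X * snd X X := by simp [Hom.mul_def]
  have h2 : (translation s ⊗ₘ translation t) ≫ μ[X] =
      (fst X X ≫ translation s) * (snd X X ≫ translation t) := by
    simp [Hom.mul_def, ← lift_map]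
  rw [h2, h1, comp_translation, comp_translation, comp_translation, MonObj.comp_mul,
    mul_mul_mul_comm]

theorem translation_comp_inv {X : Over (Spec (.of K))} [GrpObj X] [IsCommMonObj X]
    (t : 𝟙_ (Over (Spec (.of K))) ⟶ X) :
    translation t ≫ ι[X] = ι[X] ≫ translation t⁻¹ := by
  have h1 : ι[X] = (𝟙 X)⁻¹ := by rw [Hom.inv_def, Category.id_comp]
  rw [← Hom.inv_def, comp_translation, h1, translation, mul_inv, Hom.inv_def (toUnit X ≫ t),
    Category.assoc, ← Hom.inv_def]

variable [IsAlgClosed K]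

/-- The quotient of a commutative algebraic group by a group of `K`-points is a group. -/
theorem IsEtaleQuotient.exists_grpObj {X Z : Over (Spec (.of K))} [GrpObj X] [IsCommMonObj X]
    [LocallyOfFiniteType X.hom] {q : X ⟶ Z} {H : Subgroup (𝟙_ (Over (Spec (.of K))) ⟶ X)}
    (hq : IsEtaleQuotient q fun t : H => translation (t : 𝟙_ (Over (Spec (.of K))) ⟶ X)) :
    ∃ (_ : GrpObj Z) (_ : IsCommMonObj Z), IsMonHom q := by
  have := hq.epi
  have := (hq.tensor hq).epi
  have := ((hq.tensor hq).tensor hq).epi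
  have hXX : LocallyOfFiniteType (X ⊗ X).hom := by
    rw [← Over.w (fst X X)]
    have : LocallyOfFiniteType (fst X X).left :=
      inferInstanceAs (LocallyOfFiniteType (pullback.fst X.hom X.hom))
    infer_instance
  -- Translating the factors by `s, t ∈ H` translates the product by `s * t ∈ H`, which `q` does not
  -- see.
  obtain ⟨mul, hmul⟩ := (hq.tensor hq).exists_desc hXX (μ[X] ≫ q) fun i => by
    rw [← Category.assoc, tensor_translation_comp_mul, Category.assoc]
    congr 1
    exact hq.comp_eq (i.1 * i.2)
  obtain ⟨inv, hinv⟩ := hq.exists_desc inferInstance (ι[X] ≫ q) fun i => by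
    rw [← Category.assoc, translation_comp_inv, Category.assoc]
    congr 1
    exact hq.comp_eq i⁻¹
  exact exists_grpObj_of_epi q mul hmul inv hinv

end QuotientGroup


/-! ### The action of torsion points on sections over preimages under `[m]`. -/

section Action

variable {K : Type u} [Field K] {X : Over (Spec (.of K))} [GrpObj X] [IsCommMonObj X]

theorem translation_comp_mulBy_of_pow_eq_one {m : ℕ} {t : 𝟙_ (Over (Spec (.of K))) ⟶ X}
    (ht : t ^ m = 1) : (translation t).left ≫ (mulBy X m).left = (mulBy X m).left := by
  rw [← Over.comp_left, translation_comp_mulBy, ht, translation_one, Category.comp_id]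

theorem preimage_translation {m : ℕ} {t : 𝟙_ (Over (Spec (.of K))) ⟶ X}
    (ht : t ^ m = 1) (U : X.left.Opens) :
    (translation t).left ⁻¹ᵁ (mulBy X m).left ⁻¹ᵁ U = (mulBy X m).left ⁻¹ᵁ U := by
  rw [← Scheme.Hom.comp_preimage, translation_comp_mulBy_of_pow_eq_one ht]

variable (X) in
/-- The group of `K`-points of order dividing `m`. -/
noncomputable abbrev torsion (m : ℕ) : Subgroup (𝟙_ (Over (Spec (.of K))) ⟶ X) := (powMonoidHom m).ker

/-- The action of the `m`-torsion points on the functions on the preimage of an open subset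
under `[m]`. -/
noncomputable def torsionAction (m : ℕ) (U : X.left.Opens) :
    torsion X m →*
      (Γ(X.left, (mulBy X m).left ⁻¹ᵁ U) →+* Γ(X.left, (mulBy X m).left ⁻¹ᵁ U)) where
  toFun t := ((translation t.1).left.appLE _ _ (preimage_translation t.2 U).ge).hom
  map_one' := by
    have : translation ((1 : torsion X m) :
        𝟙_ (Over (Spec (.of K))) ⟶ X) = 𝟙 X := translation_one
    simp only [this, Over.id_left]
    exact congrArg CommRingCat.Hom.hom ((Category.id_comp _).trans (X.left.presheaf.map_id _))
  map_mul' s t := by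
    have : translation ((s * t : torsion X m) :
        𝟙_ (Over (Spec (.of K))) ⟶ X) = translation s.1 ≫ translation t.1 := by
      rw [translation_comp, mul_comm]
      rfl
    simp only [this, Over.comp_left]
    rw [← Scheme.Hom.appLE_comp_appLE _ _ _ _ _ (preimage_translation t.2 U).ge
      (preimage_translation s.2 U).ge]
    rfl

theorem germ_torsionAction [IsIntegral X.left] {m : ℕ} {U : X.left.Opens}
    (h : genericPoint X.left ∈ (mulBy X m).left ⁻¹ᵁ U)
    (t : torsion X m)
    (b : Γ(X.left, (mulBy X m).left ⁻¹ᵁ U)) :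
    X.left.presheaf.germ _ _ h (torsionAction m U t b) =
      funMap (translation t.1).left (X.left.presheaf.germ _ _ h b) :=
  (SubringSheaf.funMap_germ (translation t.1).left (preimage_translation t.2 U).ge h h b).symm

variable [IsAlgClosed K] [IsVariety X]

theorem finite_torsion [CharZero K] {m : ℕ} (hm : 0 < m) :
    Finite (torsion X m) := by
  have := isFinite_mulBy (X := X) m hm
  have hfin := (mulBy X m).left.finite_preimage_singleton
    (pt (1 : 𝟙_ (Over (Spec (.of K))) ⟶ X))
  have := hfin.to_subtype
  refine Finite.of_injective (fun t => (⟨pt t.1, ?_⟩ :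
    ↥((mulBy X m).left ⁻¹' {pt (1 : 𝟙_ (Over (Spec (.of K))) ⟶ X)}))) fun s t h => ?_
  · have : (mulBy X m).left (pt t.1) = pt (1 : 𝟙_ (Over (Spec (.of K))) ⟶ X) := by
      rw [← pt_comp, comp_mulBy]
      exact congrArg pt t.2
    exact this
  · exact Subtype.ext (pt_injective (congrArg Subtype.val h))

/-- Torsion points act without fixed maximal ideals. -/
theorem exists_sub_torsionAction_notMem {m : ℕ} [IsAffineHom (mulBy X m).left] {U : X.left.Opens}
    (hU : IsAffineOpen U) (t : torsion X m)
    (ht : t ≠ 1) (P : Ideal Γ(X.left, (mulBy X m).left ⁻¹ᵁ U)) (hP : P.IsMaximal) :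
    ∃ b, b - torsionAction m U t b ∉ P := by
  -- If `t` moved every function only within `P`, it would fix the corresponding closed point. That
  -- point is a `K`-point, and a translation fixing one is trivial.
  by_contra! h
  have hV := hU.preimage (mulBy X m).left
  let p : Spec Γ(X.left, (mulBy X m).left ⁻¹ᵁ U) := ⟨P, hP.isPrime⟩
  have hp : IsClosed {p} := (PrimeSpectrum.isClosed_singleton_iff_isMaximal p).mpr hP
  have : JacobsonSpace X.left := LocallyOfFiniteType.jacobsonSpace X.hom
  have hx : IsClosed {hV.fromSpec p} := by
    have h1 := hV.fromSpec.isOpenEmbedding.preimage_closedPoints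
    have h2 : p ∈ closedPoints _ := hp
    rw [← h1] at h2
    exact h2
  obtain ⟨s, hs⟩ := exists_pt_eq _ hx
  have h1 : Spec.map ((translation t.1).left.appLE _ _ (preimage_translation t.2 U).ge) p = p := by
    refine PrimeSpectrum.ext (Ideal.ext fun b => ?_)
    change torsionAction m U t b ∈ P ↔ b ∈ P
    exact ⟨fun hb => by simpa using P.add_mem (h b) hb,
      fun hb => by simpa using P.sub_mem hb (h b)⟩
  have h2 : (translation t.1).left (pt s) = pt s := by
    rw [hs, ← Scheme.Hom.comp_apply,
      ← IsAffineOpen.SpecMap_appLE_fromSpec (translation t.1).left hV hV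
        (preimage_translation t.2 U).ge, Scheme.Hom.comp_apply, h1]
  rw [pt_translation] at h2
  exact ht (Subtype.ext (mul_eq_right.mp (pt_injective h2)))

end Action


theorem IsFiniteGalois.subtype {k L : Type*} [Field k] [Field L] {φ : k →+* L}
    (hφ : IsFiniteGalois φ) {F : Subfield L} (hF : ∀ x, φ x ∈ F) : IsFiniteGalois F.subtype := by
  let := φ.toAlgebra
  have h1 : FiniteDimensional k L := hφ.1
  have h2 : IsGalois k L := hφ.2
  let := (φ.codRestrict F hF).toAlgebra
  have : IsScalarTower k F L := .of_algebraMap_eq fun x => rfl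
  exact ⟨FiniteDimensional.right k F L, IsGalois.tower_top_of_isGalois k F L⟩

theorem SubringSheaf.of_forall_appLE_toSpec {P : MorphismProperty Scheme.{u}}
    {Q : ∀ {R S : Type u} [CommRing R] [CommRing S], (R →+* S) → Prop} [HasRingHomProperty P Q]
    (hQ : RingHom.StableUnderCompositionWithLocalizationAwaySource Q)
    {X Y : Scheme.{u}} {f : X ⟶ Y} [IsAffineHom f] (S : SubringSheaf f)
    (h : ∀ U : Y.Opens, IsAffineOpen U →
      Q (S.toSpec.appLE (S.fromSpec ⁻¹ᵁ U) (f ⁻¹ᵁ U) (S.preimage_toSpec U).ge).hom) :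
    P S.toSpec := by
  refine (HasRingHomProperty.iff_exists_appLE hQ).mpr fun x => ?_
  obtain ⟨_, ⟨U, hU, rfl⟩, hx, -⟩ := Y.isBasis_affineOpens.exists_subset_of_mem_open
    (Set.mem_univ (f x)) isOpen_univ
  have hU : IsAffineOpen U := hU
  exact ⟨⟨_, hU.preimage S.fromSpec⟩, ⟨_, hU.preimage f⟩, hx, (S.preimage_toSpec U).ge, h U hU⟩

theorem finite_appLE {X Y : Scheme.{u}} {f : X ⟶ Y} [IsFinite f] {U : Y.Opens}
    (hU : IsAffineOpen U) {V : X.Opens} (e : V ≤ f ⁻¹ᵁ U) (h : V = f ⁻¹ᵁ U) :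
    (f.appLE U V e).hom.Finite := by
  subst h
  rw [Scheme.Hom.appLE_eq_app]
  exact f.finite_app U hU

theorem appLE_comp_appLE_of_comp_eq {A B C : Scheme.{u}} {x : A ⟶ B} {τ : B ⟶ B} {q : B ⟶ C}
    (hw : x ≫ τ ≫ q = x ≫ q) {U : C.Opens} {V : B.Opens} {W : A.Opens} (h₁ : V ≤ q ⁻¹ᵁ U)
    (h₂ : V ≤ τ ⁻¹ᵁ V) (h₃ : W ≤ x ⁻¹ᵁ V) : q.appLE U V h₁ ≫ x.appLE V W h₃ =
      (q.appLE U V h₁ ≫ τ.appLE V V h₂) ≫ x.appLE V W h₃ := by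
  simp only [Scheme.Hom.appLE_comp_appLE, hw]

theorem eq_of_funMap_eq {X Y Z : Scheme.{u}} [IsIntegral X] [IsIntegral Y] {f g : X ⟶ Y}
    [IsDominant f] [IsDominant g] (p : Y ⟶ Z) [IsSeparated p] (hp : f ≫ p = g ≫ p)
    (h : funMap f = funMap g) : f = g :=
  ext_of_isDominant_of_isSeparated p hp (gen X)
    (by rw [← map_funMap_gen, ← map_funMap_gen, h])

/-! ### The quotient of `X` attached to a field between `[m]^* K(X)` and `K(X)`. -/

section Quotient

variable {K : Type u} [Field K] {X : Over (Spec (.of K))} [GrpObj X] [IsCommMonObj X]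

/-- The torsion points of order dividing `m` whose translations fix a subfield of the function
field. -/
noncomputable def fixingPoints [IsIntegral X.left] (m : ℕ) (F : Subfield X.left.functionField) :
    Subgroup (𝟙_ (Over (Spec (.of K))) ⟶ X) where
  carrier := {t | t ^ m = 1 ∧ ∀ x ∈ F, funMap (translation t).left x = x}
  one_mem' := ⟨one_pow m, fun x _ => congr($((funMap_congr (by
    rw [translation_one, Over.id_left])).trans funMap_id) x)⟩
  mul_mem' {s t} hs ht := ⟨by rw [mul_pow, hs.1, ht.1, one_mul], fun x hx => by
    have : funMap (translation (s * t)).left =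
        funMap (translation s).left ≫ funMap (translation t).left := by
      rw [← funMap_comp]
      exact funMap_congr (by rw [← Over.comp_left, translation_comp])
    rw [this, CommRingCat.comp_apply, hs.2 x hx, ht.2 x hx]⟩
  inv_mem' {t} ht := ⟨by rw [inv_pow, ht.1, inv_one], fun x hx => by
    have : funMap (translation t).left ≫ funMap (translation t⁻¹).left = 𝟙 _ := by
      rw [← funMap_comp]
      exact (funMap_congr (by rw [← Over.comp_left, translation_comp, mul_inv_cancel,
        translation_one, Over.id_left])).trans funMap_id
    have := congr($this x)
    rw [CommRingCat.comp_apply, ht.2 x hx] at this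
    exact this⟩

theorem mem_fixingPoints [IsIntegral X.left] {m : ℕ} {F : Subfield X.left.functionField}
    {t : 𝟙_ (Over (Spec (.of K))) ⟶ X} :
    t ∈ fixingPoints m F ↔ t ^ m = 1 ∧ ∀ x ∈ F, funMap (translation t).left x = x := .rfl

variable [IsAlgClosed K] [CharZero K] [IsVariety X]

/-- This is the Galois correspondence on germs: automorphisms of `K(X)` over `F` fix `[m]^* K(X)`,
so they are torsion translations, namely those by `fixingPoints m F`. If the preimage of `U` is
empty, the ring of sections is zero. -/
theorem forall_torsionAction_eq_iff {m : ℕ} (hm : 0 < m) [IsDominant (mulBy X m).left]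
    {F : Subfield X.left.functionField} (hF : ∀ x, funMap (mulBy X m).left x ∈ F)
    [IsAffineHom (mulBy X m).left] {U : X.left.Opens} (b : Γ(X.left, (mulBy X m).left ⁻¹ᵁ U)) :
    (∀ t ∈ (fixingPoints m F).subgroupOf (torsion X m), torsionAction m U t b = b) ↔
      b ∈ (SubringSheaf.ofSubfield (mulBy X m).left F hF).obj U := by
  by_cases h : genericPoint X.left ∈ (mulBy X m).left ⁻¹ᵁ U
  · have : Nonempty ↥((mulBy X m).left ⁻¹ᵁ U) := ⟨⟨_, h⟩⟩
    rw [SubringSheaf.mem_ofSubfield _ h]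
    refine ⟨fun H => ?_, fun H t ht => ?_⟩
    · have hG := (isFiniteGalois_funMap_mulBy (X := X) hm).subtype hF
      obtain ⟨x, hx⟩ := hG.mem_fieldRange (x := X.left.presheaf.germ _ _ h b) fun g hg => by
        obtain ⟨t, ht, hgt⟩ := exists_funMap_translation_comp hm (𝟙 _) (CommRingCat.ofHom g)
          (by ext x; exact (congr($hg ⟨_, hF x⟩)).symm)
        have hgt : g = (funMap (translation t).left).hom :=
          congrArg CommRingCat.Hom.hom (hgt.trans (Category.comp_id _))
        have := H ⟨t, ht⟩ (Subgroup.mem_subgroupOf.mpr <| mem_fixingPoints.mpr ⟨ht, fun x hx => by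
          have := congr($hg ⟨x, hx⟩)
          rw [hgt] at this
          exact this⟩)
        rw [hgt]
        exact (germ_torsionAction h ⟨t, ht⟩ b).symm.trans (congrArg _ this)
      rw [← hx]
      exact x.2
    · refine germ_injective_of_isIntegral X.left _ h ?_
      rw [germ_torsionAction]
      exact (mem_fixingPoints.mp (Subgroup.mem_subgroupOf.mp ht)).2 _ H
  · have : (mulBy X m).left ⁻¹ᵁ U = ⊥ := by
      by_contra hne
      have hne : Nonempty ↥((mulBy X m).left ⁻¹ᵁ U) := by
        rw [← ne_eq, ← TopologicalSpace.Opens.coe_eq_empty.ne, ← Set.nonempty_iff_ne_empty] at hne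
        exact ⟨⟨_, hne.choose_spec⟩⟩
      exact h (genericPoint_mem _ (h := hne))
    have : Subsingleton Γ(X.left, (mulBy X m).left ⁻¹ᵁ U) := by
      rw [this]; infer_instance
    exact ⟨fun _ => Subring.mem_iInf.mpr fun h' => (h h').elim, fun _ _ _ => Subsingleton.elim _ _⟩

section

variable {m : ℕ} (hm : 0 < m) [IsDominant (mulBy X m).left]
  {F : Subfield X.left.functionField} (hF : ∀ x, funMap (mulBy X m).left x ∈ F)

include hm

theorem isFinite_toSpec_ofSubfield [IsAffineHom (mulBy X m).left] :
    IsFinite (SubringSheaf.ofSubfield (mulBy X m).left F hF).toSpec := by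
  have := isFinite_mulBy (X := X) m hm
  have : IsFinite ((SubringSheaf.ofSubfield (mulBy X m).left F hF).toSpec ≫
      (SubringSheaf.ofSubfield (mulBy X m).left F hF).fromSpec) := by
    rwa [SubringSheaf.toSpec_fromSpec]
  exact IsFinite.of_comp _ (SubringSheaf.ofSubfield (mulBy X m).left F hF).fromSpec

/-- Over `U` the sections of the quotient are the invariants of `fixingPoints m F`, a finite group
acting without fixed maximal ideals, so the results on free actions apply. -/
theorem flat_and_formallyUnramified_appLE_toSpec_ofSubfield [IsAffineHom (mulBy X m).left]
    {U : X.left.Opens} (hU : IsAffineOpen U)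
    {i : Γ((SubringSheaf.ofSubfield (mulBy X m).left F hF).spec, (SubringSheaf.ofSubfield
      (mulBy X m).left F hF).fromSpec ⁻¹ᵁ U) →+* Γ(X.left, (mulBy X m).left ⁻¹ᵁ U)}
    (hi : ((SubringSheaf.ofSubfield (mulBy X m).left F hF).toSpec.appLE _ _
      ((SubringSheaf.ofSubfield (mulBy X m).left F hF).preimage_toSpec U).ge).hom = i) :
    i.Flat ∧ i.FormallyUnramified := by
  have := finite_torsion (X := X) hm
  have := isFinite_toSpec_ofSubfield hm hF
  have h1 : Function.Injective i :=
    hi ▸ (SubringSheaf.ofSubfield (mulBy X m).left F hF).appLE_toSpec_injective hU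
  have h2 : i.range = (SubringSheaf.ofSubfield (mulBy X m).left F hF).obj U :=
    hi ▸ (SubringSheaf.ofSubfield (mulBy X m).left F hF).range_appLE_toSpec hU
  have h3 : i.Finite := by
    rw [← hi]
    exact finite_appLE (hU.preimage (SubringSheaf.ofSubfield (mulBy X m).left F hF).fromSpec) _
      ((SubringSheaf.ofSubfield (mulBy X m).left F hF).preimage_toSpec U).symm
  let a : (fixingPoints m F).subgroupOf (torsion X m) →* _ :=
    (torsionAction m U).comp (Subgroup.subtype _)
  have h4 (g x) : a g (i x) = i x :=
    (forall_torsionAction_eq_iff hm hF (i x)).mpr (h2.le ⟨x, rfl⟩) g.1 g.2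
  have h5 (b) (hb : ∀ g, a g b = b) : b ∈ i.range :=
    h2.ge ((forall_torsionAction_eq_iff hm hF b).mp fun t ht => hb ⟨t, ht⟩)
  have h6 (g) (hg : g ≠ 1) (P : Ideal Γ(X.left, (mulBy X m).left ⁻¹ᵁ U)) (hP : P.IsMaximal) :
      ∃ b, b - a g b ∉ P :=
    exists_sub_torsionAction_notMem hU g.1 (fun h => hg (Subtype.ext h)) P hP
  exact ⟨flat_of_free_action a i h1 h4 h5 h6, formallyUnramified_of_free_action a i h3 h1 h4 h5 h6⟩

end

/-- The relative spectrum of the functions in a subfield, as a scheme over `K`. -/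
noncomputable def subfieldQuotient (m : ℕ) [IsDominant (mulBy X m).left]
    {F : Subfield X.left.functionField} (hF : ∀ x, funMap (mulBy X m).left x ∈ F)
    [IsAffineHom (mulBy X m).left] : Over (Spec (.of K)) :=
  Over.mk ((SubringSheaf.ofSubfield (mulBy X m).left F hF).fromSpec ≫ X.hom)

/-- The factor `X ⟶ Z` of `[m]` through the quotient. -/
noncomputable def toSubfieldQuotient (m : ℕ) [IsDominant (mulBy X m).left]
    {F : Subfield X.left.functionField} (hF : ∀ x, funMap (mulBy X m).left x ∈ F)
    [IsAffineHom (mulBy X m).left] : X ⟶ subfieldQuotient m hF :=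
  Over.homMk (SubringSheaf.ofSubfield (mulBy X m).left F hF).toSpec (by
    rw [← Over.w (mulBy X m)]
    exact (Category.assoc _ _ _).symm.trans
      (congrArg (· ≫ X.hom) (SubringSheaf.toSpec_fromSpec _)))

/-- The factor `Z ⟶ X` of `[m]` through the quotient. -/
noncomputable def subfieldQuotientDesc (m : ℕ) [IsDominant (mulBy X m).left]
    {F : Subfield X.left.functionField} (hF : ∀ x, funMap (mulBy X m).left x ∈ F)
    [IsAffineHom (mulBy X m).left] : subfieldQuotient m hF ⟶ X :=
  Over.homMk (SubringSheaf.ofSubfield (mulBy X m).left F hF).fromSpec rfl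

section

variable {m : ℕ} [IsDominant (mulBy X m).left] [IsAffineHom (mulBy X m).left]
  {F : Subfield X.left.functionField} (hF : ∀ x, funMap (mulBy X m).left x ∈ F)

omit [IsAlgClosed K] [CharZero K] in
theorem toSubfieldQuotient_comp_desc :
    toSubfieldQuotient m hF ≫ subfieldQuotientDesc m hF = mulBy X m := by
  ext1
  exact SubringSheaf.toSpec_fromSpec _

instance : IsDominant (toSubfieldQuotient m hF).left :=
  SubringSheaf.isDominant_toSpec _

instance : IsIntegral (subfieldQuotient m hF).left :=
  inferInstanceAs (IsIntegral (SubringSheaf.ofSubfield (mulBy X m).left F hF).spec)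

instance : IsAffineHom (subfieldQuotientDesc m hF).left :=
  inferInstanceAs (IsAffineHom (SubringSheaf.ofSubfield (mulBy X m).left F hF).fromSpec)

theorem fieldRange_funMap_toSubfieldQuotient (hm : 0 < m) :
    (funMap (toSubfieldQuotient m hF).left).hom.fieldRange = F := by
  have := isFinite_mulBy (X := X) m hm
  have : IsDominant (SubringSheaf.ofSubfield (mulBy X m).left F hF).toSpec :=
    SubringSheaf.isDominant_toSpec _
  exact SubringSheaf.fieldRange_funMap_toSpec (mulBy X m).left

/-- The two morphisms agree after the separated map back to `X`, and they induce the same map on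
function fields because `t` fixes `F`. -/
theorem translation_comp_toSubfieldQuotient (hm : 0 < m) {t : 𝟙_ (Over (Spec (.of K))) ⟶ X}
    (ht : t ∈ fixingPoints m F) :
    translation t ≫ toSubfieldQuotient m hF = toSubfieldQuotient m hF := by
  have := isFinite_mulBy (X := X) m hm
  ext1
  rw [Over.comp_left]
  refine eq_of_funMap_eq (subfieldQuotientDesc m hF).left ?_ ?_
  · simp only [← Over.comp_left, Category.assoc, toSubfieldQuotient_comp_desc]
    rw [Over.comp_left, translation_comp_mulBy_of_pow_eq_one ht.1]
  · rw [funMap_comp]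
    ext x
    exact ht.2 _ ((fieldRange_funMap_toSubfieldQuotient hF hm).le ⟨x, rfl⟩)

/-- Composing with the map back to `X` shows that `y * x⁻¹` is `m`-torsion. Equality in the quotient
says that `x` and its translate `y` agree on the invariants of `fixingPoints m F`, so
`mem_of_eq_on_invariants` applies on an affine neighbourhood. -/
theorem mem_fixingPoints_of_comp_eq (hm : 0 < m) (x y : 𝟙_ (Over (Spec (.of K))) ⟶ X)
    (h : x ≫ toSubfieldQuotient m hF = y ≫ toSubfieldQuotient m hF) :
    y * x⁻¹ ∈ fixingPoints m F := by
  have ht : (y * x⁻¹) ^ m = 1 := by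
    have := congr($h ≫ subfieldQuotientDesc m hF)
    rw [Category.assoc, Category.assoc, toSubfieldQuotient_comp_desc, comp_mulBy, comp_mulBy] at this
    rw [mul_pow, inv_pow, this, mul_inv_cancel]
  have hxy : x ≫ translation (y * x⁻¹) = y := by
    rw [point_comp_translation]
    simp
  obtain ⟨_, ⟨U, hU, rfl⟩, hxU, -⟩ := X.left.isBasis_affineOpens.exists_subset_of_mem_open
    (Set.mem_univ ((mulBy X m).left (pt x))) isOpen_univ
  have hU : IsAffineOpen U := hU
  have hxU : pt x ∈ (mulBy X m).left ⁻¹ᵁ U := hxU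
  have : Subsingleton (𝟙_ (Over (Spec (.of K)))).left :=
    inferInstanceAs (Subsingleton (PrimeSpectrum K))
  have : Nonempty (𝟙_ (Over (Spec (.of K)))).left := inferInstanceAs (Nonempty (PrimeSpectrum K))
  have : Nonempty (⊤ : (𝟙_ (Over (Spec (.of K)))).left.Opens) :=
    ⟨⟨this.some, TopologicalSpace.Opens.mem_top _⟩⟩
  have e : ⊤ ≤ x.left ⁻¹ᵁ (mulBy X m).left ⁻¹ᵁ U := fun p _ => by
    rw [Subsingleton.elim p (closedPt (.of K))]
    exact hxU
  have := finite_torsion (X := X) hm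
  have hmem := mem_of_eq_on_invariants (torsionAction m U)
    (fun t ht P hP => exists_sub_torsionAction_notMem hU t ht P hP)
    ((fixingPoints m F).subgroupOf (torsion X m)) (x.left.appLE _ ⊤ e).hom ⟨_, ht⟩
    fun b hb => by
      have hb := (forall_torsionAction_eq_iff hm hF b).mp hb
      obtain ⟨c, rfl⟩ := ((SubringSheaf.ofSubfield (mulBy X m).left F hF).range_appLE_toSpec hU).ge hb
      have hw : x.left ≫ (translation (y * x⁻¹)).left ≫ (toSubfieldQuotient m hF).left =
          x.left ≫ (toSubfieldQuotient m hF).left := by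
        simp only [← Over.comp_left]
        rw [← Category.assoc, hxy, h]
      have h4 := appLE_comp_appLE_of_comp_eq hw
        ((SubringSheaf.ofSubfield (mulBy X m).left F hF).preimage_toSpec U).ge
        (preimage_translation ht U).ge e
      exact congr($h4 c)
  exact Subgroup.mem_subgroupOf.mp hmem

theorem isEtaleQuotient_toSubfieldQuotient (hm : 0 < m) :
    IsEtaleQuotient (toSubfieldQuotient m hF)
      fun t : fixingPoints m F => translation (t : 𝟙_ (Over (Spec (.of K))) ⟶ X) := by
  have hfin : IsFinite (toSubfieldQuotient m hF).left := isFinite_toSpec_ofSubfield hm hF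
  refine ⟨?_, ?_, inferInstance, ?_, inferInstance, fun t => ?_, fun x y h => ?_⟩
  · exact SubringSheaf.of_forall_appLE_toSpec
      (RingHom.Flat.stableUnderComposition.stableUnderCompositionWithLocalizationAway
        RingHom.Flat.holdsForLocalizationAway).1 _ fun U hU =>
      (flat_and_formallyUnramified_appLE_toSpec_ofSubfield hm hF hU rfl).1
  · exact ⟨Set.range_eq_univ.mp <|
      (toSubfieldQuotient m hF).left.isClosedMap.isClosed_range.closure_eq.symm.trans
        (toSubfieldQuotient m hF).left.denseRange.closure_eq⟩
  · exact SubringSheaf.of_forall_appLE_toSpec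
      (RingHom.FormallyUnramified.stableUnderComposition.stableUnderCompositionWithLocalizationAway
        RingHom.FormallyUnramified.holdsForLocalizationAway).1 _ fun U hU =>
      (flat_and_formallyUnramified_appLE_toSpec_ofSubfield hm hF hU rfl).2
  · exact translation_comp_toSubfieldQuotient hF hm t.2
  · refine ⟨⟨_, mem_fixingPoints_of_comp_eq hF hm x y h⟩, ?_⟩
    rw [point_comp_translation]
    simp

end

end Quotient


/-! ### The quotient is an algebraic group and its map to `X` is an isogeny. -/

section Isogeny

variable {K : Type u} [Field K] {X : Over (Spec (.of K))} [GrpObj X] [IsCommMonObj X]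

variable (X) in
theorem isMonHom_mulBy (m : ℕ) : IsMonHom (mulBy X m) where
  one_hom := by rw [comp_mulBy, MonObj.one_eq_one, one_pow]
  mul_hom := by
    have h1 : μ[X] = fst X X * snd X X := by simp [Hom.mul_def]
    have h2 : (mulBy X m ⊗ₘ mulBy X m) ≫ μ[X] = (fst X X ≫ mulBy X m) * (snd X X ≫ mulBy X m) := by
      simp [Hom.mul_def, ← lift_map]
    rw [h2, h1, comp_mulBy, comp_mulBy, comp_mulBy, mul_pow]

omit [IsCommMonObj X] in
theorem isMonHom_of_epi_comp {Z W : Over (Spec (.of K))} [GrpObj Z] [GrpObj W] (q : X ⟶ Z)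
    [IsMonHom q] [Epi (q ⊗ₘ q)] (f : Z ⟶ W) [IsMonHom (q ≫ f)] : IsMonHom f where
  one_hom := by
    rw [← IsMonHom.one_hom q, Category.assoc, IsMonHom.one_hom]
  mul_hom := by
    rw [← cancel_epi (q ⊗ₘ q), ← Category.assoc, ← IsMonHom.mul_hom, Category.assoc,
      IsMonHom.mul_hom, ← Category.assoc, tensorHom_comp_tensorHom]

variable [IsAlgClosed K] [CharZero K] [IsVariety X]

/-- The quotient of `X` by a finite group of points, associated with a subfield of the function
field which contains the image of `[m]^*`. -/
theorem exists_isogeny_of_subfield {m : ℕ} (hm : 0 < m) [IsDominant (mulBy X m).left]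
    {F : Subfield X.left.functionField} (hF : ∀ x, funMap (mulBy X m).left x ∈ F) :
    ∃ (Z : Over (Spec (.of K))) (_ : IsVariety Z) (_ : GrpObj Z) (_ : IsCommMonObj Z)
      (q : X ⟶ Z) (f : Z ⟶ X) (_ : IsDominant q.left), IsMonHom q ∧ IsIsogeny f ∧
      q ≫ f = mulBy X m ∧ (funMap q.left).hom.fieldRange = F := by
  have hfin := isFinite_mulBy (X := X) m hm
  have hsurj := surjective_mulBy (X := X) m hm
  have hq := isEtaleQuotient_toSubfieldQuotient hF hm
  obtain ⟨hgrp, hcomm, hmon⟩ := hq.exists_grpObj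
  have hcomp := toSubfieldQuotient_comp_desc hF
  have := LocallyOfFiniteType.isLocallyNoetherian X.hom
  have hf : IsFinite (subfieldQuotientDesc m hF).left := SubringSheaf.isFinite_fromSpec _ hfin
  have hZ : IsVariety (subfieldQuotient m hF) := by
    have hw := Over.w (subfieldQuotientDesc m hF)
    refine ⟨inferInstance, ?_, ?_, ?_⟩ <;> rw [← hw] <;> infer_instance
  refine ⟨subfieldQuotient m hF, hZ, hgrp, hcomm, toSubfieldQuotient m hF,
    subfieldQuotientDesc m hF, inferInstance, hmon, ⟨?_, ?_, ?_⟩, hcomp,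
    fieldRange_funMap_toSubfieldQuotient hF hm⟩
  · have := (hq.tensor hq).epi
    have : IsMonHom (toSubfieldQuotient m hF ≫ subfieldQuotientDesc m hF) :=
      by rw [hcomp]; exact isMonHom_mulBy X m
    exact isMonHom_of_epi_comp (toSubfieldQuotient m hF) _
  · have : Surjective ((toSubfieldQuotient m hF).left ≫ (subfieldQuotientDesc m hF).left) := by
      rwa [← Over.comp_left, hcomp]
    exact Surjective.of_comp (toSubfieldQuotient m hF).left _
  · infer_instance

end Isogeny


/-- Subfields satisfying `P` are `k`-subspaces of a finite-dimensional space, where ascending chains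
stop. -/
theorem exists_maximal_subfield {k M : Type*} [Field k] [Field M] (ψ : k →+* M) (hψ : ψ.Finite)
    {P : Subfield M → Prop} (hP : ∀ S, P S → ∀ x, ψ x ∈ S) {S₀ : Subfield M} (h₀ : P S₀) :
    ∃ S, P S ∧ ∀ S', P S' → S ≤ S' → S' ≤ S := by
  let := ψ.toAlgebra
  have : Module.Finite k M := hψ
  obtain ⟨W, ⟨S, hS, hSW⟩, hmax⟩ := (wellFounded_gt (α := Submodule k M)).has_min
    {W | ∃ S, P S ∧ (S : Set M) = W}
    ⟨{ S₀.toSubring with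
        smul_mem' := fun c x hx => by
          rw [Algebra.smul_def]
          exact S₀.mul_mem (hP _ h₀ c) hx }, S₀, h₀, rfl⟩
  refine ⟨S, hS, fun S' hS' hle => ?_⟩
  by_contra hne
  refine hmax { S'.toSubring with
    smul_mem' := fun c x hx => by
      rw [Algebra.smul_def]
      exact S'.mul_mem (hP _ hS' c) hx } ⟨S', hS', rfl⟩ (lt_of_le_not_ge (fun x hx => ?_) fun h => ?_)
  · exact hle (show x ∈ (S : Set M) from hSW ▸ hx)
  · exact hne fun x hx => (show x ∈ (S : Set M) from hSW ▸ h hx)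

theorem exists_comp_eq_of_fieldRange_le {S L Z : Type*} [Field S] [Field L] [Field Z]
    (σ : S →+* L) (τ : Z →+* L) (h : τ.fieldRange ≤ σ.fieldRange) :
    ∃ θ : Z →+* S, ∀ z, σ (θ z) = τ z := by
  choose θ hθ using fun z => h ⟨z, rfl⟩
  exact ⟨{ toFun := θ
           map_one' := σ.injective (by rw [hθ, map_one, map_one])
           map_zero' := σ.injective (by rw [hθ, map_zero, map_zero])
           map_add' := fun x y => σ.injective (by rw [map_add, hθ, hθ, hθ, map_add])
           map_mul' := fun x y => σ.injective (by rw [map_mul, hθ, hθ, hθ, map_mul]) }, hθ⟩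

/-! ### Factorization of a cover through the maximal isogeny. -/

section Covers

variable {K : Type u} [Field K] {X Y : Over (Spec (.of K))} [IsVariety X] [IsVariety Y]

/-- Factorizations of the function field map of a cover come from factorizations of the cover. -/
theorem IsCover.exists_compHom_eq {π : Y.left ⤏ X.left} (hπ : IsCover π) [π.IsDominant]
    {Z : Over (Spec (.of K))} [IsVariety Z] (f : Z ⟶ X) [IsDominant f.left]
    (θ : Z.left.functionField ⟶ Y.left.functionField) (hθ : funMap f.left ≫ θ = ratMap π) :
    ∃ (ρ : Y.left ⤏ Z.left) (_ : ρ.IsDominant),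
      IsCover ρ ∧ ρ.compHom f.left = π ∧ ratMap ρ = θ := by
  have hf : (Spec.map θ ≫ gen Z.left) ≫ f.left = π.fromFunctionField := by
    rw [Category.assoc, ← map_funMap_gen, ← Category.assoc, ← Spec.map_comp, hθ, map_ratMap_gen]
  have hw : (Spec.map θ ≫ gen Z.left) ≫ Z.hom = gen Y.left ≫ Y.hom := by
    rw [← Over.w f, ← Category.assoc, hf, ← fromFunctionField_compHom, hπ.isOver,
      fromFunctionField_toRationalMap']
  let ρ := Scheme.RationalMap.equivFunctionField Y.hom Z.hom ⟨_, hw⟩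
  have hρ : ρ.1.fromFunctionField = Spec.map θ ≫ gen Z.left :=
    Scheme.RationalMap.fromFunctionField_ofFunctionField _ _ _ _
  have hdom : ρ.1.IsDominant := by
    rw [isDominant_iff_fromFunctionField, hρ, Scheme.Hom.comp_apply, gen_apply]
  have hrat : ratMap ρ.1 = θ := map_gen_injective ((map_ratMap_gen _).trans hρ)
  refine ⟨ρ.1, hdom, ⟨ρ.2, hdom, ?_⟩, ?_, hrat⟩
  · rw [functionFieldMap_finite_iff, hrat]
    have := (functionFieldMap_finite_iff π).mp hπ.finite
    rw [← hθ] at this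
    exact RingHom.Finite.of_comp_finite this
  · refine Scheme.RationalMap.eq_of_fromFunctionField_eq _ _ ?_
    rw [fromFunctionField_compHom, hρ, hf]

variable [GrpObj X] [IsCommMonObj X] [IsAlgClosed K] [CharZero K]

/-- A subfield of `K(Y)` over `K(X)` which embeds into `K(X)` over `K(X)` viewed as an extension of
itself by some `[m]`. -/
def EmbedsViaMulBy {M : Type u} [Field M] (ψ : X.left.functionField →+* M) (S : Subfield M) : Prop :=
  ∃ (h : ∀ x, ψ x ∈ S) (m : ℕ) (_ : 0 < m) (_ : IsDominant (mulBy X m).left)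
    (σ : S →+* X.left.functionField), ∀ x, σ ⟨ψ x, h x⟩ = funMap (mulBy X m).left x

omit [IsAlgClosed K] in
-- Taking `m = 1` shows that the family from which a maximal subfield is drawn is non-empty.
theorem embedsViaMulBy_fieldRange {M : Type u} [Field M] (ψ : X.left.functionField →+* M) :
    EmbedsViaMulBy ψ ψ.fieldRange := by
  have := isDominant_mulBy (X := X) 1 one_pos
  obtain ⟨σ, hσ⟩ := exists_comp_eq_of_fieldRange_le ψ ψ.fieldRange.subtype
    (by rintro _ ⟨x, rfl⟩; exact x.2)
  refine ⟨fun x => ⟨x, rfl⟩, 1, one_pos, this, σ, fun x => ?_⟩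
  have h1 : funMap (mulBy X 1).left = 𝟙 _ :=
    (funMap_congr (by rw [mulBy_one, Over.id_left])).trans funMap_id
  rw [h1]
  exact ψ.injective (hσ _)

theorem exists_isogeny_satisfiesPB (π : Y.left ⤏ X.left) (hπ : IsCover π) :
    ∃ (Z : Over (Spec (.of K))) (_ : IsVariety Z) (_ : GrpObj Z) (_ : IsCommMonObj Z)
      (f : Z ⟶ X) (ρ : Y.left ⤏ Z.left),
      IsIsogeny f ∧ IsCover ρ ∧ ρ.compHom f.left = π ∧ SatisfiesPB ρ := by
  have := hπ.dominant
  have hfin := (functionFieldMap_finite_iff π).mp hπ.finite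
  obtain ⟨S, ⟨hS, m, hm, hdm, σ, hσ⟩, hmax⟩ := exists_maximal_subfield (ratMap π).hom hfin
    (P := EmbedsViaMulBy (ratMap π).hom) (fun S hS => hS.choose)
    (embedsViaMulBy_fieldRange (ratMap π).hom)
  obtain ⟨Z, hZ, hgrp, hcomm, q, f, hq, hqmon, hf, hqf, hrange⟩ := exists_isogeny_of_subfield hm
    (F := σ.fieldRange) fun x => ⟨_, hσ x⟩
  have hfs := hf.surjective
  have hfd : IsDominant f.left := inferInstance
  -- Both `K(Z)` and `S` have image `σ(S)` in `K(X)`, so `θ` identifies `K(Z)` with `S`; composed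
  -- with the inclusion it defines `ρ`.
  obtain ⟨θ, hθ⟩ := exists_comp_eq_of_fieldRange_le σ (funMap q.left).hom hrange.le
  have hqf' (x) : funMap q.left (funMap f.left x) = funMap (mulBy X m).left x := by
    rw [← CommRingCat.comp_apply, ← funMap_comp]
    exact congr($(funMap_congr (by rw [← hqf, Over.comp_left])) x)
  have hθS : (S.subtype.comp θ).fieldRange = S := by
    refine le_antisymm ?_ fun x hx => ?_
    · rintro _ ⟨z, rfl⟩
      exact (θ z).2
    · obtain ⟨z, hz⟩ := hrange.ge ⟨⟨x, hx⟩, rfl⟩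
      exact ⟨z, congrArg Subtype.val (σ.injective ((hθ z).trans hz))⟩
  have hθf (x) : θ (funMap f.left x) = ⟨ratMap π x, hS x⟩ :=
    σ.injective ((hθ _).trans ((hqf' x).trans (hσ x).symm))
  obtain ⟨ρ, hρd, hρ, hcomp, hrat⟩ := hπ.exists_compHom_eq f (CommRingCat.ofHom (S.subtype.comp θ))
    (by ext x; exact congrArg Subtype.val (hθf x))
  refine ⟨Z, hZ, hgrp, hcomm, f, ρ, hf, hρ, hcomp, fun n hn => ?_⟩
  have := isDominant_mulBy (X := Z) n hn
  rw [irreducibleSpace_pullbackMulBy_iff ρ ((functionFieldMap_finite_iff ρ).mp hρ.finite) hn, hrat]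
  rintro S' hS' ⟨σ', hσ'⟩
  refine le_of_le_of_eq (hmax S' ?_ ?_) hθS.symm
  -- An embedding of `S'` into the extension `[n]^*` of `K(Z)`, followed by the pull-back along `q`,
  -- is an embedding over `K(X)` into the extension `[n * m]^*`, since `q ≫ [n] ≫ f = [n * m]`. So
  -- `S'` belongs to the family in which `S` is maximal.
  · have hdom := isDominant_mulBy (X := X) (n * m) (Nat.mul_pos hn hm)
    have hmem (x) : (ratMap π).hom x ∈ S' := by
      have := hS' (funMap f.left x)
      exact (congrArg (· ∈ S') (congrArg Subtype.val (hθf x))).mp this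
    refine ⟨hmem, n * m, Nat.mul_pos hn hm, hdom, (funMap q.left).hom.comp σ', fun x => ?_⟩
    have h1 : (⟨(ratMap π).hom x, hmem x⟩ : S') = ⟨_, hS' (funMap f.left x)⟩ :=
      Subtype.ext (congrArg Subtype.val (hθf x)).symm
    have h2 : mulBy X (n * m) = q ≫ mulBy Z n ≫ f := by
      rw [← mulBy_comp_mulBy, ← hqf, ← Category.assoc, ← Category.assoc, comp_mulBy, mulBy,
        MonObj.pow_comp, Category.id_comp]
    rw [h1]
    refine (congrArg (funMap q.left) (hσ' _)).trans ?_
    rw [← CommRingCat.comp_apply, ← CommRingCat.comp_apply, ← funMap_comp, ← funMap_comp]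
    exact congr($(funMap_congr (by rw [h2, Over.comp_left, Over.comp_left, Category.assoc])) x)
  · rw [← hθS]
    rintro _ ⟨z, rfl⟩
    exact hS' z

end Covers

end CoverPB

theorem proposition2p1 {K : Type u} [Field K] [IsAlgClosed K] [CharZero K]
    (X Y : Over (Spec (.of K))) [CoverPB.IsVariety X] [GrpObj X] [IsCommMonObj X]
    [CoverPB.IsVariety Y] (π : Y.left ⤏ X.left) (hπ : CoverPB.IsCover π)
    (d : ℕ) (hd : CoverPB.degree π = d) :
    (CoverPB.SatisfiesPB π ↔ IrreducibleSpace (CoverPB.pullbackMulBy d π)) ∧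
    ∃ (Z : Over (Spec (.of K))) (_ : CoverPB.IsVariety Z) (_ : GrpObj Z) (_ : IsCommMonObj Z)
      (isog : Z ⟶ X) (ρ : Y.left ⤏ Z.left),
      CoverPB.IsIsogeny isog ∧ CoverPB.IsCover ρ ∧ ρ.compHom isog.left = π ∧
      CoverPB.SatisfiesPB ρ :=
  ⟨CoverPB.satisfiesPB_iff π hπ hd, CoverPB.exists_isogeny_satisfiesPB π hπ⟩
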